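/- **Definitions.** Arithmetical formulas are built from $0,1,+,\cdot,<,=$ with the primitive connectives $\neg,\wedge,\vee,\to,\exists,\forall$ ($\neg$ does not count as an implication). A candidate witness is an infinite sequence of input-output pairs and whitespace; inputs and outputs are listed in the order of decreasing scope. The output of a pair is uniquely determined by its input, and it is preserved when initial segments of candidate witnesses in the input are extended. $W$ is a *witness* for: an atomic formula or a negation, if that formula is (classically) true; $A\wedge B$, if on input $0$, respectively $1$, it provides a witness for $A$, respectively $B$; $A\vee B$, if it outputs a choice $0$ or $1$ of $A$ or $B$ and provides a witness for the chosen formula; $\exists x\,A(x)$, if it outputs some $n$ and provides a witness for $A(n)$; $\forall x\,A(x)$, if on every input $n$ it provides a witness for $A(n)$; $A\to B$, if for every witness $X$ for $A$, $W_X$ is a witness for $B$, where $W_X$ consists of the pairs of $W$ whose first input is a finite initial segment of $X$, with this input removed. A sentence $A$ is *constructively true*, written $\Box A$, if it has a recursive witness. (This is realizability by a recursive function in the sense of Kleene's function realizability.) A set $S\subseteq\mathbb N$ is $\Pi^1_1$ if $S=\{n:\forall X\subseteq\mathbb N\ \varphi(n,X)\}$ for some arithmetical formula $\varphi$ with a set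 variable $X$; hardness and completeness refer to recursive many-one reductions; sentences are identified with their Gödel numbers. **Theorem 1.** 1. The set of constructively true arithmetical sentences is $\Pi^1_1$-hard. 2. The set of constructively true arithmetical sentences of the form $A\to B$, where $\to$ occurs neither in $A$ nor in $B$, is $\Pi^1_1$-complete. 3. There is an arithmetical sequence $x=(x_0,x_1,\dots)$ of sets of natural numbers, definable by a formula $\xi(n,i)$ for $i\in x_n$ without $\to$, such that for every $n$, $x_n$ is not recursive in the sequence $x$ with $x_n$ replaced by $\emptyset$. 4. Let $x$ be any arithmetical sequence with this property, defined by a formula $\xi(n,i)$, and let $P(n)$ be $\forall i\,(\neg\neg\xi(n,i)\vee\neg\xi(n,i))$. Let $T$ be a tree of finite sequences of natural numbers (closed under initial segments). Let "$s$ has length $n$", "$s\in T$" and "$s$ is incompatible with $t$" be expressed by formulas $\theta$ about codes of sequences that are constructively decidable, i.e. the universal closure of $\theta\vee\neg\theta$ is constructively true. Then $T$ has no infinite path if and only if $$\Box\bigl(\forall n\,\exists s\,(s\text{ has length }n\ \wedge\ s\in T\ \wedge\ P(s))\ \to\ \exists s\,\exists t\,(s\text{ is incompatible with }t\ \wedge\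 P(s)\wedge P(t))\bigr).$$ 5. Constructively decidable formulas without $\to$ exist for "$s$ has length $n$", for "$s$ is incompatible with $t$", and for "$s\in T$" for every recursive tree $T$; moreover, for fixed $\xi$, the sentence in 4 can be obtained recursively from a program that decides $T$. -/

import Mathlib

/-! ### Arithmetical formulas -/

/-- Terms over `0`, `1`, `+`, `*`; variables are de Bruijn indices. -/
inductive Term where
  | var : ℕ → Term
  | zero : Term
  | one : Term
  | add : Term → Term → Term
  | mul : Term → Term → Term

/-- First order formulas of arithmetic with, in addition, a unary predicate symbol for every element
of `P`.  All connectives are primitive; `neg` is not an implication.  The quantifiers `ex` and `all`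
bind the variable `0` and shift the other ones. -/
inductive Form (P : Type) where
  | eq : Term → Term → Form P
  | lt : Term → Term → Form P
  | pred : P → Term → Form P
  | neg : Form P → Form P
  | and : Form P → Form P → Form P
  | or : Form P → Form P → Form P
  | imp : Form P → Form P → Form P
  | ex : Form P → Form P
  | all : Form P → Form P

/-- Arithmetical formulas: no additional predicate symbols. -/
abbrev ArithForm := Form Empty

/-- The assignment `e` with the value `n` put in front, for the variable `0`. -/
def push (n : ℕ) (e : ℕ → ℕ) : ℕ → ℕ
  | 0 => n
  | k + 1 => e k

namespace Term

def eval (e : ℕ → ℕ) : Term → ℕ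
  | var k => e k
  | zero => 0
  | one => 1
  | add s t => s.eval e + t.eval e
  | mul s t => s.eval e * t.eval e

/-- All variables are smaller than `b`. -/
def FreeBelow (b : ℕ) : Term → Prop
  | var k => k < b
  | zero => True
  | one => True
  | add s t => s.FreeBelow b ∧ t.FreeBelow b
  | mul s t => s.FreeBelow b ∧ t.FreeBelow b

def rename (r : ℕ → ℕ) : Term → Term
  | var k => var (r k)
  | zero => zero
  | one => one
  | add s t => add (s.rename r) (t.rename r)
  | mul s t => mul (s.rename r) (t.rename r)

/-- Gödel number of a term. -/
def code : Term → ℕ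
  | var k => Nat.pair 0 k
  | zero => Nat.pair 1 0
  | one => Nat.pair 2 0
  | add s t => Nat.pair 3 (Nat.pair s.code t.code)
  | mul s t => Nat.pair 4 (Nat.pair s.code t.code)

end Term

namespace Form

/-- Classical truth in the standard model, with `I` interpreting the predicate symbols. -/
def Holds {P : Type} (I : P → Set ℕ) : (ℕ → ℕ) → Form P → Prop
  | e, eq s t => s.eval e = t.eval e
  | e, lt s t => s.eval e < t.eval e
  | e, pred p t => t.eval e ∈ I p
  | e, neg A => ¬ A.Holds I e
  | e, and A B => A.Holds I e ∧ B.Holds I e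
  | e, or A B => A.Holds I e ∨ B.Holds I e
  | e, imp A B => A.Holds I e → B.Holds I e
  | e, ex A => ∃ n, A.Holds I (push n e)
  | e, all A => ∀ n, A.Holds I (push n e)

/-- All free variables are smaller than `b`. -/
def FreeBelow {P : Type} : ℕ → Form P → Prop
  | b, eq s t => s.FreeBelow b ∧ t.FreeBelow b
  | b, lt s t => s.FreeBelow b ∧ t.FreeBelow b
  | b, pred _ t => t.FreeBelow b
  | b, neg A => A.FreeBelow b
  | b, and A B => A.FreeBelow b ∧ B.FreeBelow b
  | b, or A B => A.FreeBelow b ∧ B.FreeBelow b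
  | b, imp A B => A.FreeBelow b ∧ B.FreeBelow b
  | b, ex A => A.FreeBelow (b + 1)
  | b, all A => A.FreeBelow (b + 1)

/-- Statements, i.e. formulas without free variables. -/
def IsSentence {P : Type} (A : Form P) : Prop := A.FreeBelow 0

/-- `→` does not occur. -/
def ImpFree {P : Type} : Form P → Prop
  | eq _ _ => True
  | lt _ _ => True
  | pred _ _ => True
  | neg A => A.ImpFree
  | and A B => A.ImpFree ∧ B.ImpFree
  | or A B => A.ImpFree ∧ B.ImpFree
  | imp _ _ => False
  | ex A => A.ImpFree
  | all A => A.ImpFree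

/-- Renaming `r` of variables, carried under a quantifier. -/
def liftRen (r : ℕ → ℕ) : ℕ → ℕ
  | 0 => 0
  | k + 1 => r k + 1

/-- Renaming of the free variables. -/
def rename {P : Type} : (ℕ → ℕ) → Form P → Form P
  | r, eq s t => eq (s.rename r) (t.rename r)
  | r, lt s t => lt (s.rename r) (t.rename r)
  | r, pred p t => pred p (t.rename r)
  | r, neg A => neg (A.rename r)
  | r, and A B => and (A.rename r) (B.rename r)
  | r, or A B => or (A.rename r) (B.rename r)
  | r, imp A B => imp (A.rename r) (B.rename r)
  | r, ex A => ex (A.rename (liftRen r))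
  | r, all A => all (A.rename (liftRen r))

/-- Gödel number of an arithmetical formula. -/
def code : ArithForm → ℕ
  | eq s t => Nat.pair 0 (Nat.pair s.code t.code)
  | lt s t => Nat.pair 1 (Nat.pair s.code t.code)
  | pred p _ => nomatch p
  | neg A => Nat.pair 2 A.code
  | and A B => Nat.pair 3 (Nat.pair A.code B.code)
  | or A B => Nat.pair 4 (Nat.pair A.code B.code)
  | imp A B => Nat.pair 5 (Nat.pair A.code B.code)
  | ex A => Nat.pair 6 A.code
  | all A => Nat.pair 7 A.code

/-- Classical truth of an arithmetical formula under an assignment. -/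
def IsTrue (e : ℕ → ℕ) (A : ArithForm) : Prop := A.Holds (fun p => nomatch p) e

end Form

/-! ### Witnesses -/

/-- An input-output pair `(i₁, i₂, … : o₁, o₂, …)`.  Inputs and outputs are listed in the order of
decreasing scope.  An input is a number (for `∀`), `0` or `1` (the chosen conjunct, for `∧`) or
the code of a finite initial segment of a candidate witness of the antecedent (for `→`); an output is
a number (for `∃`) or `0` or `1` (the chosen disjunct, for `∨`). -/
abbrev InOut := List ℕ × List ℕ

/-- Candidate witnesses: infinite sequences of input-output pairs and whitespace (`none`). -/
abbrev Cand := ℕ → Option InOut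

namespace Cand

/-- The pairs with first input `n`, this input being removed. -/
def onInput (W : Cand) (n : ℕ) : Cand := fun k =>
  match W k with
  | some (m :: i, o) => if m = n then some (i, o) else none
  | _ => none

/-- The pairs with first output `n`, this output being removed. -/
def onOutput (W : Cand) (n : ℕ) : Cand := fun k =>
  match W k with
  | some (i, m :: o) => if m = n then some (i, o) else none
  | _ => none

/-- The finite sequence `σ` is an initial segment of `X`. -/
def IsSegment (σ : List (Option InOut)) (X : Cand) : Prop :=
  σ = (List.range σ.length).map X

instance (σ : List (Option InOut)) (X : Cand) : Decidable (IsSegment σ X) :=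
  inferInstanceAs (Decidable (_ = _))

/-- `W` applied to `X`: the pairs whose first input is (the code of) an initial segment of `X`, this
input being removed. -/
def app (W X : Cand) : Cand := fun k =>
  match W k with
  | some (c :: i, o) =>
    match (Encodable.decode c : Option (List (Option InOut))) with
    | some σ => if IsSegment σ X then some (i, o) else none
    | none => none
  | _ => none

/-- `n` is the first output of some pair of `W`. -/
def Gives (W : Cand) (n : ℕ) : Prop := ∃ k i o, W k = some (i, n :: o)

end Cand

namespace Form

/-- `W` has the right syntactic form for a witness of `A`: every pair is a (possibly incomplete) list
of inputs and outputs as described by `A`, and output is unique, i.e. at every occurrence of `∃` or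
`∨` at most one choice is made for given input, input that is an initial segment of a candidate
witness being identified with its extensions. -/
def WellFormed : ArithForm → Cand → Prop
  | eq _ _, W => ∀ k p, W k = some p → p = ([], [])
  | lt _ _, W => ∀ k p, W k = some p → p = ([], [])
  | pred p _, _ => nomatch p
  | neg _, W => ∀ k p, W k = some p → p = ([], [])
  | and A B, W =>
      (∀ k p, W k = some p → p = ([], []) ∨ ∃ j i o, j < 2 ∧ p = (j :: i, o)) ∧
      A.WellFormed (W.onInput 0) ∧ B.WellFormed (W.onInput 1)
  | or A B, W =>
      (∀ k p, W k = some p → p = ([], []) ∨ ∃ j i o, j < 2 ∧ p = (i, j :: o)) ∧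
      (∀ m n, W.Gives m → W.Gives n → m = n) ∧
      A.WellFormed (W.onOutput 0) ∧ B.WellFormed (W.onOutput 1)
  | imp A B, W =>
      (∀ k p, W k = some p → p = ([], []) ∨
        ∃ (σ : List (Option InOut)) (i o : List ℕ), p = (Encodable.encode σ :: i, o)) ∧
      ∀ X : Cand, A.WellFormed X → B.WellFormed (W.app X)
  | ex A, W =>
      (∀ k p, W k = some p → p = ([], []) ∨ ∃ n i o, p = (i, n :: o)) ∧
      (∀ m n, W.Gives m → W.Gives n → m = n) ∧
      ∀ n, A.WellFormed (W.onOutput n)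
  | all A, W =>
      (∀ k p, W k = some p → p = ([], []) ∨ ∃ n i o, p = (n :: i, o)) ∧
      ∀ n, A.WellFormed (W.onInput n)

/-- The well-formed candidate `W` provides correct and sufficient output. -/
def Correct : (ℕ → ℕ) → ArithForm → Cand → Prop
  | e, eq s t, _ => s.eval e = t.eval e
  | e, lt s t, _ => s.eval e < t.eval e
  | _, pred p _, _ => nomatch p
  | e, neg A, _ => ¬ A.IsTrue e
  | e, and A B, W => A.Correct e (W.onInput 0) ∧ B.Correct e (W.onInput 1)
  | e, or A B, W =>
      (W.Gives 0 ∧ A.Correct e (W.onOutput 0)) ∨ (W.Gives 1 ∧ B.Correct e (W.onOutput 1))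
  | e, imp A B, W => ∀ X : Cand, A.WellFormed X → A.Correct e X → B.Correct e (W.app X)
  | e, ex A, W => ∃ n, W.Gives n ∧ A.Correct (push n e) (W.onOutput n)
  | e, all A, W => ∀ n, A.Correct (push n e) (W.onInput n)

/-- `W` is a witness for the formula `A` under the assignment `e`. -/
def IsWitness (e : ℕ → ℕ) (A : ArithForm) (W : Cand) : Prop :=
  A.WellFormed W ∧ A.Correct e W

/-- Constructive truth of a statement: it has a recursive witness. -/
def ConstructivelyTrue (A : ArithForm) : Prop :=
  ∃ W : Cand, Computable W ∧ A.IsWitness (fun _ => 0) W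

end Form

/-! ### `Π¹₁` sets -/

/-- `S` is `Π¹₁`: for some arithmetical formula `φ(n, X)` with a set variable `X`, `n ∈ S` iff
`φ(n, X)` holds for all sets `X`. -/
def IsPi11 (S : Set ℕ) : Prop :=
  ∃ φ : Form Unit, φ.FreeBelow 1 ∧
    ∀ n, n ∈ S ↔ ∀ X : Set ℕ, φ.Holds (fun _ => X) (push n fun _ => 0)

/-- Every `Π¹₁` set is many-one reducible to `C`. -/
def Pi11Hard (C : Set ℕ) : Prop :=
  ∀ S : Set ℕ, IsPi11 S → ManyOneReducible (fun n => n ∈ S) (fun n => n ∈ C)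

def Pi11Complete (C : Set ℕ) : Prop := IsPi11 C ∧ Pi11Hard C

/-- The set of (Gödel numbers of) constructively true arithmetical statements. -/
def constructiveTruth : Set ℕ :=
  {c | ∃ A : ArithForm, A.IsSentence ∧ A.ConstructivelyTrue ∧ A.code = c}

/-- The set of (Gödel numbers of) constructively true arithmetical statements `A → B` with `A` and `B`
free of `→`. -/
def simpleConstructiveTruth : Set ℕ :=
  {c | ∃ A B : ArithForm, A.ImpFree ∧ B.ImpFree ∧ (A.imp B).IsSentence ∧
    (A.imp B).ConstructivelyTrue ∧ (A.imp B).code = c}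

/-! ### Trees and the reduction -/

/-- A tree of finite sequences: closed under initial segments. -/
def IsSeqTree (T : Set (List ℕ)) : Prop := ∀ s t : List ℕ, s <+: t → t ∈ T → s ∈ T

/-- The tree `T` has no infinite path. -/
def WellFoundedTree (T : Set (List ℕ)) : Prop :=
  ¬ ∃ p : ℕ → ℕ, ∀ n, (List.range n).map p ∈ T

/-- The program `c` computes the characteristic function of `T`. -/
def Decides (c : Nat.Partrec.Code) (T : Set (List ℕ)) : Prop :=
  ∀ s : List ℕ, (s ∈ T → c.eval (Encodable.encode s) = Part.some 1) ∧
    (s ∉ T → c.eval (Encodable.encode s) = Part.some 0)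

open Classical in
/-- Characteristic function of a set, as an oracle. -/
noncomputable def charFun (A : Set ℕ) : ℕ →. ℕ := fun n => Part.some (if n ∈ A then 1 else 0)

/-- The sequence `x₀, x₁, …` of sets with `xₙ` replaced by the empty set, as one set of numbers. -/
def joinWithout (x : ℕ → Set ℕ) (n : ℕ) : Set ℕ :=
  {k | k.unpair.1 ≠ n ∧ k.unpair.2 ∈ x k.unpair.1}

/-- No `xₙ` is recursive in the sequence of the other ones. -/
def Independent (x : ℕ → Set ℕ) : Prop :=
  ∀ n, ¬ TuringReducible (charFun (x n)) (charFun (joinWithout x n))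

namespace Form

/-- The sequence of sets defined by `ξ`: the variable `0` of `ξ` is the element `i`, the variable `1`
is the index `n`. -/
def family (ξ : ArithForm) (n : ℕ) : Set ℕ := {i | ξ.IsTrue (push i (push n fun _ => 0))}

/-- `∀ i (¬¬ xₙ(i) ∨ ¬ xₙ(i))`, where `n` is the variable `v`. -/
def deciding (ξ : ArithForm) (v : ℕ) : ArithForm :=
  let ξ' := ξ.rename fun k => if k = 0 then 0 else v + 1
  all (or (neg (neg ξ')) (neg ξ'))

/-- `∀ n ∃ s (s has length n ∧ s ∈ T ∧ P(s)) → ∃ s ∃ t (s, t are incompatible ∧ P(s) ∧ P(t))`, where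
`len`, `tree`, `inc` express that the sequence coded by the variable `0` has length the variable `1`,
that it lies in `T`, and that it is incompatible with the sequence coded by the variable `1`. -/
def pathSentence (ξ len tree inc : ArithForm) : ArithForm :=
  imp
    (all (ex (and len (and tree (deciding ξ 0)))))
    (ex (ex (and inc (and (deciding ξ 1) (deciding ξ 0)))))

/-- `len` is a constructively decidable formula for "the sequence (coded by) `0` has length `1`". -/
def ExpressesLength (len : ArithForm) : Prop :=
  len.FreeBelow 2 ∧ (all (all (or len (neg len)))).ConstructivelyTrue ∧
    ∀ (s : List ℕ) (n : ℕ),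
      len.IsTrue (push (Encodable.encode s) (push n fun _ => 0)) ↔ s.length = n

/-- `inc` is a constructively decidable formula for "the sequences `0` and `1` are incompatible". -/
def ExpressesIncompatible (inc : ArithForm) : Prop :=
  inc.FreeBelow 2 ∧ (all (all (or inc (neg inc)))).ConstructivelyTrue ∧
    ∀ s t : List ℕ,
      inc.IsTrue (push (Encodable.encode s) (push (Encodable.encode t) fun _ => 0)) ↔
        ¬ s <+: t ∧ ¬ t <+: s

/-- `tree` is a constructively decidable formula for "the sequence `0` lies in `T`". -/
def ExpressesTree (tree : ArithForm) (T : Set (List ℕ)) : Prop :=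
  tree.FreeBelow 1 ∧ (all (or tree (neg tree))).ConstructivelyTrue ∧
    ∀ s : List ℕ, tree.IsTrue (push (Encodable.encode s) fun _ => 0) ↔ s ∈ T

end Form

open Encodable

/-! ### Renaming and free variables -/

namespace Term

theorem eval_rename (r : ℕ → ℕ) (e : ℕ → ℕ) (t : Term) : (t.rename r).eval e = t.eval (e ∘ r) := by
  induction t with
  | var k => rfl
  | zero => rfl
  | one => rfl
  | add s t hs ht => simp [rename, eval, hs, ht]
  | mul s t hs ht => simp [rename, eval, hs, ht]

theorem eval_congr {b : ℕ} {t : Term} (h : t.FreeBelow b) {e e' : ℕ → ℕ}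
    (he : ∀ k < b, e k = e' k) : t.eval e = t.eval e' := by
  induction t with
  | var k => exact he k h
  | zero => rfl
  | one => rfl
  | add s t hs ht => simp [eval, hs h.1, ht h.2]
  | mul s t hs ht => simp [eval, hs h.1, ht h.2]

theorem freeBelow_rename {b : ℕ} {r : ℕ → ℕ} (hr : ∀ k, r k < b) (t : Term) :
    (t.rename r).FreeBelow b := by
  induction t with
  | var k => exact hr k
  | zero => trivial
  | one => trivial
  | add s t hs ht => exact ⟨hs, ht⟩
  | mul s t hs ht => exact ⟨hs, ht⟩

theorem code_injective : Function.Injective code := by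
  intro s
  induction s with
  | var k => intro t h; cases t <;> simp_all [code, Nat.pair_eq_pair]
  | zero => intro t h; cases t <;> simp_all [code, Nat.pair_eq_pair]
  | one => intro t h; cases t <;> simp_all [code, Nat.pair_eq_pair]
  | add s₁ s₂ h₁ h₂ =>
    intro t h
    cases t <;> simp [code, Nat.pair_eq_pair] at h
    rw [h₁ h.1, h₂ h.2]
  | mul s₁ s₂ h₁ h₂ =>
    intro t h
    cases t <;> simp [code, Nat.pair_eq_pair] at h
    rw [h₁ h.1, h₂ h.2]

end Term

theorem push_comp_liftRen (n : ℕ) (e r : ℕ → ℕ) :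
    push n e ∘ Form.liftRen r = push n (e ∘ r) := by
  funext k; cases k <;> rfl

theorem push_congr {b : ℕ} {e e' : ℕ → ℕ} (he : ∀ k < b, e k = e' k) (n : ℕ) :
    ∀ k < b + 1, push n e k = push n e' k := by
  intro k hk
  cases k with
  | zero => rfl
  | succ k => exact he k (by omega)

namespace Form

variable {P : Type}

theorem holds_rename (I : P → Set ℕ) (A : Form P) (r e : ℕ → ℕ) :
    (A.rename r).Holds I e ↔ A.Holds I (e ∘ r) := by
  induction A generalizing r e with
  | eq s t => simp [rename, Holds, Term.eval_rename]
  | lt s t => simp [rename, Holds, Term.eval_rename]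
  | pred p t => simp [rename, Holds, Term.eval_rename]
  | neg A h => simp [rename, Holds, h]
  | and A B hA hB => simp [rename, Holds, hA, hB]
  | or A B hA hB => simp [rename, Holds, hA, hB]
  | imp A B hA hB => simp [rename, Holds, hA, hB]
  | ex A h => simp [rename, Holds, h, push_comp_liftRen]
  | all A h => simp [rename, Holds, h, push_comp_liftRen]

theorem holds_congr (I : P → Set ℕ) {A : Form P} {b : ℕ} (hA : A.FreeBelow b) {e e' : ℕ → ℕ}
    (he : ∀ k < b, e k = e' k) : A.Holds I e ↔ A.Holds I e' := by
  induction A generalizing b e e' with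
  | eq s t => simp [Holds, Term.eval_congr hA.1 he, Term.eval_congr hA.2 he]
  | lt s t => simp [Holds, Term.eval_congr hA.1 he, Term.eval_congr hA.2 he]
  | pred p t => simp [Holds, Term.eval_congr hA he]
  | neg A h => simp [Holds, h hA he]
  | and A B h₁ h₂ => simp [Holds, h₁ hA.1 he, h₂ hA.2 he]
  | or A B h₁ h₂ => simp [Holds, h₁ hA.1 he, h₂ hA.2 he]
  | imp A B h₁ h₂ => simp [Holds, h₁ hA.1 he, h₂ hA.2 he]
  | ex A h => exact exists_congr fun n => h hA (push_congr he n)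
  | all A h => exact forall_congr' fun n => h hA (push_congr he n)

theorem isTrue_congr {A : ArithForm} {b : ℕ} (hA : A.FreeBelow b) {e e' : ℕ → ℕ}
    (he : ∀ k < b, e k = e' k) : A.IsTrue e ↔ A.IsTrue e' := holds_congr _ hA he

theorem freeBelow_rename {b : ℕ} {r : ℕ → ℕ} (hr : ∀ k, r k < b) (A : Form P) :
    (A.rename r).FreeBelow b := by
  have lift : ∀ {b : ℕ} {r : ℕ → ℕ}, (∀ k, r k < b) → ∀ k, liftRen r k < b + 1 := by
    intro b r hr k
    cases k with
    | zero => exact Nat.succ_pos b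
    | succ k => exact Nat.succ_lt_succ (hr k)
  induction A generalizing b r with
  | eq s t => exact ⟨s.freeBelow_rename hr, t.freeBelow_rename hr⟩
  | lt s t => exact ⟨s.freeBelow_rename hr, t.freeBelow_rename hr⟩
  | pred p t => exact t.freeBelow_rename hr
  | neg A h => exact h hr
  | and A B h₁ h₂ => exact ⟨h₁ hr, h₂ hr⟩
  | or A B h₁ h₂ => exact ⟨h₁ hr, h₂ hr⟩
  | imp A B h₁ h₂ => exact ⟨h₁ hr, h₂ hr⟩
  | ex A h => exact h (lift hr)
  | all A h => exact h (lift hr)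

theorem ImpFree.rename {A : Form P} (hA : A.ImpFree) (r : ℕ → ℕ) : (A.rename r).ImpFree := by
  induction A generalizing r with
  | eq s t => trivial
  | lt s t => trivial
  | pred p t => trivial
  | neg A h => exact h hA r
  | and A B h₁ h₂ => exact ⟨h₁ hA.1 r, h₂ hA.2 r⟩
  | or A B h₁ h₂ => exact ⟨h₁ hA.1 r, h₂ hA.2 r⟩
  | imp A B h₁ h₂ => exact hA.elim
  | ex A h => exact h hA _
  | all A h => exact h hA _

theorem FreeBelow.mono {A : Form P} {b c : ℕ} (hA : A.FreeBelow b) (hbc : b ≤ c) :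
    A.FreeBelow c := by
  have term : ∀ {b c : ℕ} {t : Term}, t.FreeBelow b → b ≤ c → t.FreeBelow c := by
    intro b c t ht hbc
    induction t with
    | var k => exact lt_of_lt_of_le ht hbc
    | zero => trivial
    | one => trivial
    | add s t hs h => exact ⟨hs ht.1, h ht.2⟩
    | mul s t hs h => exact ⟨hs ht.1, h ht.2⟩
  induction A generalizing b c with
  | eq s t => exact ⟨term hA.1 hbc, term hA.2 hbc⟩
  | lt s t => exact ⟨term hA.1 hbc, term hA.2 hbc⟩
  | pred p t => exact term hA hbc
  | neg A h => exact h hA hbc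
  | and A B h₁ h₂ => exact ⟨h₁ hA.1 hbc, h₂ hA.2 hbc⟩
  | or A B h₁ h₂ => exact ⟨h₁ hA.1 hbc, h₂ hA.2 hbc⟩
  | imp A B h₁ h₂ => exact ⟨h₁ hA.1 hbc, h₂ hA.2 hbc⟩
  | ex A h => exact h hA (Nat.succ_le_succ hbc)
  | all A h => exact h hA (Nat.succ_le_succ hbc)

theorem code_injective : Function.Injective code := by
  intro A
  induction A with
  | eq s t =>
    intro B h
    cases B with
    | pred p => exact p.elim
    | _ => simp_all [code, Nat.pair_eq_pair, Term.code_injective.eq_iff]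
  | lt s t =>
    intro B h
    cases B with
    | pred p => exact p.elim
    | _ => simp_all [code, Nat.pair_eq_pair, Term.code_injective.eq_iff]
  | pred p => exact p.elim
  | neg A hA =>
    intro B h
    cases B with
    | pred p => exact p.elim
    | neg B => rw [hA (by simpa [code, Nat.pair_eq_pair] using h)]
    | _ => simp [code, Nat.pair_eq_pair] at h
  | ex A hA =>
    intro B h
    cases B with
    | pred p => exact p.elim
    | ex B => rw [hA (by simpa [code, Nat.pair_eq_pair] using h)]
    | _ => simp [code, Nat.pair_eq_pair] at h
  | all A hA =>
    intro B h
    cases B with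
    | pred p => exact p.elim
    | all B => rw [hA (by simpa [code, Nat.pair_eq_pair] using h)]
    | _ => simp [code, Nat.pair_eq_pair] at h
  | and A A' hA hA' =>
    intro B h
    cases B with
    | pred p => exact p.elim
    | and B B' =>
      simp only [code, Nat.pair_eq_pair, true_and] at h
      rw [hA h.1, hA' h.2]
    | _ => simp [code, Nat.pair_eq_pair] at h
  | or A A' hA hA' =>
    intro B h
    cases B with
    | pred p => exact p.elim
    | or B B' =>
      simp only [code, Nat.pair_eq_pair, true_and] at h
      rw [hA h.1, hA' h.2]
    | _ => simp [code, Nat.pair_eq_pair] at h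
  | imp A A' hA hA' =>
    intro B h
    cases B with
    | pred p => exact p.elim
    | imp B B' =>
      simp only [code, Nat.pair_eq_pair, true_and] at h
      rw [hA h.1, hA' h.2]
    | _ => simp [code, Nat.pair_eq_pair] at h

end Form

/-! ### Definable relations between assignments -/

/-- The assignment without the value of the variable `0`. -/
def tl (e : ℕ → ℕ) : ℕ → ℕ := fun k => e (k + 1)

/-- The relation `R` is defined by a formula without `→`. -/
def EnvDef {P : Type} (R : (P → Set ℕ) → (ℕ → ℕ) → Prop) : Prop :=
  ∃ φ : Form P, φ.ImpFree ∧ ∀ I e, φ.Holds I e ↔ R I e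

/-- The graph of `g` is defined by a formula without `→`. -/
def EnvFun (P : Type) (g : (ℕ → ℕ) → ℕ) : Prop :=
  EnvDef (P := P) fun _ e => e 0 = g (tl e)

namespace EnvDef

variable {P : Type} {R S : (P → Set ℕ) → (ℕ → ℕ) → Prop}

theorem of_iff (h : EnvDef R) (H : ∀ I e, R I e ↔ S I e) : EnvDef S :=
  let ⟨φ, h₁, h₂⟩ := h
  ⟨φ, h₁, fun I e => (h₂ I e).trans (H I e)⟩

theorem not (h : EnvDef R) : EnvDef fun I e => ¬ R I e :=
  let ⟨φ, h₁, h₂⟩ := h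
  ⟨φ.neg, h₁, fun I e => not_congr (h₂ I e)⟩

theorem and (h : EnvDef R) (h' : EnvDef S) : EnvDef fun I e => R I e ∧ S I e :=
  let ⟨φ, h₁, h₂⟩ := h
  let ⟨ψ, h₁', h₂'⟩ := h'
  ⟨φ.and ψ, ⟨h₁, h₁'⟩, fun I e => and_congr (h₂ I e) (h₂' I e)⟩

theorem or (h : EnvDef R) (h' : EnvDef S) : EnvDef fun I e => R I e ∨ S I e :=
  let ⟨φ, h₁, h₂⟩ := h
  let ⟨ψ, h₁', h₂'⟩ := h'
  ⟨φ.or ψ, ⟨h₁, h₁'⟩, fun I e => or_congr (h₂ I e) (h₂' I e)⟩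

theorem imp (h : EnvDef R) (h' : EnvDef S) : EnvDef fun I e => R I e → S I e :=
  (h.not.or h').of_iff fun _ _ => imp_iff_not_or.symm

theorem ex {R : (P → Set ℕ) → (ℕ → ℕ) → ℕ → Prop} (h : EnvDef fun I e => R I (tl e) (e 0)) :
    EnvDef fun I e => ∃ x, R I e x :=
  let ⟨φ, h₁, h₂⟩ := h
  ⟨φ.ex, h₁, fun I e => exists_congr fun n => h₂ I (push n e)⟩

theorem all {R : (P → Set ℕ) → (ℕ → ℕ) → ℕ → Prop} (h : EnvDef fun I e => R I (tl e) (e 0)) :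
    EnvDef fun I e => ∀ x, R I e x :=
  let ⟨φ, h₁, h₂⟩ := h
  ⟨φ.all, h₁, fun I e => forall_congr' fun n => h₂ I (push n e)⟩

theorem comp (h : EnvDef R) (r : ℕ → ℕ) : EnvDef fun I e => R I (e ∘ r) :=
  let ⟨φ, h₁, h₂⟩ := h
  ⟨φ.rename r, h₁.rename r, fun I e => (φ.holds_rename I r e).trans (h₂ I _)⟩

theorem eq_term (s t : Term) : EnvDef (P := P) fun _ e => s.eval e = t.eval e :=
  ⟨.eq s t, trivial, fun _ _ => Iff.rfl⟩

theorem lt_term (s t : Term) : EnvDef (P := P) fun _ e => s.eval e < t.eval e :=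
  ⟨.lt s t, trivial, fun _ _ => Iff.rfl⟩

theorem pred (p : P) (t : Term) : EnvDef fun I e => t.eval e ∈ I p :=
  ⟨.pred p t, trivial, fun _ _ => Iff.rfl⟩

/-- Substitution of definable functions for the variables of a binary relation. -/
theorem subst₁ {Q : (P → Set ℕ) → ℕ → Prop} (h : EnvDef fun I e => Q I (e 0))
    {f : (ℕ → ℕ) → ℕ} (hf : EnvFun P f) : EnvDef fun I e => Q I (f e) := by
  refine of_iff (R := fun I e => ∃ x, x = f e ∧ Q I x) (ex (and hf ?_)) (by simp)
  exact h

theorem subst₂ {Q : (P → Set ℕ) → ℕ → ℕ → Prop} (h : EnvDef fun I e => Q I (e 0) (e 1))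
    {f g : (ℕ → ℕ) → ℕ} (hf : EnvFun P f) (hg : EnvFun P g) :
    EnvDef fun I e => Q I (f e) (g e) := by
  refine of_iff (R := fun I e => ∃ x, x = f e ∧ ∃ y, y = g e ∧ Q I x y)
    (ex (and hf (ex (and ?_ ?_)))) (by simp)
  · exact EnvDef.comp hg (Form.liftRen Nat.succ)
  · exact h.comp fun k => if k = 0 then 1 else 0

end EnvDef

namespace EnvFun

variable {P : Type} {f g h : (ℕ → ℕ) → ℕ}

theorem term (t : Term) : EnvFun P fun e => t.eval e :=
  (EnvDef.eq_term (.var 0) (t.rename Nat.succ)).of_iff fun _ e => by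
    simp only [Term.eval_rename]; rfl

theorem var (k : ℕ) : EnvFun P fun e => e k := term (.var k)

theorem tl (hf : EnvFun P f) : EnvFun P fun e => f (tl e) :=
  EnvDef.comp hf (Form.liftRen Nat.succ)

theorem eq (hf : EnvFun P f) (hg : EnvFun P g) : EnvDef (P := P) fun _ e => f e = g e :=
  EnvDef.subst₂ (Q := fun _ x y => x = y) (EnvDef.eq_term (.var 0) (.var 1)) hf hg

theorem lt (hf : EnvFun P f) (hg : EnvFun P g) : EnvDef (P := P) fun _ e => f e < g e :=
  EnvDef.subst₂ (Q := fun _ x y => x < y) (EnvDef.lt_term (.var 0) (.var 1)) hf hg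

theorem comp₂ {F : ℕ → ℕ → ℕ} (hF : EnvFun P fun e => F (e 0) (e 1)) (hf : EnvFun P f)
    (hg : EnvFun P g) : EnvFun P fun e => F (f e) (g e) := by
  refine EnvDef.of_iff (R := fun I e => ∃ x, x = f (_root_.tl e) ∧ ∃ y, y = g (_root_.tl e) ∧
    e 0 = F x y) (EnvDef.ex ((eq (var 0) hf.tl.tl).and (EnvDef.ex ((eq (var 0) hg.tl.tl.tl).and ?_))))
    (by simp)
  exact (EnvDef.comp hF fun k => if k = 0 then 2 else if k = 1 then 1 else 0)

theorem add (hf : EnvFun P f) (hg : EnvFun P g) : EnvFun P fun e => f e + g e :=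
  comp₂ (F := (· + ·)) (term (.add (.var 0) (.var 1))) hf hg

theorem mul (hf : EnvFun P f) (hg : EnvFun P g) : EnvFun P fun e => f e * g e :=
  comp₂ (F := (· * ·)) (term (.mul (.var 0) (.var 1))) hf hg

theorem zero : EnvFun P fun _ => 0 := term .zero

theorem one : EnvFun P fun _ => 1 := term .one

theorem natPair (hf : EnvFun P f) (hg : EnvFun P g) : EnvFun P fun e => Nat.pair (f e) (g e) := by
  refine comp₂ (F := Nat.pair) ?_ hf hg
  refine EnvDef.of_iff (R := fun _ e => (e 1 < e 2 ∧ e 0 = e 2 * e 2 + e 1) ∨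
    (¬ e 1 < e 2 ∧ e 0 = e 1 * e 1 + e 1 + e 2)) ?_ ?_
  · exact ((lt (var 1) (var 2)).and (eq (var 0) (((var 2).mul (var 2)).add (var 1)))).or
      ((lt (var 1) (var 2)).not.and
        (eq (var 0) ((((var 1).mul (var 1)).add (var 1)).add (var 2))))
  · intro I e
    show _ ↔ e 0 = Nat.pair (e 1) (e 2)
    by_cases h : e 1 < e 2 <;> simp [Nat.pair, h]

theorem unpair_fst (hf : EnvFun P f) : EnvFun P fun e => (f e).unpair.1 := by
  refine EnvDef.of_iff (R := fun _ e => ∃ y, f (_root_.tl e) = Nat.pair (e 0) y)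
    (EnvDef.ex (eq hf.tl.tl (natPair (var 0).tl (var 0)))) fun _ e => ⟨?_, fun h => ?_⟩
  · rintro ⟨y, hy⟩
    simp [hy]
  · exact ⟨(f (_root_.tl e)).unpair.2, by rw [h, Nat.pair_unpair]⟩

theorem unpair_snd (hf : EnvFun P f) : EnvFun P fun e => (f e).unpair.2 := by
  refine EnvDef.of_iff (R := fun _ e => ∃ y, f (_root_.tl e) = Nat.pair y (e 0))
    (EnvDef.ex (eq hf.tl.tl (natPair (var 0) (var 0).tl))) fun _ e => ⟨?_, fun h => ?_⟩
  · rintro ⟨y, hy⟩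
    simp [hy]
  · exact ⟨(f (_root_.tl e)).unpair.1, by rw [h, Nat.pair_unpair]⟩

theorem mod_succ (hf : EnvFun P f) (hg : EnvFun P g) : EnvFun P fun e => f e % (g e + 1) := by
  refine EnvDef.of_iff (R := fun _ e => e 0 < g (_root_.tl e) + 1 ∧
    ∃ q, f (_root_.tl e) = (g (_root_.tl e) + 1) * q + e 0)
    ((lt (var 0) (hg.tl.add one)).and (EnvDef.ex (eq hf.tl.tl
      (((hg.tl.tl.add one).mul (var 0)).add (var 0).tl)))) fun _ e => ⟨?_, fun h => ?_⟩
  · rintro ⟨h, q, hq⟩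
    show e 0 = f (_root_.tl e) % (g (_root_.tl e) + 1)
    rw [hq, Nat.mul_add_mod, Nat.mod_eq_of_lt h]
  · exact ⟨h ▸ Nat.mod_lt _ (Nat.succ_pos _), f (_root_.tl e) / (g (_root_.tl e) + 1), by
      rw [h, Nat.div_add_mod]⟩

theorem beta (hf : EnvFun P f) (hg : EnvFun P g) : EnvFun P fun e => Nat.beta (f e) (g e) :=
  mod_succ hf.unpair_fst ((hg.add one).mul hf.unpair_snd)

end EnvFun

/-! ### Partial recursive functions are definable -/

theorem Nat.exists_beta_eq (h : ℕ → ℕ) (n : ℕ) : ∃ s, ∀ i < n, Nat.beta s i = h i := by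
  refine ⟨Nat.unbeta ((List.range n).map h), fun i hi => ?_⟩
  have := Nat.beta_unbeta_coe ((List.range n).map h) ⟨i, by simpa using hi⟩
  simpa using this

theorem Part.mem_nat_rec_iff {σ : Type*} (u : Part σ) (v : ℕ → σ → Part σ) (n : ℕ) (m : σ) :
    m ∈ (Nat.rec u (fun y IH => IH >>= fun i => v y i) n : Part σ) ↔
      ∃ h : ℕ → σ, h 0 ∈ u ∧ (∀ i < n, h (i + 1) ∈ v i (h i)) ∧ h n = m := by
  induction n generalizing m with
  | zero => exact ⟨fun hm => ⟨fun _ => m, hm, by simp, rfl⟩, by rintro ⟨h, h₀, -, rfl⟩; exact h₀⟩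
  | succ n ih =>
    simp only [Part.bind_eq_bind, Part.mem_bind_iff]
    constructor
    · rintro ⟨i, hi, hm⟩
      obtain ⟨h, h₀, h₁, rfl⟩ := (ih i).1 hi
      refine ⟨fun k => if k ≤ n then h k else m, by simpa using h₀, fun k hk => ?_, by simp⟩
      rcases Nat.lt_succ_iff_lt_or_eq.1 hk with hk | rfl
      · simpa [hk.le, Nat.succ_le_iff.2 hk] using h₁ k hk
      · simpa using hm
    · rintro ⟨h, h₀, h₁, rfl⟩
      exact ⟨h n, (ih _).2 ⟨h, h₀, fun i hi => h₁ i (by omega), rfl⟩, h₁ n (by omega)⟩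

theorem EnvDef.mem_partrec {P : Type} {f : ℕ →. ℕ} (hf : Nat.Partrec f) {u v : (ℕ → ℕ) → ℕ}
    (hu : EnvFun P u) (hv : EnvFun P v) : EnvDef (P := P) fun _ e => v e ∈ f (u e) := by
  induction hf generalizing u v with
  | zero => exact (hv.eq .zero).of_iff fun _ e => by simp [pure, PFun.pure]
  | succ => exact (hv.eq (hu.add .one)).of_iff fun _ e => by simp
  | left => exact (hv.eq hu.unpair_fst).of_iff fun _ e => by simp
  | right => exact (hv.eq hu.unpair_snd).of_iff fun _ e => by simp
  | @pair f g _ _ ihf ihg =>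
    refine EnvDef.of_iff (R := fun _ e => ∃ x y, x ∈ f (u e) ∧ y ∈ g (u e) ∧ v e = Nat.pair x y) ?_ ?_
    · exact .ex (.ex ((ihf hu.tl.tl (.tl (.var 0))).and ((ihg hu.tl.tl (.var 0)).and
        (hv.tl.tl.eq (.natPair (.tl (.var 0)) (.var 0))))))
    · intro I e
      simp only [Seq.seq, Part.map_eq_map, Part.mem_bind_iff, Part.mem_map_iff]
      constructor
      · rintro ⟨x, y, hx, hy, h⟩
        exact ⟨_, ⟨x, hx, rfl⟩, y, hy, h.symm⟩
      · rintro ⟨_, ⟨x, hx, rfl⟩, y, hy, h⟩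
        exact ⟨x, y, hx, hy, h.symm⟩
  | @comp f g _ _ ihf ihg =>
    refine EnvDef.of_iff (R := fun _ e => ∃ x, x ∈ g (u e) ∧ v e ∈ f x) ?_ ?_
    · exact .ex ((ihg hu.tl (.var 0)).and (ihf (.var 0) hv.tl))
    · exact fun I e => Part.mem_bind_iff.symm
  | @prec f g _ _ ihf ihg =>
    refine EnvDef.of_iff (R := fun _ e => ∃ s, Nat.beta s 0 ∈ f (u e).unpair.1 ∧
      (∀ i, i < (u e).unpair.2 → Nat.beta s (i + 1) ∈
        g (Nat.pair (u e).unpair.1 (Nat.pair i (Nat.beta s i)))) ∧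
      Nat.beta s (u e).unpair.2 = v e) ?_ ?_
    · refine .ex ((ihf hu.tl.unpair_fst (.beta (.var 0) .zero)).and (.and (.all (.imp ?_ ?_)) ?_))
      · exact (EnvFun.var 0).lt hu.tl.tl.unpair_snd
      · exact ihg (hu.tl.tl.unpair_fst.natPair ((EnvFun.var 0).natPair
          ((EnvFun.var 0).tl.beta (.var 0)))) ((EnvFun.var 0).tl.beta ((EnvFun.var 0).add .one))
      · exact ((EnvFun.var 0).beta hu.tl.unpair_snd).eq hv.tl
    · intro I e
      refine Iff.trans ?_ (Part.mem_nat_rec_iff (f (u e).unpair.1)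
        (fun y i => g (Nat.pair (u e).unpair.1 (Nat.pair y i))) (u e).unpair.2 (v e)).symm
      constructor
      · rintro ⟨s, hs⟩
        exact ⟨Nat.beta s, hs⟩
      · rintro ⟨h, h₀, h₁, h₂⟩
        obtain ⟨s, hs⟩ := Nat.exists_beta_eq h ((u e).unpair.2 + 1)
        refine ⟨s, by rwa [hs 0 (by omega)], fun i hi => ?_, by rwa [hs _ (by omega)]⟩
        rw [hs _ (by omega), hs _ (by omega)]
        exact h₁ i hi
  | @rfind f _ ihf =>
    refine EnvDef.of_iff (R := fun _ e => 0 ∈ f (Nat.pair (u e) (v e)) ∧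
      ∀ i, i < v e → ∃ m, ¬ m = 0 ∧ m ∈ f (Nat.pair (u e) i)) ?_ ?_
    · refine (ihf (hu.natPair hv) .zero).and (.all (.imp ((EnvFun.var 0).lt hv.tl) (.ex (.and ?_ ?_))))
      · exact ((EnvFun.var 0).eq .zero).not
      · exact ihf (hu.tl.tl.natPair (.tl (.var 0))) (.var 0)
    · intro I e
      refine Iff.trans ?_ Nat.mem_rfind.symm
      refine and_congr (by simp) (forall_congr' fun i => forall_congr' fun _ => ?_)
      simp [and_comm]

/-! ### Arithmetical relations on encoded types -/

/-- The relation `R`, which may depend on the interpretation of the predicate symbols, is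
arithmetical: it is defined by a formula without `→`. -/
def ArithDef {P : Type} {α : Type*} [Primcodable α] (R : (P → Set ℕ) → α → Prop) : Prop :=
  ∃ Q : (P → Set ℕ) → ℕ → Prop, EnvDef (fun I e => Q I (e 0)) ∧ ∀ I a, Q I (encode a) ↔ R I a

namespace ArithDef

variable {P : Type} {α β σ : Type*} [Primcodable α] [Primcodable β] [Primcodable σ]
variable {R S : (P → Set ℕ) → α → Prop}

theorem exists_form (h : ArithDef R) : ∃ φ : Form P, φ.ImpFree ∧ φ.FreeBelow 1 ∧
    ∀ I a e, e 0 = encode a → (φ.Holds I e ↔ R I a) := by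
  obtain ⟨Q, ⟨φ, h₁, h₂⟩, h₃⟩ := h
  refine ⟨φ.rename fun _ => 0, h₁.rename _, Form.freeBelow_rename (fun _ => one_pos) φ, ?_⟩
  intro I a e he
  rw [Form.holds_rename, h₂, ← h₃, ← he]
  rfl

theorem of_iff (h : ArithDef R) (H : ∀ I a, R I a ↔ S I a) : ArithDef S :=
  let ⟨Q, h₁, h₂⟩ := h
  ⟨Q, h₁, fun I a => (h₂ I a).trans (H I a)⟩

theorem not (h : ArithDef R) : ArithDef fun I a => ¬ R I a :=
  let ⟨Q, h₁, h₂⟩ := h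
  ⟨fun I n => ¬ Q I n, h₁.not, fun I a => not_congr (h₂ I a)⟩

theorem and (h : ArithDef R) (h' : ArithDef S) : ArithDef fun I a => R I a ∧ S I a :=
  let ⟨Q, h₁, h₂⟩ := h
  let ⟨Q', h₁', h₂'⟩ := h'
  ⟨fun I n => Q I n ∧ Q' I n, h₁.and h₁', fun I a => and_congr (h₂ I a) (h₂' I a)⟩

theorem or (h : ArithDef R) (h' : ArithDef S) : ArithDef fun I a => R I a ∨ S I a :=
  let ⟨Q, h₁, h₂⟩ := h
  let ⟨Q', h₁', h₂'⟩ := h'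
  ⟨fun I n => Q I n ∨ Q' I n, h₁.or h₁', fun I a => or_congr (h₂ I a) (h₂' I a)⟩

theorem imp (h : ArithDef R) (h' : ArithDef S) : ArithDef fun I a => R I a → S I a :=
  let ⟨Q, h₁, h₂⟩ := h
  let ⟨Q', h₁', h₂'⟩ := h'
  ⟨fun I n => Q I n → Q' I n, h₁.imp h₁', fun I a => imp_congr (h₂ I a) (h₂' I a)⟩

theorem iff (h : ArithDef R) (h' : ArithDef S) : ArithDef fun I a => R I a ↔ S I a :=
  ((h.imp h').and (h'.imp h)).of_iff fun _ _ => iff_iff_implies_and_implies.symm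

theorem mem_partrec {f : α →. σ} (hf : Partrec f) :
    ArithDef (P := P) fun _ (p : α × σ) => p.2 ∈ f p.1 := by
  refine ⟨fun _ n => n.unpair.2 ∈ Part.bind (decode (α := α) n.unpair.1) fun a => (f a).map encode,
    EnvDef.mem_partrec hf (EnvFun.var 0).unpair_fst (EnvFun.var 0).unpair_snd, ?_⟩
  rintro I ⟨a, b⟩
  simp

theorem comp {R : (P → Set ℕ) → β → Prop} (h : ArithDef R) {f : α → β} (hf : Computable f) :
    ArithDef fun I a => R I (f a) := by
  obtain ⟨Q, h₁, h₂⟩ := h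
  refine ⟨fun I n => ∃ y, y ∈ (Part.bind (decode (α := α) n) fun a => (Part.some (f a)).map encode) ∧
    Q I y, .ex ((EnvDef.mem_partrec hf (.tl (.var 0)) (.var 0)).and h₁), ?_⟩
  intro I a
  simp [h₂]

theorem ex {R : (P → Set ℕ) → α → β → Prop} (h : ArithDef fun I (p : α × β) => R I p.1 p.2) :
    ArithDef fun I a => ∃ b, R I a b := by
  obtain ⟨Q, h₁, h₂⟩ := h
  have hG : Partrec fun m : ℕ => ((decode m : Option β) : Part β) :=
    Computable.ofOption Computable.decode
  refine ⟨fun I n => ∃ m, ∃ v, v ∈ (Part.bind (decode (α := ℕ) m) fun a =>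
    (((decode a : Option β) : Part β)).map encode) ∧ Q I (Nat.pair n v), .ex (.ex (.and ?_ ?_)), ?_⟩
  · exact EnvDef.mem_partrec hG (.tl (.var 0)) (.var 0)
  · exact h₁.subst₁ (.natPair (.tl (.tl (.var 0))) (.var 0))
  · intro I a
    constructor
    · rintro ⟨m, v, hv, hQ⟩
      simp only [decode_nat, Part.coe_some, Part.bind_some, Part.mem_map_iff] at hv
      obtain ⟨b, -, rfl⟩ := hv
      exact ⟨b, (h₂ I (a, b)).1 hQ⟩
    · rintro ⟨b, hb⟩
      exact ⟨encode b, encode b, by simp, (h₂ I (a, b)).2 hb⟩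

theorem all {R : (P → Set ℕ) → α → β → Prop} (h : ArithDef fun I (p : α × β) => R I p.1 p.2) :
    ArithDef fun I a => ∀ b, R I a b :=
  (ArithDef.ex (R := fun I a b => ¬ R I a b) h.not).not.of_iff fun _ _ => by simp

theorem mem (p : P) {f : α → ℕ} (hf : Computable f) : ArithDef fun I a => f a ∈ I p :=
  comp (R := fun I n => n ∈ I p) ⟨fun I n => n ∈ I p, EnvDef.pred p (.var 0), fun _ _ => Iff.rfl⟩ hf

theorem of_re {p : α → Prop} (hp : REPred p) : ArithDef (P := P) fun _ a => p a :=
  (ex (R := fun _ a b => b ∈ Part.assert (p a) fun _ => Part.some ()) (mem_partrec hp)).of_iff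
    fun _ a => by simp

theorem of_computable {p : α → Prop} (hp : ComputablePred p) : ArithDef (P := P) fun _ a => p a :=
  of_re hp.to_re

theorem eq {f g : α → β} (hf : Computable f) (hg : Computable g) :
    ArithDef (P := P) fun _ a => f a = g a := by
  classical
  exact comp (R := fun _ (p : β × β) => p.1 = p.2) (f := fun a => (f a, g a))
    (of_computable (PrimrecPred.computablePred Primrec.eq)) (hf.pair hg)

theorem lt {f g : α → ℕ} (hf : Computable f) (hg : Computable g) :
    ArithDef (P := P) fun _ a => f a < g a :=
  comp (R := fun _ (p : ℕ × ℕ) => p.1 < p.2) (f := fun a => (f a, g a))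
    (of_computable (PrimrecPred.computablePred Primrec.nat_lt)) (hf.pair hg)

end ArithDef

/-! ### Recursive enumerability relative to a set -/

open Classical in
/-- The initial segment of length `u` of the characteristic function of `O`. -/
noncomputable def seg (O : Set ℕ) (u : ℕ) : List Bool := (List.range u).map fun n => decide (n ∈ O)

@[simp] theorem length_seg (O : Set ℕ) (u : ℕ) : (seg O u).length = u := by simp [seg]

open Classical in
theorem getElem?_seg (O : Set ℕ) (u n : ℕ) :
    (seg O u)[n]? = if n < u then some (decide (n ∈ O)) else none := by
  split_ifs with h <;> simp [seg, h]

theorem take_seg (O : Set ℕ) (u v : ℕ) : (seg O u).take v = seg O (min v u) := by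
  simp [seg, ← List.map_take, List.take_range]

/-- `p` is recursively enumerable in `O`. -/
def OracleRE (O : Set ℕ) {α : Type*} [Primcodable α] (p : α → Prop) : Prop :=
  ∃ R : α → List Bool → Prop, PrimrecRel R ∧
    (∀ a u v, u ≤ v → R a (seg O u) → R a (seg O v)) ∧ ∀ a, p a ↔ ∃ u, R a (seg O u)

namespace OracleRE

variable {O : Set ℕ} {α β σ : Type*} [Primcodable α] [Primcodable β] [Primcodable σ]
variable {p q : α → Prop}

theorem of_iff (h : OracleRE O p) (H : ∀ a, p a ↔ q a) : OracleRE O q :=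
  (funext fun a => propext (H a) : p = q) ▸ h

theorem and (h : OracleRE O p) (h' : OracleRE O q) : OracleRE O fun a => p a ∧ q a := by
  obtain ⟨R, h₁, h₂, h₃⟩ := h
  obtain ⟨S, h₁', h₂', h₃'⟩ := h'
  refine ⟨fun a τ => R a τ ∧ S a τ, PrimrecPred.and h₁ h₁',
    fun a u v huv h => ⟨h₂ a u v huv h.1, h₂' a u v huv h.2⟩, fun a => ?_⟩
  simp only [h₃, h₃']
  constructor
  · rintro ⟨⟨u, hu⟩, v, hv⟩
    exact ⟨max u v, h₂ a _ _ (le_max_left _ _) hu, h₂' a _ _ (le_max_right _ _) hv⟩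
  · rintro ⟨u, h, h'⟩
    exact ⟨⟨u, h⟩, u, h'⟩

theorem or (h : OracleRE O p) (h' : OracleRE O q) : OracleRE O fun a => p a ∨ q a := by
  obtain ⟨R, h₁, h₂, h₃⟩ := h
  obtain ⟨S, h₁', h₂', h₃'⟩ := h'
  refine ⟨fun a τ => R a τ ∨ S a τ, PrimrecPred.or h₁ h₁',
    fun a u v huv h => h.imp (h₂ a u v huv) (h₂' a u v huv), fun a => ?_⟩
  simp only [h₃, h₃', exists_or]

theorem ex {p : α → β → Prop} (h : OracleRE O fun x : α × β => p x.1 x.2) :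
    OracleRE O fun a => ∃ b, p a b := by
  classical
  obtain ⟨R, h₁, h₂, h₃⟩ := h
  have hR : PrimrecRel fun (n : ℕ) (x : α × List Bool) =>
      ∃ b ∈ (decode n : Option β), R (x.1, b) x.2 := by
    have : Primrec fun y : ℕ × α × List Bool =>
        Option.casesOn (motive := fun _ => Bool) (decode y.1 : Option β) false
          fun b => decide (R (y.2.1, b) y.2.2) := by
      refine Primrec.option_casesOn (Primrec.decode.comp Primrec.fst) (Primrec.const _)
        (PrimrecRel.decide h₁ |>.comp (Primrec.pair ?_ Primrec.snd) ?_)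
      · exact Primrec.fst.comp (Primrec.snd.comp Primrec.fst)
      · exact Primrec.snd.comp (Primrec.snd.comp Primrec.fst)
    refine PrimrecPred.of_eq (p := fun y => _ = true) (Primrec.eq.comp this (Primrec.const true)) ?_
    rintro ⟨n, a, τ⟩
    cases h : (decode n : Option β) <;> simp [h]
  refine ⟨fun a τ => ∃ n ∈ List.range τ.length, ∃ b ∈ (decode n : Option β), R (a, b) τ,
    hR.exists_mem_list.comp (Primrec.list_range.comp (Primrec.list_length.comp Primrec.snd))
      Primrec.id, ?_, fun a => ?_⟩
  · rintro a u v huv ⟨n, hn, b, hb, h⟩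
    refine ⟨n, ?_, b, hb, h₂ _ u v huv h⟩
    simp only [List.mem_range, length_seg] at hn ⊢
    omega
  · constructor
    · rintro ⟨b, hb⟩
      obtain ⟨u, hu⟩ := (h₃ (a, b)).1 hb
      refine ⟨max u (encode b + 1), encode b, ?_, b, by simp, h₂ _ _ _ (le_max_left _ _) hu⟩
      simp
    · rintro ⟨u, n, hn, b, hb, h⟩
      exact ⟨b, (h₃ (a, b)).2 ⟨u, h⟩⟩

theorem of_re (hp : REPred p) : OracleRE O p := by
  classical
  obtain ⟨c, hc⟩ := Nat.Partrec.Code.exists_code.1 hp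
  have hdom : ∀ a, p a ↔ ∃ k, (c.evaln k (encode a)).isSome := by
    intro a
    have h : p a ↔ ∃ x, x ∈ c.eval (encode a) := by rw [hc]; simp
    simp only [h, Nat.Partrec.Code.evaln_complete, Option.isSome_iff_exists]
    rw [exists_comm]
    rfl
  have hmono : ∀ {k l : ℕ} {n : ℕ}, k ≤ l → (c.evaln k n).isSome → (c.evaln l n).isSome := by
    intro k l n hkl h
    obtain ⟨x, hx⟩ := Option.isSome_iff_exists.1 h
    exact Option.isSome_iff_exists.2 ⟨x, Nat.Partrec.Code.evaln_mono hkl hx⟩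
  refine ⟨fun a τ => (c.evaln τ.length (encode a)).isSome = true, ?_, ?_, ?_⟩
  · refine Primrec.eq.comp (Primrec.option_isSome.comp (Nat.Partrec.Code.primrec_evaln.comp
      (Primrec.pair (Primrec.pair ?_ (Primrec.const c)) ?_))) (Primrec.const true)
    · exact Primrec.list_length.comp Primrec.snd
    · exact Primrec.encode.comp Primrec.fst
  · intro a u v huv
    simpa using hmono huv
  · intro a
    simp only [length_seg]
    exact hdom a

theorem of_computable (hp : ComputablePred p) : OracleRE O p := of_re hp.to_re

theorem comp_primrec {p : β → Prop} (h : OracleRE O p) {f : α → β} (hf : Primrec f) :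
    OracleRE O fun a => p (f a) := by
  obtain ⟨R, h₁, h₂, h₃⟩ := h
  exact ⟨fun a τ => R (f a) τ, h₁.comp (hf.comp Primrec.fst) Primrec.snd,
    fun a => h₂ (f a), fun a => h₃ (f a)⟩

theorem eq {f g : α → β} (hf : Computable f) (hg : Computable g) :
    OracleRE O fun a => f a = g a := by
  classical
  obtain ⟨_, h⟩ := PrimrecPred.computablePred (Primrec.eq (α := β))
  exact of_computable ⟨fun _ => inferInstance, (h.comp (hf.pair hg)).of_eq fun _ => by
    simp⟩

theorem lt {f g : α → ℕ} (hf : Computable f) (hg : Computable g) :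
    OracleRE O fun a => f a < g a := by
  obtain ⟨_, h⟩ := PrimrecPred.computablePred Primrec.nat_lt
  exact of_computable ⟨fun _ => inferInstance, (h.comp (hf.pair hg)).of_eq fun _ => by
    simp⟩

theorem comp {p : β → Prop} (h : OracleRE O p) {f : α → β} (hf : Computable f) :
    OracleRE O fun a => p (f a) :=
  (ex (p := fun a b => f a = b ∧ p b) ((eq (hf.comp .fst) .snd).and
    (h.comp_primrec Primrec.snd))).of_iff fun _ => by simp

theorem forall_lt {p : α → ℕ → Prop} (h : OracleRE O fun x : α × ℕ => p x.1 x.2) {f : α → ℕ}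
    (hf : Computable f) : OracleRE O fun a => ∀ n < f a, p a n := by
  suffices h' : OracleRE O fun x : α × ℕ => ∀ n < x.2, p x.1 n from
    h'.comp (Computable.id.pair hf)
  obtain ⟨R, h₁, h₂, h₃⟩ := h
  have hR : PrimrecRel fun (n : ℕ) (x : α × List Bool) => R (x.1, n) x.2 :=
    h₁.comp ((Primrec.fst.comp Primrec.snd).pair Primrec.fst) (Primrec.snd.comp Primrec.snd)
  refine ⟨fun x τ => ∀ n ∈ List.range x.2, R (x.1, n) τ, ?_,
    fun x u v huv h n hn => h₂ _ u v huv (h n hn), ?_⟩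
  · exact hR.forall_mem_list.comp (Primrec.list_range.comp (Primrec.snd.comp Primrec.fst))
      ((Primrec.fst.comp Primrec.fst).pair Primrec.snd)
  · rintro ⟨a, m⟩
    simp only [List.mem_range]
    constructor
    · intro h
      induction m with
      | zero => exact ⟨0, by simp⟩
      | succ m ih =>
        obtain ⟨u, hu⟩ := ih fun n hn => h n (by omega)
        obtain ⟨v, hv⟩ := (h₃ (a, m)).1 (h m (by simp))
        refine ⟨max u v, fun n hn => ?_⟩
        rcases Nat.lt_succ_iff_lt_or_eq.1 hn with hn | rfl
        · exact h₂ _ _ _ (le_max_left _ _) (hu n hn)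
        · exact h₂ _ _ _ (le_max_right _ _) hv
    · rintro ⟨u, hu⟩ n hn
      exact (h₃ (a, n)).2 ⟨u, hu n hn⟩

open Classical in
theorem mem_iff {f : α → ℕ} (hf : Computable f) {g : α → Bool} (hg : Computable g) :
    OracleRE O fun a => decide (f a ∈ O) = g a := by
  suffices h' : OracleRE O fun x : ℕ × Bool => decide (x.1 ∈ O) = x.2 from h'.comp (hf.pair hg)
  refine ⟨fun x τ => τ[x.1]? = some x.2, ?_, ?_, ?_⟩
  · exact Primrec.eq.comp (Primrec.list_getElem?.comp Primrec.snd (Primrec.fst.comp Primrec.fst))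
      (Primrec.option_some.comp (Primrec.snd.comp Primrec.fst))
  · rintro ⟨n, b⟩ u v huv
    simp only [getElem?_seg]
    split_ifs <;> first | omega | simp_all
  · rintro ⟨n, b⟩
    simp only [getElem?_seg]
    constructor
    · intro h
      exact ⟨n + 1, by simp [h]⟩
    · rintro ⟨u, hu⟩
      split_ifs at hu
      simpa using hu

theorem re (h : OracleRE ∅ p) : REPred p := by
  classical
  obtain ⟨R, h₁, -, h₃⟩ := h
  have hseg : Primrec (seg ∅) :=
    (Primrec.list_map Primrec.list_range ((Primrec.const false).to₂)).of_eq fun u => by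
      simp [seg]
  have : Partrec fun a => Nat.rfind fun u => Part.some (decide (R a (seg ∅ u))) :=
    Partrec.rfind (Primrec.to_comp (f := fun x : α × ℕ => decide (R x.1 (seg ∅ x.2)))
      (PrimrecRel.decide h₁ |>.comp Primrec.fst (hseg.comp Primrec.snd))).partrec
  refine this.dom_re.of_eq fun a => ?_
  rw [h₃, Part.dom_iff_mem]
  constructor
  · rintro ⟨u, hu⟩
    exact ⟨u, by simpa using (Nat.mem_rfind.1 hu).1⟩
  · rintro ⟨u, hu⟩
    obtain ⟨n, hn, -⟩ := Nat.rfind_min' (p := fun u => decide (R a (seg ∅ u))) (m := u)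
      (by simpa using hu)
    exact ⟨n, hn⟩

end OracleRE

/-! ### Turing reducibility and relative enumerability of graphs -/

namespace Nat.RecursiveIn

variable {O : Set (ℕ →. ℕ)}

theorem comp_total {f : ℕ →. ℕ} {g : ℕ → ℕ} (hf : Nat.RecursiveIn O f)
    (hg : Nat.RecursiveIn O (g : ℕ →. ℕ)) : Nat.RecursiveIn O fun n => f (g n) :=
  (hf.comp hg).of_eq fun _ => Part.bind_some _ _

theorem pair_total {f g : ℕ → ℕ} (hf : Nat.RecursiveIn O (f : ℕ →. ℕ))
    (hg : Nat.RecursiveIn O (g : ℕ →. ℕ)) :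
    Nat.RecursiveIn O ((fun n => Nat.pair (f n) (g n) : ℕ → ℕ) : ℕ →. ℕ) :=
  (hf.pair hg).of_eq fun n => by simp [Seq.seq]

theorem of_primrec {f : ℕ → ℕ} (hf : Primrec f) : Nat.RecursiveIn O (f : ℕ →. ℕ) :=
  (Primrec.nat_iff.1 hf).recursiveIn

end Nat.RecursiveIn

theorem recursiveIn_encode_seg (O : Set ℕ) :
    Nat.RecursiveIn {charFun O} ((fun u => encode (seg O u) : ℕ → ℕ) : ℕ →. ℕ) := by
  classical
  let c : ℕ → ℕ := fun n => if n ∈ O then 1 else 0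
  have hc : Nat.RecursiveIn {charFun O} (c : ℕ →. ℕ) := .oracle _ (by
    rw [Set.mem_singleton_iff]; rfl)
  let K : ℕ → ℕ := fun n =>
    encode (((decode n.unpair.1 : Option (List Bool)).getD []) ++ [decide (n.unpair.2 = 1)])
  have hK : Primrec K := by
    refine Primrec.encode.comp (Primrec.list_append.comp (Primrec.option_getD.comp
      (Primrec.decode.comp (Primrec.fst.comp Primrec.unpair)) (Primrec.const []))
      (Primrec.list_cons.comp ?_ (Primrec.const [])))
    exact (Primrec.eq (α := ℕ)).decide.comp (Primrec.snd.comp Primrec.unpair) (Primrec.const 1)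
  have hstep : Nat.RecursiveIn {charFun O} ((fun p => K (Nat.pair p.unpair.2.unpair.2
      (c p.unpair.2.unpair.1)) : ℕ → ℕ) : ℕ →. ℕ) := by
    refine (Nat.RecursiveIn.of_primrec hK).comp_total (Nat.RecursiveIn.pair_total
      (.of_primrec ?_) (hc.comp_total (.of_primrec ?_)))
    · exact Primrec.snd.comp (Primrec.unpair.comp (Primrec.snd.comp Primrec.unpair))
    · exact Primrec.fst.comp (Primrec.unpair.comp (Primrec.snd.comp Primrec.unpair))
  have h := (Nat.RecursiveIn.prec (Nat.RecursiveIn.of_primrec (Primrec.const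
    (encode ([] : List Bool)))) hstep).comp_total (.of_primrec (Primrec₂.natPair.comp
      (Primrec.const 0) Primrec.id))
  refine h.of_eq fun u => ?_
  simp only [Nat.unpair_pair, id]
  induction u with
  | zero => simp [seg]
  | succ u ih =>
    simp only [ih]
    simp [K, c, seg, List.range_succ]

theorem OracleRE.turingReducible {O : Set ℕ} {f : ℕ → ℕ}
    (h : OracleRE O fun x : ℕ × ℕ => f x.1 = x.2) :
    TuringReducible (f : ℕ →. ℕ) (charFun O) := by
  classical
  obtain ⟨R, h₁, h₂, h₃⟩ := h
  rw [TuringReducible, RecursiveIn.iff_nat]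
  obtain ⟨K, hK, hR⟩ : ∃ K : ℕ → ℕ, Primrec K ∧ ∀ i v,
      K (Nat.pair (Nat.pair i v) (encode (seg O v.unpair.2))) = 0 ↔
        R (i, v.unpair.1) (seg O v.unpair.2) := by
    refine ⟨fun n => if R (n.unpair.1.unpair.1, n.unpair.1.unpair.2.unpair.1)
      ((decode n.unpair.2 : Option (List Bool)).getD []) then 0 else 1, ?_, fun i v => by simp⟩
    refine Primrec.ite (h₁.comp ?_ ?_) (Primrec.const _) (Primrec.const _)
    · have h := Primrec.unpair.comp (Primrec.fst.comp Primrec.unpair)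
      exact (Primrec.fst.comp h).pair (Primrec.fst.comp (Primrec.unpair.comp (Primrec.snd.comp h)))
    · exact Primrec.option_getD.comp (Primrec.decode.comp (Primrec.snd.comp Primrec.unpair))
        (Primrec.const [])
  have htest : Nat.RecursiveIn {charFun O} ((fun n => K (Nat.pair n
      (encode (seg O n.unpair.2.unpair.2))) : ℕ → ℕ) : ℕ →. ℕ) := by
    refine (Nat.RecursiveIn.of_primrec hK).comp_total (Nat.RecursiveIn.pair_total
      (.of_primrec Primrec.id) ((recursiveIn_encode_seg O).comp_total (.of_primrec ?_)))
    exact Primrec.snd.comp (Primrec.unpair.comp (Primrec.snd.comp Primrec.unpair))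
  have hsearch : Nat.RecursiveIn {charFun O} fun i => Nat.rfind fun v =>
      Part.some (decide (K (Nat.pair (Nat.pair i v) (encode (seg O v.unpair.2))) = 0)) :=
    htest.rfind.of_eq fun i => by simp only [Nat.unpair_pair, PFun.coe_val, Part.map_eq_map, Part.map_some]
  refine (Nat.RecursiveIn.comp Nat.RecursiveIn.left hsearch).of_eq_tot fun i => ?_
  obtain ⟨u, hu⟩ := (h₃ (i, f i)).1 rfl
  obtain ⟨v, hv, -⟩ := Nat.rfind_min' (m := Nat.pair (f i) u)
    (p := fun v => decide (K (Nat.pair (Nat.pair i v) (encode (seg O v.unpair.2))) = 0))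
    (decide_eq_true ((hR i _).2 (by simpa using hu)))
  refine Part.mem_bind_iff.2 ⟨v, hv, ?_⟩
  have hv' := (hR i v).1 (of_decide_eq_true (Part.mem_some_iff.1 (Nat.mem_rfind.1 hv).1).symm)
  have := (h₃ (i, v.unpair.1)).2 ⟨_, hv'⟩
  exact Part.mem_some_iff.2 this

theorem OracleRE.of_recursiveIn {O : Set ℕ} {f : ℕ →. ℕ} (hf : Nat.RecursiveIn {charFun O} f) :
    OracleRE O fun x : ℕ × ℕ => x.2 ∈ f x.1 := by
  classical
  have hpart : ∀ {f : ℕ →. ℕ}, Nat.Partrec f → OracleRE O fun x : ℕ × ℕ => x.2 ∈ f x.1 := by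
    intro f hf
    have h : Partrec fun x : ℕ × ℕ => (f x.1).bind fun y => if y = x.2 then Part.some () else Part.none := by
      refine Partrec.bind ((Partrec.nat_iff.2 hf).comp .fst) ?_
      refine (Partrec.cond (f := fun _ => Part.some ()) (g := fun _ => Part.none)
        (c := fun y : (ℕ × ℕ) × ℕ => decide (y.2 = y.1.2)) ?_ (Computable.const ()) Partrec.none).of_eq ?_
      · exact ((Primrec.eq (α := ℕ)).decide.comp Primrec.snd
          (Primrec.snd.comp Primrec.fst)).to_comp
      · rintro ⟨⟨a, b⟩, y⟩
        by_cases h : y = b <;> simp [h]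
    refine (OracleRE.of_re h.dom_re).of_iff fun x => ?_
    rw [Part.dom_iff_mem]
    simp only [Part.mem_bind_iff]
    constructor
    · rintro ⟨_, y, hy, h⟩
      split_ifs at h with hxy
      · exact hxy ▸ hy
      · simp at h
    · intro h
      exact ⟨(), x.2, h, by simp⟩
  induction hf with
  | zero => exact hpart .zero
  | succ => exact hpart .succ
  | left => exact hpart .left
  | right => exact hpart .right
  | oracle g hg =>
    obtain rfl := Set.mem_singleton_iff.1 hg
    refine OracleRE.of_iff (p := fun x : ℕ × ℕ => (decide (x.1 ∈ O) = true ∧ x.2 = 1) ∨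
      (decide (x.1 ∈ O) = false ∧ x.2 = 0)) ?_ ?_
    · exact ((OracleRE.mem_iff .fst (.const true)).and (.eq .snd (.const 1))).or
        ((OracleRE.mem_iff .fst (.const false)).and (.eq .snd (.const 0)))
    · rintro ⟨a, b⟩
      by_cases h : a ∈ O <;> simp [charFun, h]
  | @pair f g _ _ ihf ihg =>
    refine OracleRE.of_iff (p := fun x : ℕ × ℕ => ∃ y : ℕ × ℕ, y.1 ∈ f x.1 ∧ y.2 ∈ g x.1 ∧
      x.2 = Nat.pair y.1 y.2) (.ex (.and ?_ (.and ?_ ?_))) ?_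
    · exact ihf.comp ((Computable.fst.comp .fst).pair (Computable.fst.comp .snd))
    · exact ihg.comp ((Computable.fst.comp .fst).pair (Computable.snd.comp .snd))
    · exact .eq (Computable.snd.comp .fst) (Primrec₂.natPair.to_comp.comp
        (Computable.fst.comp .snd) (Computable.snd.comp .snd))
    · intro x
      simp only [Seq.seq, Part.map_eq_map, Part.mem_bind_iff, Part.mem_map_iff]
      constructor
      · rintro ⟨y, hx, hy, h⟩
        exact ⟨_, ⟨y.1, hx, rfl⟩, y.2, hy, h.symm⟩
      · rintro ⟨_, ⟨x, hx, rfl⟩, y, hy, h⟩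
        exact ⟨(x, y), hx, hy, h.symm⟩
  | @comp f g _ _ ihf ihg =>
    refine OracleRE.of_iff (p := fun x : ℕ × ℕ => ∃ y : ℕ, y ∈ g x.1 ∧ x.2 ∈ f y)
      (.ex (.and ?_ ?_)) fun x => Part.mem_bind_iff.symm
    · exact ihg.comp ((Computable.fst.comp .fst).pair .snd)
    · exact ihf.comp (Computable.snd.pair (Computable.snd.comp .fst))
  | @prec f g _ _ ihf ihg =>
    refine OracleRE.of_iff (p := fun x : ℕ × ℕ => ∃ l : List ℕ, l.getD 0 0 ∈ f x.1.unpair.1 ∧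
      (∀ i < x.1.unpair.2, l.getD (i + 1) 0 ∈
        g (Nat.pair x.1.unpair.1 (Nat.pair i (l.getD i 0)))) ∧
      l.getD x.1.unpair.2 0 = x.2) (.ex (.and ?_ (.and (.forall_lt ?_ ?_) ?_))) ?_
    · exact ihf.comp ((Computable.fst.comp (Computable.unpair.comp (Computable.fst.comp .fst))).pair
        ((Primrec.list_getD 0).to_comp.comp .snd (.const 0)))
    · refine ihg.comp (Computable.pair ?_ ?_)
      · exact Primrec₂.natPair.to_comp.comp (Computable.fst.comp (Computable.unpair.comp
          (Computable.fst.comp (Computable.fst.comp .fst)))) (Primrec₂.natPair.to_comp.comp .snd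
          ((Primrec.list_getD 0).to_comp.comp (Computable.snd.comp .fst) .snd))
      · exact (Primrec.list_getD 0).to_comp.comp (Computable.snd.comp .fst)
          (Computable.succ.comp .snd)
    · exact Computable.snd.comp (Computable.unpair.comp (Computable.fst.comp .fst))
    · exact .eq ((Primrec.list_getD 0).to_comp.comp .snd
        (Computable.snd.comp (Computable.unpair.comp (Computable.fst.comp .fst))))
          (Computable.snd.comp .fst)
    · rintro ⟨a, m⟩
      refine Iff.trans ?_ (Part.mem_nat_rec_iff (f a.unpair.1)
        (fun y i => g (Nat.pair a.unpair.1 (Nat.pair y i))) a.unpair.2 m).symm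
      constructor
      · rintro ⟨l, hl⟩
        exact ⟨fun i => l.getD i 0, hl⟩
      · rintro ⟨h, h₀, h₁, h₂⟩
        have hl : ∀ i < a.unpair.2 + 1, ((List.range (a.unpair.2 + 1)).map h).getD i 0 = h i := by
          intro i hi
          simp [List.getD, hi]
        refine ⟨(List.range (a.unpair.2 + 1)).map h, by rwa [hl 0 (by omega)], fun i hi => ?_,
          by rwa [hl _ (by simp)]⟩
        have hi' : i < a.unpair.2 := hi
        rw [hl _ (by omega), hl _ (by omega)]
        exact h₁ i hi
  | @rfind f _ ihf =>
    refine OracleRE.of_iff (p := fun x : ℕ × ℕ => 0 ∈ f (Nat.pair x.1 x.2) ∧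
      ∀ i < x.2, ∃ m : ℕ, m + 1 ∈ f (Nat.pair x.1 i)) (.and ?_ (.forall_lt (.ex ?_) .snd)) ?_
    · exact ihf.comp ((Primrec₂.natPair.to_comp.comp .fst .snd).pair (.const 0))
    · exact ihf.comp ((Primrec₂.natPair.to_comp.comp (Computable.fst.comp
        (Computable.fst.comp .fst)) (Computable.snd.comp .fst)).pair (Computable.succ.comp .snd))
    · intro x
      refine Iff.trans ?_ Nat.mem_rfind.symm
      refine and_congr (by simp) (forall_congr' fun i => forall_congr' fun _ => ?_)
      constructor
      · rintro ⟨m, hm⟩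
        exact Part.mem_map_iff _ |>.2 ⟨m + 1, hm, by simp⟩
      · intro h
        obtain ⟨m, hm, h⟩ := (Part.mem_map_iff _).1 h
        refine ⟨m - 1, ?_⟩
        rwa [Nat.sub_add_cancel (Nat.pos_of_ne_zero (by simpa using h))]

/-! ### Candidate witnesses as sets of pairs -/

namespace Cand

/-- The pair `p` occurs in `W`. -/
def Has (W : Cand) (p : InOut) : Prop := ∃ k, W k = some p

variable {W X : Cand} {n : ℕ} {i o : List ℕ}

theorem has_onInput : (W.onInput n).Has (i, o) ↔ W.Has (n :: i, o) := by
  refine exists_congr fun k => ?_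
  unfold onInput
  rcases W k with _ | ⟨_ | ⟨m, i'⟩, o'⟩
  · simp
  · simp
  · by_cases h : m = n <;> simp [h]

theorem has_onOutput : (W.onOutput n).Has (i, o) ↔ W.Has (i, n :: o) := by
  refine exists_congr fun k => ?_
  unfold onOutput
  rcases W k with _ | ⟨i', _ | ⟨m, o'⟩⟩
  · simp
  · simp
  · by_cases h : m = n <;> simp [h]

theorem has_app : (W.app X).Has (i, o) ↔ ∃ σ : List (Option InOut),
    IsSegment σ X ∧ W.Has (encode σ :: i, o) := by
  constructor
  · rintro ⟨k, hk⟩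
    unfold app at hk
    rcases hW : W k with _ | ⟨_ | ⟨c, i'⟩, o'⟩
    · simp [hW] at hk
    · simp [hW] at hk
    · simp only [hW, Denumerable.decode_eq_ofNat] at hk
      by_cases h : IsSegment (Denumerable.ofNat (List (Option InOut)) c) X
      · simp only [h, if_true, Option.some.injEq, Prod.mk.injEq] at hk
        obtain ⟨rfl, rfl⟩ := hk
        exact ⟨_, h, k, by rw [Denumerable.encode_ofNat, hW]⟩
      · simp [h] at hk
  · rintro ⟨σ, hσ, k, hk⟩
    refine ⟨k, ?_⟩
    unfold app
    simp only [hk, encodek, hσ, if_true]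

theorem gives_iff : W.Gives n ↔ ∃ i o, W.Has (i, n :: o) := by
  constructor
  · rintro ⟨k, i, o, h⟩
    exact ⟨i, o, k, h⟩
  · rintro ⟨i, o, k, h⟩
    exact ⟨k, i, o, h⟩

open Classical in
/-- A candidate with the given pairs. -/
noncomputable def ofSet (D : Set InOut) : Cand := fun k =>
  (decode k : Option InOut).bind fun p => if p ∈ D then some p else none

theorem has_ofSet {D : Set InOut} {p : InOut} : (ofSet D).Has p ↔ p ∈ D := by
  constructor
  · rintro ⟨k, hk⟩
    obtain ⟨q, -, hq⟩ := Option.bind_eq_some_iff.1 hk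
    split_ifs at hq with h
    exact Option.some.inj hq ▸ h
  · intro h
    exact ⟨encode p, by simp only [ofSet, encodek, Option.bind_some, h, if_true]⟩

theorem getElem?_of_isSegment {σ : List (Option InOut)} (h : IsSegment σ X) {k : ℕ}
    (hk : k < σ.length) : σ[k]? = some (X k) := by
  rw [IsSegment] at h
  rw [h]
  simp [hk]

theorem isSegment_map_range (X : Cand) (l : ℕ) : IsSegment ((List.range l).map X) X := by
  simp [IsSegment]

end Cand

namespace Form

variable {A B : ArithForm} {e : ℕ → ℕ} {V W : Cand}

/-- Well-formedness is inherited by candidates with fewer pairs, up to the empty pair. -/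
theorem WellFormed.mono (hW : A.WellFormed W)
    (h : ∀ p, V.Has p → p = ([], []) ∨ W.Has p) : A.WellFormed V := by
  have hin : ∀ {V W : Cand}, (∀ p, V.Has p → p = ([], []) ∨ W.Has p) → ∀ n p,
      (V.onInput n).Has p → p = ([], []) ∨ (W.onInput n).Has p := by
    rintro V W h n ⟨i, o⟩ hp
    rw [Cand.has_onInput] at hp ⊢
    exact .inr ((h _ hp).resolve_left (by simp))
  have hout : ∀ {V W : Cand}, (∀ p, V.Has p → p = ([], []) ∨ W.Has p) → ∀ n p,
      (V.onOutput n).Has p → p = ([], []) ∨ (W.onOutput n).Has p := by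
    rintro V W h n ⟨i, o⟩ hp
    rw [Cand.has_onOutput] at hp ⊢
    exact .inr ((h _ hp).resolve_left (by simp))
  have hgives : ∀ {V W : Cand}, (∀ p, V.Has p → p = ([], []) ∨ W.Has p) → ∀ n,
      V.Gives n → W.Gives n := by
    intro V W h n hp
    rw [Cand.gives_iff] at hp ⊢
    obtain ⟨i, o, hp⟩ := hp
    exact ⟨i, o, (h _ hp).resolve_left (by simp)⟩
  have hshape : ∀ {V W : Cand}, (∀ p, V.Has p → p = ([], []) ∨ W.Has p) → ∀ {S : InOut → Prop},
      (∀ k p, W k = some p → p = ([], []) ∨ S p) → ∀ k p, V k = some p → p = ([], []) ∨ S p := by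
    intro V W h S hS k p hp
    rcases h p ⟨k, hp⟩ with h | ⟨k', hk'⟩
    · exact .inl h
    · exact hS k' p hk'
  induction A generalizing V W with
  | eq s t => exact fun k p hp => (h p ⟨k, hp⟩).elim id fun ⟨k', hk'⟩ => hW k' p hk'
  | lt s t => exact fun k p hp => (h p ⟨k, hp⟩).elim id fun ⟨k', hk'⟩ => hW k' p hk'
  | pred p => exact p.elim
  | neg A => exact fun k p hp => (h p ⟨k, hp⟩).elim id fun ⟨k', hk'⟩ => hW k' p hk'
  | and A B hA hB =>
    exact ⟨hshape h hW.1, hA hW.2.1 (hin h 0), hB hW.2.2 (hin h 1)⟩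
  | or A B hA hB =>
    exact ⟨hshape h hW.1, fun m n hm hn => hW.2.1 m n (hgives h m hm) (hgives h n hn),
      hA hW.2.2.1 (hout h 0), hB hW.2.2.2 (hout h 1)⟩
  | imp A B hA hB =>
    refine ⟨hshape h hW.1, fun X hX => hB (hW.2 X hX) ?_⟩
    rintro ⟨i, o⟩ hp
    rw [Cand.has_app] at hp ⊢
    obtain ⟨σ, hσ, hp⟩ := hp
    exact .inr ⟨σ, hσ, (h _ hp).resolve_left (by simp)⟩
  | ex A hA =>
    exact ⟨hshape h hW.1, fun m n hm hn => hW.2.1 m n (hgives h m hm) (hgives h n hn),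
      fun n => hA (hW.2.2 n) (hout h n)⟩
  | all A hA => exact ⟨hshape h hW.1, fun n => hA (hW.2 n) (hin h n)⟩

/-- Correctness is inherited by candidates with more pairs. -/
theorem Correct.mono (hV : A.Correct e V) (h : ∀ p, V.Has p → W.Has p) : A.Correct e W := by
  have hin : ∀ {V W : Cand}, (∀ p, V.Has p → W.Has p) → ∀ n p,
      (V.onInput n).Has p → (W.onInput n).Has p := by
    rintro V W h n ⟨i, o⟩ hp
    rw [Cand.has_onInput] at hp ⊢
    exact h _ hp
  have hout : ∀ {V W : Cand}, (∀ p, V.Has p → W.Has p) → ∀ n p,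
      (V.onOutput n).Has p → (W.onOutput n).Has p := by
    rintro V W h n ⟨i, o⟩ hp
    rw [Cand.has_onOutput] at hp ⊢
    exact h _ hp
  have hgives : ∀ {V W : Cand}, (∀ p, V.Has p → W.Has p) → ∀ n, V.Gives n → W.Gives n := by
    intro V W h n hp
    rw [Cand.gives_iff] at hp ⊢
    obtain ⟨i, o, hp⟩ := hp
    exact ⟨i, o, h _ hp⟩
  induction A generalizing e V W with
  | eq s t => exact hV
  | lt s t => exact hV
  | pred p => exact p.elim
  | neg A => exact hV
  | and A B hA hB => exact ⟨hA hV.1 (hin h 0), hB hV.2 (hin h 1)⟩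
  | or A B hA hB =>
    exact hV.imp (fun hV => ⟨hgives h 0 hV.1, hA hV.2 (hout h 0)⟩)
      fun hV => ⟨hgives h 1 hV.1, hB hV.2 (hout h 1)⟩
  | imp A B hA hB =>
    refine fun X hX hX' => hB (hV X hX hX') ?_
    rintro ⟨i, o⟩ hp
    rw [Cand.has_app] at hp ⊢
    obtain ⟨σ, hσ, hp⟩ := hp
    exact ⟨σ, hσ, h _ hp⟩
  | ex A hA =>
    obtain ⟨n, hn, hV⟩ := hV
    exact ⟨n, hgives h n hn, hA hV (hout h n)⟩
  | all A hA => exact fun n => hA (hV n) (hin h n)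

theorem wellFormed_of_not_has (h : ∀ p, ¬ W.Has p) : A.WellFormed W := by
  have hshape : ∀ {W : Cand}, (∀ p, ¬ W.Has p) → ∀ {S : InOut → Prop} (k p), W k = some p → S p :=
    fun h _ k p hp => (h p ⟨k, hp⟩).elim
  have hgives : ∀ {W : Cand}, (∀ p, ¬ W.Has p) → ∀ m n, W.Gives m → W.Gives n → m = n :=
    fun h _ _ ⟨k, i, o, hk⟩ _ => (h _ ⟨k, hk⟩).elim
  have hin : ∀ {W : Cand}, (∀ p, ¬ W.Has p) → ∀ n p, ¬ (W.onInput n).Has p :=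
    fun h n p hp => h _ (Cand.has_onInput.1 hp)
  have hout : ∀ {W : Cand}, (∀ p, ¬ W.Has p) → ∀ n p, ¬ (W.onOutput n).Has p :=
    fun h n p hp => h _ (Cand.has_onOutput.1 hp)
  induction A generalizing W with
  | eq s t => exact hshape h
  | lt s t => exact hshape h
  | pred p => exact p.elim
  | neg A => exact hshape h
  | and A B hA hB => exact ⟨hshape h, hA (hin h 0), hB (hin h 1)⟩
  | or A B hA hB => exact ⟨hshape h, hgives h, hA (hout h 0), hB (hout h 1)⟩
  | imp A B hA hB =>
    refine ⟨hshape h, fun X _ => hB fun p hp => ?_⟩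
    obtain ⟨σ, hσ, hp⟩ := Cand.has_app.1 hp
    exact h _ hp
  | ex A hA => exact ⟨hshape h, hgives h, fun n => hA (hout h n)⟩
  | all A hA => exact ⟨hshape h, fun n => hA (hin h n)⟩

theorem wellFormed_ex_of_has {n : ℕ} (h : ∀ p, W.Has p → ∃ i o, p = (i, n :: o))
    (hA : A.WellFormed (W.onOutput n)) : (ex A).WellFormed W := by
  have hg : ∀ m, W.Gives m → m = n := by
    intro m hm
    obtain ⟨i, o, hm⟩ := Cand.gives_iff.1 hm
    obtain ⟨i', o', h⟩ := h _ hm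
    simp only [Prod.mk.injEq, List.cons.injEq] at h
    exact h.2.1
  refine ⟨fun k p hp => .inr ?_, fun m m' hm hm' => (hg m hm).trans (hg m' hm').symm, fun m => ?_⟩
  · obtain ⟨i, o, h⟩ := h p ⟨k, hp⟩
    exact ⟨n, i, o, h⟩
  · by_cases hm : m = n
    · exact hm ▸ hA
    · refine wellFormed_of_not_has ?_
      rintro ⟨i, o⟩ hp
      exact hm (hg m (Cand.gives_iff.2 ⟨i, o, Cand.has_onOutput.1 hp⟩))

theorem correct_congr {b : ℕ} (hA : A.FreeBelow b) {e e' : ℕ → ℕ}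
    (he : ∀ k < b, e k = e' k) : A.Correct e W ↔ A.Correct e' W := by
  induction A generalizing b e e' W with
  | eq s t => simp [Correct, Term.eval_congr hA.1 he, Term.eval_congr hA.2 he]
  | lt s t => simp [Correct, Term.eval_congr hA.1 he, Term.eval_congr hA.2 he]
  | pred p => exact p.elim
  | neg A => exact isTrue_congr hA he
  | and A B h₁ h₂ => exact and_congr (h₁ hA.1 he) (h₂ hA.2 he)
  | or A B h₁ h₂ =>
    exact or_congr (and_congr_right fun _ => h₁ hA.1 he) (and_congr_right fun _ => h₂ hA.2 he)
  | imp A B h₁ h₂ =>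
    exact forall_congr' fun X => imp_congr_right fun _ => imp_congr (h₁ hA.1 he) (h₂ hA.2 he)
  | ex A h => exact exists_congr fun n => and_congr_right fun _ => h hA (push_congr he n)
  | all A h => exact forall_congr' fun n => h hA (push_congr he n)

theorem isWitness_congr {b : ℕ} (hA : A.FreeBelow b) {e e' : ℕ → ℕ}
    (he : ∀ k < b, e k = e' k) : A.IsWitness e W ↔ A.IsWitness e' W :=
  and_congr_right fun _ => correct_congr hA he

/-- Classical truth is the existence of a not necessarily recursive witness. -/
theorem isTrue_iff_exists_isWitness : A.IsTrue e ↔ ∃ W, A.IsWitness e W := by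
  have hempty : ∀ p, ¬ Cand.Has (fun _ => none) p := by rintro p ⟨k, hk⟩; cases hk
  induction A generalizing e with
  | eq s t => exact ⟨fun h => ⟨fun _ => none, wellFormed_of_not_has hempty, h⟩, fun ⟨_, h⟩ => h.2⟩
  | lt s t => exact ⟨fun h => ⟨fun _ => none, wellFormed_of_not_has hempty, h⟩, fun ⟨_, h⟩ => h.2⟩
  | pred p => exact p.elim
  | neg A => exact ⟨fun h => ⟨fun _ => none, wellFormed_of_not_has hempty, h⟩, fun ⟨_, h⟩ => h.2⟩
  | and A B hA hB =>
    constructor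
    · rintro ⟨h₁, h₂⟩
      obtain ⟨V₁, hV₁⟩ := hA.1 h₁
      obtain ⟨V₂, hV₂⟩ := hB.1 h₂
      refine ⟨.ofSet {p | ∃ i o, (p = (0 :: i, o) ∧ V₁.Has (i, o)) ∨ (p = (1 :: i, o) ∧
        V₂.Has (i, o))}, ⟨?_, hV₁.1.mono ?_, hV₂.1.mono ?_⟩, hV₁.2.mono ?_, hV₂.2.mono ?_⟩
      · intro k p hp
        obtain ⟨i, o, h | h⟩ := Cand.has_ofSet.1 ⟨k, hp⟩
        · exact .inr ⟨0, i, o, by simp, h.1⟩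
        · exact .inr ⟨1, i, o, by simp, h.1⟩
      · rintro ⟨i, o⟩ hp
        obtain ⟨i', o', h | h⟩ := Cand.has_ofSet.1 (Cand.has_onInput.1 hp) <;> simp_all
      · rintro ⟨i, o⟩ hp
        obtain ⟨i', o', h | h⟩ := Cand.has_ofSet.1 (Cand.has_onInput.1 hp) <;> simp_all
      · rintro ⟨i, o⟩ hp
        exact Cand.has_onInput.2 (Cand.has_ofSet.2 ⟨i, o, .inl ⟨rfl, hp⟩⟩)
      · rintro ⟨i, o⟩ hp
        exact Cand.has_onInput.2 (Cand.has_ofSet.2 ⟨i, o, .inr ⟨rfl, hp⟩⟩)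
    · rintro ⟨W, ⟨-, h₁, h₂⟩, h₃, h₄⟩
      exact ⟨hA.2 ⟨_, h₁, h₃⟩, hB.2 ⟨_, h₂, h₄⟩⟩
  | or A B hA hB =>
    have key : ∀ {C : ArithForm} {V : Cand} {n : ℕ}, n < 2 → C.WellFormed V →
        ∃ W : Cand, (∀ p, V.Has p → (W.onOutput n).Has p) ∧ W.Gives n ∧
          (∀ m, W.Gives m → m = n) ∧ C.WellFormed (W.onOutput n) ∧
          ∀ k p, W k = some p → p = ([], []) ∨ ∃ j i o, j < 2 ∧ p = (i, j :: o) := by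
      intro C V n hn hV
      have hW : ∀ p, Cand.Has (.ofSet {p | p = ([], [n]) ∨ ∃ i o, p = (i, n :: o) ∧ V.Has (i, o)}) p →
          ∃ i o, p = (i, n :: o) ∧ ((i, o) = ([], []) ∨ V.Has (i, o)) := by
        intro p hp
        rcases Cand.has_ofSet.1 hp with h | ⟨i, o, h⟩
        · exact ⟨[], [], h, .inl rfl⟩
        · exact ⟨i, o, h.1, .inr h.2⟩
      refine ⟨.ofSet {p | p = ([], [n]) ∨ ∃ i o, p = (i, n :: o) ∧ V.Has (i, o)}, ?_, ?_, ?_,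
        hV.mono ?_, ?_⟩
      · rintro ⟨i, o⟩ hp
        exact Cand.has_onOutput.2 (Cand.has_ofSet.2 (.inr ⟨i, o, rfl, hp⟩))
      · exact Cand.gives_iff.2 ⟨[], [], Cand.has_ofSet.2 (.inl rfl)⟩
      · intro m hm
        obtain ⟨i, o, hm⟩ := Cand.gives_iff.1 hm
        obtain ⟨i', o', h, -⟩ := hW _ hm
        simp_all
      · rintro ⟨i, o⟩ hp
        obtain ⟨i', o', h, h'⟩ := hW _ (Cand.has_onOutput.1 hp)
        simp_all
      · intro k p hp
        obtain ⟨i', o', h, -⟩ := hW _ ⟨k, hp⟩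
        exact .inr ⟨n, i', o', hn, h⟩
    have none : ∀ {W : Cand} {m n : ℕ}, (∀ m, W.Gives m → m = n) → m ≠ n →
        ∀ p, ¬ (W.onOutput m).Has p := fun h hmn p hp =>
      hmn (h _ (Cand.gives_iff.2 ⟨p.1, p.2, Cand.has_onOutput.1 hp⟩))
    constructor
    · rintro (h | h)
      · obtain ⟨V, hV⟩ := hA.1 h
        obtain ⟨W, h₁, h₂, h₃, h₄, h₅⟩ := key zero_lt_two hV.1
        exact ⟨W, ⟨h₅, fun m n hm hn => (h₃ m hm).trans (h₃ n hn).symm, h₄,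
          wellFormed_of_not_has (none h₃ one_ne_zero)⟩, .inl ⟨h₂, hV.2.mono h₁⟩⟩
      · obtain ⟨V, hV⟩ := hB.1 h
        obtain ⟨W, h₁, h₂, h₃, h₄, h₅⟩ := key one_lt_two hV.1
        exact ⟨W, ⟨h₅, fun m n hm hn => (h₃ m hm).trans (h₃ n hn).symm,
          wellFormed_of_not_has (none h₃ zero_ne_one), h₄⟩, .inr ⟨h₂, hV.2.mono h₁⟩⟩
    · rintro ⟨W, ⟨-, -, h₁, h₂⟩, h | h⟩
      · exact .inl (hA.2 ⟨_, h₁, h.2⟩)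
      · exact .inr (hB.2 ⟨_, h₂, h.2⟩)
  | imp A B hA hB =>
    constructor
    · intro h
      by_cases hAe : A.IsTrue e
      · obtain ⟨V, hV⟩ := hB.1 (h hAe)
        refine ⟨.ofSet {p | ∃ i o, p = (encode ([] : List (Option InOut)) :: i, o) ∧ V.Has (i, o)},
          ⟨?_, fun X _ => hV.1.mono ?_⟩, fun X _ _ => hV.2.mono ?_⟩
        · intro k p hp
          obtain ⟨i, o, h, -⟩ := Cand.has_ofSet.1 ⟨k, hp⟩
          exact .inr ⟨[], i, o, h⟩
        · rintro ⟨i, o⟩ hp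
          obtain ⟨σ, -, hp⟩ := Cand.has_app.1 hp
          obtain ⟨i', o', h, h'⟩ := Cand.has_ofSet.1 hp
          simp_all
        · rintro ⟨i, o⟩ hp
          exact Cand.has_app.2 ⟨[], rfl, Cand.has_ofSet.2 ⟨i, o, rfl, hp⟩⟩
      · exact ⟨fun _ => none, wellFormed_of_not_has hempty, fun X h₁ h₂ =>
          (hAe (hA.2 ⟨X, h₁, h₂⟩)).elim⟩
    · rintro ⟨W, ⟨-, h₁⟩, h₂⟩ h
      obtain ⟨X, hX⟩ := hA.1 h
      exact hB.2 ⟨_, h₁ X hX.1, h₂ X hX.1 hX.2⟩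
  | ex A hA =>
    constructor
    · rintro ⟨n, h⟩
      obtain ⟨V, hV⟩ := hA.1 h
      refine ⟨.ofSet {p | p = ([], [n]) ∨ ∃ i o, p = (i, n :: o) ∧ V.Has (i, o)},
        wellFormed_ex_of_has (n := n) ?_ (hV.1.mono ?_), n, ?_, hV.2.mono ?_⟩
      · intro p hp
        rcases Cand.has_ofSet.1 hp with h | ⟨i, o, h⟩
        · exact ⟨[], [], h⟩
        · exact ⟨i, o, h.1⟩
      · rintro ⟨i, o⟩ hp
        rcases Cand.has_ofSet.1 (Cand.has_onOutput.1 hp) with h | ⟨i', o', h⟩ <;> simp_all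
      · exact Cand.gives_iff.2 ⟨[], [], Cand.has_ofSet.2 (.inl rfl)⟩
      · rintro ⟨i, o⟩ hp
        exact Cand.has_onOutput.2 (Cand.has_ofSet.2 (.inr ⟨i, o, rfl, hp⟩))
    · rintro ⟨W, ⟨-, -, h₁⟩, n, -, h₂⟩
      exact ⟨n, hA.2 ⟨_, h₁ n, h₂⟩⟩
  | all A hA =>
    constructor
    · intro h
      choose V hV using fun n => hA.1 (h n)
      refine ⟨.ofSet {p | ∃ n i o, p = (n :: i, o) ∧ (V n).Has (i, o)},
        ⟨?_, fun n => (hV n).1.mono ?_⟩, fun n => (hV n).2.mono ?_⟩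
      · intro k p hp
        obtain ⟨n, i, o, h, -⟩ := Cand.has_ofSet.1 ⟨k, hp⟩
        exact .inr ⟨n, i, o, h⟩
      · rintro ⟨i, o⟩ hp
        obtain ⟨n', i', o', h, h'⟩ := Cand.has_ofSet.1 (Cand.has_onInput.1 hp)
        simp_all
      · rintro ⟨i, o⟩ hp
        exact Cand.has_onInput.2 (Cand.has_ofSet.2 ⟨n, i, o, rfl, hp⟩)
    · rintro ⟨W, ⟨-, h₁⟩, h₂⟩ n
      exact hA.2 ⟨_, h₁ n, h₂ n⟩

/-- It suffices for constructive truth that the pairs of a witness are recursively enumerable. -/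
theorem constructivelyTrue_of_re (h : A.IsWitness (fun _ => 0) W) (hW : REPred fun p => W.Has p) :
    A.ConstructivelyTrue := by
  classical
  obtain ⟨R, h₁, -, h₃⟩ := OracleRE.of_re (O := ∅) hW
  have hseg : Primrec (seg ∅) :=
    (Primrec.list_map Primrec.list_range ((Primrec.const false).to₂)).of_eq fun u => by
      simp [seg]
  let V : Cand := fun k => (decode k : Option (InOut × ℕ)).bind fun x =>
    if R x.1 (seg ∅ x.2) then some x.1 else none
  have hV : Primrec V := by
    refine Primrec.option_bind Primrec.decode (Primrec.ite (h₁.comp ?_ ?_) ?_ (Primrec.const _))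
    · exact Primrec.fst.comp Primrec.snd
    · exact hseg.comp (Primrec.snd.comp Primrec.snd)
    · exact Primrec.option_some.comp (Primrec.fst.comp Primrec.snd)
  have hVW : ∀ p, V.Has p ↔ W.Has p := by
    intro p
    refine Iff.trans ?_ (h₃ p).symm
    constructor
    · rintro ⟨k, hk⟩
      obtain ⟨⟨q, u⟩, -, hq⟩ := Option.bind_eq_some_iff.1 hk
      split_ifs at hq with h
      obtain rfl := Option.some.inj hq
      exact ⟨u, h⟩
    · rintro ⟨u, hu⟩
      exact ⟨encode (p, u), by simp only [V, encodek, Option.bind_some, hu, if_true]⟩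
  exact ⟨V, hV.to_comp, h.1.mono fun p hp => .inr ((hVW p).1 hp),
    h.2.mono fun p hp => (hVW p).2 hp⟩

theorem oracleRE_has {O : Set ℕ} (hW : Computable W) {α : Type*} [Primcodable α] {f : α → InOut}
    (hf : Computable f) : OracleRE O fun a => W.Has (f a) :=
  OracleRE.ex (.eq (hW.comp .snd) (Computable.option_some.comp (hf.comp .fst)))

end Form

/-! ### Decidable formulas -/

namespace Form

variable {θ : ArithForm} {e : ℕ → ℕ} {V : Cand}

theorem IsWitness.isTrue {A : ArithForm} (h : A.IsWitness e V) : A.IsTrue e :=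
  isTrue_iff_exists_isWitness.2 ⟨V, h⟩

theorem IsWitness.gives_zero_iff (h : (or θ (neg θ)).IsWitness e V) : V.Gives 0 ↔ θ.IsTrue e := by
  constructor
  · intro h₀
    rcases h.2 with h' | h'
    · exact IsWitness.isTrue ⟨h.1.2.2.1, h'.2⟩
    · exact absurd (h.1.2.1 0 1 h₀ h'.1) zero_ne_one
  · intro ht
    rcases h.2 with h' | h'
    · exact h'.1
    · exact absurd ht h'.2

theorem IsWitness.onOutput_zero (h : (or θ (neg θ)).IsWitness e V) (ht : θ.IsTrue e) :
    θ.IsWitness e (V.onOutput 0) := by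
  rcases h.2 with h' | h'
  · exact ⟨h.1.2.2.1, h'.2⟩
  · exact absurd ht h'.2

theorem IsWitness.onInput {A : ArithForm} (h : (all A).IsWitness e V) (n : ℕ) :
    A.IsWitness (push n e) (V.onInput n) := ⟨h.1.2 n, h.2 n⟩

section deciding

variable {ξ : ArithForm}

theorem isTrue_rename_family (hξ : ξ.FreeBelow 2) (v i : ℕ) :
    (ξ.rename fun k => if k = 0 then 0 else v + 1).IsTrue (push i e) ↔ i ∈ ξ.family (e v) := by
  refine (holds_rename _ ξ _ _).trans (holds_congr _ hξ fun k hk => ?_)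
  obtain rfl | rfl : k = 0 ∨ k = 1 := by omega
  · rfl
  · rfl

theorem correct_deciding (hξ : ξ.FreeBelow 2) (v : ℕ) : (deciding ξ v).Correct e V ↔ ∀ i,
    (∃ i' o, V.Has (i :: i', 0 :: o)) ∧ i ∈ ξ.family (e v) ∨
      (∃ i' o, V.Has (i :: i', 1 :: o)) ∧ i ∉ ξ.family (e v) := by
  refine forall_congr' fun i => ?_
  refine or_congr (and_congr ?_ ?_) (and_congr ?_ ?_)
  · simp only [Cand.gives_iff, Cand.has_onInput]
  · exact not_not.trans (isTrue_rename_family hξ v i)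
  · simp only [Cand.gives_iff, Cand.has_onInput]
  · exact not_congr (isTrue_rename_family hξ v i)

theorem wellFormed_deciding (v : ℕ)
    (h : ∀ p, V.Has p → ∃ n j, j < 2 ∧ p = ([n], [j]))
    (hu : ∀ n j j', V.Has ([n], [j]) → V.Has ([n], [j']) → j = j') :
    (deciding ξ v).WellFormed V := by
  have leaf : ∀ n j k p, ((V.onInput n).onOutput j) k = some p → p = ([], []) := by
    rintro n j k ⟨i, o⟩ hp
    obtain ⟨n', j', -, h⟩ := h _ (Cand.has_onInput.1 (Cand.has_onOutput.1 ⟨k, hp⟩))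
    simp_all
  refine ⟨fun k p hp => ?_, fun n => ⟨fun k p hp => ?_, fun j j' hj hj' => ?_, leaf n 0, leaf n 1⟩⟩
  · obtain ⟨n, j, -, h⟩ := h p ⟨k, hp⟩
    exact .inr ⟨n, [], [j], h⟩
  · obtain ⟨n', j, hj, h⟩ := h _ (Cand.has_onInput.1 ⟨k, hp⟩)
    simp only [Prod.mk.injEq, List.cons.injEq] at h
    exact .inr ⟨j, [], [], hj, Prod.ext h.1.2 h.2⟩
  · simp only [Cand.gives_iff, Cand.has_onInput] at hj hj'
    obtain ⟨i, o, hj⟩ := hj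
    obtain ⟨i', o', hj'⟩ := hj'
    obtain ⟨n₁, j₁, -, h₁⟩ := h _ hj
    obtain ⟨n₂, j₂, -, h₂⟩ := h _ hj'
    simp only [Prod.mk.injEq, List.cons.injEq] at h₁ h₂
    obtain ⟨⟨rfl, rfl⟩, rfl, rfl⟩ := h₁
    obtain ⟨⟨-, rfl⟩, rfl, rfl⟩ := h₂
    exact hu _ _ _ hj hj'

/-- The antecedent of the path sentence. -/
def pathAntecedent (ξ len tree : ArithForm) : ArithForm :=
  all (ex (and len (and tree (deciding ξ 0))))

/-- The consequent of the path sentence. -/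
def pathConsequent (ξ inc : ArithForm) : ArithForm :=
  ex (ex (and inc (and (deciding ξ 1) (deciding ξ 0))))

end deciding

end Form

/-! ### Incompatible sequences -/

/-- The codes `s` and `t` denote incompatible sequences. -/
def Incompatible (s t : ℕ) : Prop :=
  ¬ Denumerable.ofNat (List ℕ) s <+: Denumerable.ofNat (List ℕ) t ∧
    ¬ Denumerable.ofNat (List ℕ) t <+: Denumerable.ofNat (List ℕ) s

theorem primrecRel_incompatible : PrimrecRel Incompatible := by
  have h : PrimrecRel fun s t : List ℕ => s <+: t := by
    refine PrimrecRel.of_eq (r := fun s t : List ℕ => t.take s.length = s) ?_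
      fun s t => ⟨fun h => h ▸ List.take_prefix _ _, fun h => (List.prefix_iff_eq_take.1 h).symm⟩
    exact Primrec.eq.comp (Primrec.list_take.comp (Primrec.list_length.comp Primrec.fst) Primrec.snd)
      Primrec.fst
  have hd := Primrec.ofNat (List ℕ)
  exact PrimrecPred.and (h.comp (hd.comp Primrec.fst) (hd.comp Primrec.snd)).not
    (h.comp (hd.comp Primrec.snd) (hd.comp Primrec.fst)).not

theorem Form.ExpressesIncompatible.isTrue_iff {inc : ArithForm} (h : inc.ExpressesIncompatible)
    (s t : ℕ) : inc.IsTrue (push s (push t fun _ => 0)) ↔ Incompatible s t := by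
  have := h.2.2 (Denumerable.ofNat (List ℕ) s) (Denumerable.ofNat (List ℕ) t)
  rwa [Denumerable.encode_ofNat, Denumerable.encode_ofNat] at this

theorem Form.ExpressesLength.isTrue_iff {len : ArithForm} (h : len.ExpressesLength) (s n : ℕ) :
    len.IsTrue (push s (push n fun _ => 0)) ↔ (Denumerable.ofNat (List ℕ) s).length = n := by
  have := h.2.2 (Denumerable.ofNat (List ℕ) s) n
  rwa [Denumerable.encode_ofNat] at this

theorem Form.ExpressesTree.isTrue_iff {tree : ArithForm} {T : Set (List ℕ)}
    (h : tree.ExpressesTree T) (s : ℕ) (e : ℕ → ℕ) :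
    tree.IsTrue (push s e) ↔ Denumerable.ofNat (List ℕ) s ∈ T := by
  have := h.2.2 (Denumerable.ofNat (List ℕ) s)
  rw [Denumerable.encode_ofNat] at this
  rw [← this]
  refine Form.isTrue_congr h.1 fun k hk => ?_
  obtain rfl : k = 0 := by omega
  rfl

/-- If there is a sequence of every length in `T` and these are compatible, then `T` has a path. -/
theorem WellFoundedTree.exists_incompatible {T : Set (List ℕ)} (hT : WellFoundedTree T)
    {S : ℕ → ℕ} (hS : ∀ n, (Denumerable.ofNat (List ℕ) (S n)).length = n)
    (hST : ∀ n, Denumerable.ofNat (List ℕ) (S n) ∈ T) : ∃ n m, Incompatible (S n) (S m) := by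
  by_contra hc
  have hpre : ∀ n m, n ≤ m → Denumerable.ofNat (List ℕ) (S n) <+: Denumerable.ofNat (List ℕ) (S m) := by
    intro n m hnm
    by_contra h
    refine hc ⟨n, m, h, fun h' => h ?_⟩
    have hlen := h'.length_le
    rw [hS, hS] at hlen
    obtain rfl : n = m := le_antisymm hnm hlen
    exact List.prefix_rfl
  refine hT ⟨fun k => (Denumerable.ofNat (List ℕ) (S (k + 1))).getD k 0, fun n => ?_⟩
  convert! hST n using 1
  refine List.ext_getElem (by simp [hS]) fun k h₁ h₂ => ?_
  rw [hS] at h₂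
  have h₃ : k < (Denumerable.ofNat (List ℕ) (S (k + 1))).length := by rw [hS]; omega
  simp only [List.getElem_map, List.getElem_range]
  rw [List.getD_eq_getElem _ _ h₃]
  exact (hpre (k + 1) n h₂).getElem h₃

/-! ### The recursive witness for a well-founded tree -/

/-- The first input and the first output of the pair at the position `k` of `σ`. -/
def entry (σ : List (Option InOut)) (k : ℕ) : Option (ℕ × ℕ) :=
  (σ[k]?).bind fun x => x.bind fun p => p.1.head?.bind fun n => p.2.head?.map fun s => (n, s)

theorem primrec₂_entry : Primrec₂ entry := by
  refine Primrec.option_bind (Primrec.list_getElem?.comp Primrec.fst Primrec.snd) ?_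
  refine Primrec.option_bind Primrec.snd ?_
  refine Primrec.option_bind (Primrec.list_head?.comp (Primrec.fst.comp Primrec.snd)) ?_
  refine Primrec.option_map (Primrec.list_head?.comp
    (Primrec.snd.comp (Primrec.snd.comp Primrec.fst))) ?_
  exact (Primrec.snd.comp Primrec.fst).pair Primrec.snd

theorem entry_eq_some {σ : List (Option InOut)} {k n s : ℕ} :
    entry σ k = some (n, s) ↔ ∃ i o, σ[k]? = some (some (n :: i, s :: o)) := by
  constructor
  · intro h
    obtain ⟨x, hx, h₁⟩ := Option.bind_eq_some_iff.1 h
    obtain ⟨⟨i, o⟩, rfl, h₂⟩ := Option.bind_eq_some_iff.1 h₁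
    obtain ⟨n', hn, h₃⟩ := Option.bind_eq_some_iff.1 h₂
    obtain ⟨s', hs, h₄⟩ := Option.map_eq_some_iff.1 h₃
    obtain ⟨rfl, rfl⟩ := Prod.mk.inj h₄
    obtain ⟨i', rfl⟩ := List.head?_eq_some_iff.1 hn
    obtain ⟨o', rfl⟩ := List.head?_eq_some_iff.1 hs
    exact ⟨i', o', hx⟩
  · rintro ⟨i, o, h⟩
    simp [entry, h]

open Classical in
/-- The positions coded by `u` have incompatible first outputs. -/
noncomputable def hit (σ : List (Option InOut)) (u : ℕ) : Bool :=
  ((entry σ u.unpair.1).bind fun a => (entry σ u.unpair.2).map fun b =>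
    decide (Incompatible a.2 b.2)).getD false

theorem primrec₂_hit : Primrec₂ hit := by
  classical
  refine Primrec.option_getD.comp (Primrec.option_bind (primrec₂_entry.comp Primrec.fst
    (Primrec.fst.comp (Primrec.unpair.comp Primrec.snd))) ?_) (Primrec.const false)
  refine Primrec.option_map (primrec₂_entry.comp (Primrec.fst.comp Primrec.fst)
    (Primrec.snd.comp (Primrec.unpair.comp (Primrec.snd.comp Primrec.fst)))) ?_
  exact (PrimrecRel.decide primrecRel_incompatible).comp
    (Primrec.snd.comp (Primrec.snd.comp Primrec.fst)) (Primrec.snd.comp Primrec.snd)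

theorem hit_eq_true {σ : List (Option InOut)} {u : ℕ} : hit σ u = true ↔ ∃ n s m t,
    entry σ u.unpair.1 = some (n, s) ∧ entry σ u.unpair.2 = some (m, t) ∧ Incompatible s t := by
  unfold hit
  rcases entry σ u.unpair.1 with _ | ⟨n, s⟩
  · simp
  · rcases entry σ u.unpair.2 with _ | ⟨m, t⟩
    · simp
    · simp

/-- The first incompatible outputs in `σ` are `s` on input `n` and `t` on input `m`. -/
def FirstHit (σ : List (Option InOut)) (n s m t : ℕ) : Prop :=
  ∃ u, hit σ u = true ∧ (∀ v < u, hit σ v = false) ∧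
    entry σ u.unpair.1 = some (n, s) ∧ entry σ u.unpair.2 = some (m, t)

theorem max_unpair_le_of_le {u v : ℕ} (h : u ≤ v) :
    max u.unpair.1 u.unpair.2 ≤ max v.unpair.1 v.unpair.2 := by
  have h₁ := Nat.max_sq_add_min_le_pair u.unpair.1 u.unpair.2
  have h₂ := Nat.pair_lt_max_add_one_sq v.unpair.1 v.unpair.2
  rw [Nat.pair_unpair] at h₁ h₂
  by_contra! hlt
  have := Nat.pow_le_pow_left (Nat.succ_le_of_lt hlt) 2
  simp only [Nat.succ_eq_add_one] at this
  omega

section segments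

variable {X : Cand} {σ τ : List (Option InOut)}

theorem lt_length_of_entry {k : ℕ} {a : ℕ × ℕ} (h : entry σ k = some a) : k < σ.length := by
  obtain ⟨n, s⟩ := a
  obtain ⟨i, o, h⟩ := entry_eq_some.1 h
  exact (List.getElem?_eq_some_iff.1 h).1

theorem entry_congr (hσ : Cand.IsSegment σ X) (hτ : Cand.IsSegment τ X) {k : ℕ}
    (h₁ : k < σ.length) (h₂ : k < τ.length) : entry σ k = entry τ k := by
  unfold entry
  rw [Cand.getElem?_of_isSegment hσ h₁, Cand.getElem?_of_isSegment hτ h₂]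

theorem hit_congr (hσ : Cand.IsSegment σ X) (hτ : Cand.IsSegment τ X) {u : ℕ}
    (h₁ : max u.unpair.1 u.unpair.2 < σ.length) (h₂ : max u.unpair.1 u.unpair.2 < τ.length) :
    hit σ u = hit τ u := by
  unfold hit
  rw [entry_congr hσ hτ (k := u.unpair.1) (by omega) (by omega),
    entry_congr hσ hτ (k := u.unpair.2) (by omega) (by omega)]

theorem lt_length_of_hit {u : ℕ} (h : hit σ u = true) : max u.unpair.1 u.unpair.2 < σ.length := by
  obtain ⟨n, s, m, t, h₁, h₂, -⟩ := hit_eq_true.1 h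
  exact max_lt (lt_length_of_entry h₁) (lt_length_of_entry h₂)

theorem FirstHit.unique (hσ : Cand.IsSegment σ X) (hτ : Cand.IsSegment τ X) {n s m t n' s' m' t' : ℕ}
    (h : FirstHit σ n s m t) (h' : FirstHit τ n' s' m' t') :
    n = n' ∧ s = s' ∧ m = m' ∧ t = t' := by
  obtain ⟨u, h₁, h₂, h₃, h₄⟩ := h
  obtain ⟨v, h₁', h₂', h₃', h₄'⟩ := h'
  have key : ∀ {σ τ : List (Option InOut)}, Cand.IsSegment σ X → Cand.IsSegment τ X → ∀ {u v : ℕ},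
      hit σ u = true → hit τ v = true → (∀ w < v, hit τ w = false) → ¬ u < v := by
    intro σ τ hσ hτ u v hu hv hmin huv
    have h₁ := lt_length_of_hit hu
    have h₂ := lt_of_le_of_lt (max_unpair_le_of_le huv.le) (lt_length_of_hit hv)
    rw [hit_congr hσ hτ h₁ h₂, hmin u huv] at hu
    cases hu
  obtain rfl : u = v := le_antisymm (not_lt.1 (key hτ hσ h₁' h₁ h₂)) (not_lt.1 (key hσ hτ h₁ h₁' h₂'))
  rw [entry_congr hσ hτ (lt_length_of_entry h₃) (lt_length_of_entry h₃')] at h₃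
  rw [entry_congr hσ hτ (lt_length_of_entry h₄) (lt_length_of_entry h₄')] at h₄
  have e₁ := Option.some.inj (h₃.symm.trans h₃')
  have e₂ := Option.some.inj (h₄.symm.trans h₄')
  simp only [Prod.mk.injEq] at e₁ e₂
  exact ⟨e₁.1, e₁.2, e₂.1, e₂.2⟩

/-- Incompatible outputs of `X` give a first pair of such outputs in all long segments. -/
theorem exists_firstHit {n s m t : ℕ} (hn : (X.onInput n).Gives s) (hm : (X.onInput m).Gives t)
    (h : Incompatible s t) : ∃ n s m t l, (X.onInput n).Gives s ∧ (X.onInput m).Gives t ∧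
      Incompatible s t ∧ ∀ l' ≥ l, FirstHit ((List.range l').map X) n s m t := by
  classical
  have hent : ∀ {l k n s : ℕ}, entry ((List.range l).map X) k = some (n, s) →
      (X.onInput n).Gives s := by
    intro l k n s h
    have hk := lt_length_of_entry h
    obtain ⟨i, o, h⟩ := entry_eq_some.1 h
    rw [Cand.getElem?_of_isSegment (Cand.isSegment_map_range X l) hk] at h
    exact Cand.gives_iff.2 ⟨i, o, Cand.has_onInput.2 ⟨k, Option.some.inj h⟩⟩
  have hex : ∃ u, ∃ l, hit ((List.range l).map X) u = true := by
    obtain ⟨i, o, h₁⟩ := Cand.gives_iff.1 hn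
    obtain ⟨i', o', h₂⟩ := Cand.gives_iff.1 hm
    obtain ⟨k, hk⟩ := Cand.has_onInput.1 h₁
    obtain ⟨k', hk'⟩ := Cand.has_onInput.1 h₂
    refine ⟨Nat.pair k k', k + k' + 1, hit_eq_true.2 ⟨n, s, m, t, ?_, ?_, h⟩⟩
    · rw [Nat.unpair_pair]
      refine entry_eq_some.2 ⟨i, o, ?_⟩
      rw [Cand.getElem?_of_isSegment (Cand.isSegment_map_range X _) (by simp +arith), hk]
    · rw [Nat.unpair_pair]
      refine entry_eq_some.2 ⟨i', o', ?_⟩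
      rw [Cand.getElem?_of_isSegment (Cand.isSegment_map_range X _) (by simp +arith), hk']
  obtain ⟨l, hl⟩ := Nat.find_spec hex
  set u := Nat.find hex
  obtain ⟨n', s', m', t', h₁, h₂, h₃⟩ := hit_eq_true.1 hl
  refine ⟨n', s', m', t', l, hent h₁, hent h₂, h₃, fun l' hl' => ⟨u, ?_, fun v hv => ?_, ?_, ?_⟩⟩
  · have := lt_length_of_hit hl
    rw [hit_congr (Cand.isSegment_map_range X l') (Cand.isSegment_map_range X l) _ this]
    · exact hl
    · simp at this ⊢; omega
  · by_contra hne
    exact Nat.find_min hex hv ⟨l', by simpa using hne⟩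
  · have := lt_length_of_entry h₁
    rw [entry_congr (Cand.isSegment_map_range X l') (Cand.isSegment_map_range X l) _ this]
    · exact h₁
    · simp at this ⊢; omega
  · have := lt_length_of_entry h₂
    rw [entry_congr (Cand.isSegment_map_range X l') (Cand.isSegment_map_range X l) _ this]
    · exact h₂
    · simp at this ⊢; omega

end segments

/-- The pairs of the witness of the path sentence of a well-founded tree, where `D` decides
incompatibility. -/
def PathPair (D : Cand) (p : InOut) : Prop :=
  ∃ (σ : List (Option InOut)) (n s m t : ℕ), FirstHit σ n s m t ∧ ∃ i o : List ℕ,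
    (p = (encode σ :: 0 :: i, s :: t :: o) ∧ D.Has (s :: t :: i, 0 :: o)) ∨
    (p = (encode σ :: 1 :: 0 :: i, s :: t :: o) ∧ some (n :: 1 :: 1 :: i, s :: o) ∈ σ) ∨
    (p = (encode σ :: 1 :: 1 :: i, s :: t :: o) ∧ some (m :: 1 :: 1 :: i, t :: o) ∈ σ)

/-! ### Computability of compound functions -/

attribute [fun_prop] Computable

namespace Computable

variable {α β γ : Type*} [Primcodable α] [Primcodable β] [Primcodable γ]

@[fun_prop] theorem fun_id : Computable fun a : α => a := Computable.id

@[fun_prop] theorem fun_const (b : β) : Computable fun _ : α => b := Computable.const b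

@[fun_prop] theorem fun_comp {f : β → γ} {g : α → β} (hf : Computable f) (hg : Computable g) :
    Computable fun a => f (g a) := hf.comp hg

@[fun_prop] theorem fun_mk {f : α → β} {g : α → γ} (hf : Computable f) (hg : Computable g) :
    Computable fun a => (f a, g a) := hf.pair hg

@[fun_prop] theorem fun_fst {f : α → β × γ} (hf : Computable f) : Computable fun a => (f a).1 :=
  Computable.fst.comp hf

@[fun_prop] theorem fun_snd {f : α → β × γ} (hf : Computable f) : Computable fun a => (f a).2 :=
  Computable.snd.comp hf

@[fun_prop] theorem fun_cons {f : α → β} {g : α → List β} (hf : Computable f) (hg : Computable g) :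
    Computable fun a => f a :: g a := Primrec.list_cons.to_comp.comp hf hg

@[fun_prop] theorem fun_encode {f : α → β} (hf : Computable f) :
    Computable fun a => encode (f a) := Computable.encode.comp hf

@[fun_prop] theorem fun_some {f : α → β} (hf : Computable f) : Computable fun a => some (f a) :=
  Computable.option_some.comp hf

@[fun_prop] theorem fun_getElem? {f : α → List β} {g : α → ℕ} (hf : Computable f)
    (hg : Computable g) : Computable fun a => (f a)[g a]? :=
  Primrec.list_getElem?.to_comp.comp hf hg

@[fun_prop] theorem fun_length {f : α → List β} (hf : Computable f) :
    Computable fun a => (f a).length := Primrec.list_length.to_comp.comp hf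

@[fun_prop] theorem fun_append {f g : α → List β} (hf : Computable f) (hg : Computable g) :
    Computable fun a => f a ++ g a := Primrec.list_append.to_comp.comp hf hg

@[fun_prop] theorem fun_take {f : α → ℕ} {g : α → List β} (hf : Computable f) (hg : Computable g) :
    Computable fun a => (g a).take (f a) := Primrec.list_take.to_comp.comp hf hg

@[fun_prop] theorem fun_ofNat {f : α → ℕ} (hf : Computable f) :
    Computable fun a => Denumerable.ofNat (List ℕ) (f a) := (Computable.ofNat (List ℕ)).comp hf

@[fun_prop] theorem fun_pair {f g : α → ℕ} (hf : Computable f) (hg : Computable g) :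
    Computable fun a => Nat.pair (f a) (g a) := Primrec₂.natPair.to_comp.comp hf hg

@[fun_prop] theorem fun_unpair {f : α → ℕ} (hf : Computable f) :
    Computable fun a => (f a).unpair := Computable.unpair.comp hf

@[fun_prop] theorem fun_add {f g : α → ℕ} (hf : Computable f) (hg : Computable g) :
    Computable fun a => f a + g a := Primrec.nat_add.to_comp.comp hf hg

end Computable

theorem OracleRE.list_mem {O : Set ℕ} {α β : Type*} [Primcodable α] [Primcodable β] {f : α → β}
    {g : α → List β} (hf : Computable f) (hg : Computable g) : OracleRE O fun a => f a ∈ g a :=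
  OracleRE.of_iff (p := fun a => ∃ k : ℕ, (g a)[k]? = some (f a)) (.ex (.eq (by fun_prop)
    (by fun_prop))) fun a => List.mem_iff_getElem?.symm

theorem OracleRE.firstHit {O : Set ℕ} : OracleRE O fun x : List (Option InOut) × ℕ × ℕ × ℕ × ℕ =>
    FirstHit x.1 x.2.1 x.2.2.1 x.2.2.2.1 x.2.2.2.2 := by
  have h₁ : ∀ {α : Type} [Primcodable α] {f : α → List (Option InOut)} {g : α → ℕ},
      Computable f → Computable g → Computable fun a => hit (f a) (g a) :=
    fun hf hg => primrec₂_hit.to_comp.comp hf hg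
  have h₂ : ∀ {α : Type} [Primcodable α] {f : α → List (Option InOut)} {g : α → ℕ},
      Computable f → Computable g → Computable fun a => entry (f a) (g a) :=
    fun hf hg => primrec₂_entry.to_comp.comp hf hg
  refine .ex (.and (.eq (h₁ ?_ ?_) ?_) (.and (.forall_lt
    (p := fun (x : (List (Option InOut) × ℕ × ℕ × ℕ × ℕ) × ℕ) v => hit x.1.1 v = false)
    (.eq (h₁ ?_ ?_) ?_) ?_) (.and (.eq (h₂ ?_ ?_) ?_) (.eq (h₂ ?_ ?_) ?_)))) <;> fun_prop

theorem rePred_pathPair {D : Cand} (hD : Computable D) : REPred (PathPair D) := by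
  refine OracleRE.re ?_
  refine .ex (.ex (.ex (.ex (.ex (.and ?_ (.ex (.ex (.or (.and ?_ ?_) (.or (.and ?_ ?_)
    (.and ?_ ?_))))))))))
  · exact OracleRE.firstHit.comp (f := fun x : ((((InOut × List (Option InOut)) × ℕ) × ℕ) × ℕ) × ℕ =>
      (x.1.1.1.1.2, x.1.1.1.2, x.1.1.2, x.1.2, x.2)) (by fun_prop)
  · refine .eq ?_ ?_ <;> fun_prop
  · exact Form.oracleRE_has hD (by fun_prop)
  · refine .eq ?_ ?_ <;> fun_prop
  · refine .list_mem ?_ ?_ <;> fun_prop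
  · refine .eq ?_ ?_ <;> fun_prop
  · refine .list_mem ?_ ?_ <;> fun_prop

namespace Form

variable {ξ len inc tree : ArithForm} {T : Set (List ℕ)}

theorem wellFormed_pathSentence_pathPair {D : Cand}
    (hD : (all (all (or inc (neg inc)))).IsWitness (fun _ => 0) D) :
    (pathSentence ξ len tree inc).WellFormed (.ofSet {p | PathPair D p}) := by
  refine ⟨?_, fun X hX => ?_⟩
  · intro k p hp
    obtain ⟨σ, n, s, m, t, -, i, o, h | h | h⟩ := Cand.has_ofSet.1 ⟨k, hp⟩
    · exact .inr ⟨σ, _, _, h.1⟩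
    · exact .inr ⟨σ, _, _, h.1⟩
    · exact .inr ⟨σ, _, _, h.1⟩
  by_cases hex : ∃ (τ : List (Option InOut)) (n s m t : ℕ), Cand.IsSegment τ X ∧ FirstHit τ n s m t
  swap
  · refine wellFormed_of_not_has ?_
    rintro ⟨i, o⟩ hp
    obtain ⟨σ, hσ, hp⟩ := Cand.has_app.1 hp
    obtain ⟨σ', n, s, m, t, hf, i', o', h⟩ := Cand.has_ofSet.1 hp
    have : σ = σ' := by
      rcases h with h | h | h <;> exact encode_injective (List.cons.inj (Prod.mk.inj h.1).1).1
    exact hex ⟨σ, n, s, m, t, hσ, this ▸ hf⟩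
  obtain ⟨τ, n, s, m, t, hτ, hf⟩ := hex
  have hmem : ∀ {σ : List (Option InOut)} {p : InOut}, Cand.IsSegment σ X → some p ∈ σ → X.Has p := by
    intro σ p hσ hp
    obtain ⟨k, hk⟩ := List.mem_iff_getElem?.1 hp
    rw [Cand.getElem?_of_isSegment hσ (List.getElem?_eq_some_iff.1 hk).1] at hk
    exact ⟨k, Option.some.inj hk⟩
  have key : ∀ p, Cand.Has (Cand.app (.ofSet {p | PathPair D p}) X) p → ∃ i o : List ℕ,
      (p = (0 :: i, s :: t :: o) ∧ D.Has (s :: t :: i, 0 :: o)) ∨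
      (p = (1 :: 0 :: i, s :: t :: o) ∧ X.Has (n :: 1 :: 1 :: i, s :: o)) ∨
      (p = (1 :: 1 :: i, s :: t :: o) ∧ X.Has (m :: 1 :: 1 :: i, t :: o)) := by
    rintro ⟨i, o⟩ hp
    obtain ⟨σ, hσ, hp⟩ := Cand.has_app.1 hp
    obtain ⟨σ', n', s', m', t', hf', i', o', h⟩ := Cand.has_ofSet.1 hp
    have : σ = σ' := by
      rcases h with h | h | h <;> exact encode_injective (List.cons.inj (Prod.mk.inj h.1).1).1
    subst this
    obtain ⟨rfl, rfl, rfl, rfl⟩ := FirstHit.unique hσ hτ hf' hf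
    refine ⟨i', o', ?_⟩
    rcases h with ⟨h, h'⟩ | ⟨h, h'⟩ | ⟨h, h'⟩
    · left
      simp_all
    · right; left
      exact ⟨by simp_all, hmem hσ h'⟩
    · right; right
      exact ⟨by simp_all, hmem hσ h'⟩
  have hXP : ∀ n s, (deciding ξ 0).WellFormed
      ((((X.onInput n).onOutput s).onInput 1).onInput 1) :=
    fun n s => ((hX.2 n).2.2 s).2.2.2.2
  refine wellFormed_ex_of_has (n := s) ?_ (wellFormed_ex_of_has (n := t) ?_ ⟨?_, ?_, ?_, ?_, ?_⟩)
  · intro p hp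
    obtain ⟨i, o, h | h | h⟩ := key p hp <;> exact ⟨_, _, h.1⟩
  · rintro ⟨i, o⟩ hp
    obtain ⟨i', o', h | h | h⟩ := key _ (Cand.has_onOutput.1 hp) <;>
      exact ⟨i, o', by simp_all⟩
  · rintro k ⟨i, o⟩ hp
    obtain ⟨i', o', h | h | h⟩ := key _ (Cand.has_onOutput.1 (Cand.has_onOutput.1 ⟨k, hp⟩))
    · exact .inr ⟨0, i', o, by simp_all⟩
    · exact .inr ⟨1, 0 :: i', o, by simp_all⟩
    · exact .inr ⟨1, 1 :: i', o, by simp_all⟩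
  · refine (((hD.1.2 s).2 t).2.2.1).mono ?_
    rintro ⟨i, o⟩ hp
    obtain ⟨i', o', h | h | h⟩ :=
      key _ (Cand.has_onOutput.1 (Cand.has_onOutput.1 (Cand.has_onInput.1 hp)))
    · simp only [Cand.has_onInput, Cand.has_onOutput]
      simp_all
    · simp at h
    · simp at h
  · rintro k ⟨i, o⟩ hp
    obtain ⟨i', o', h | h | h⟩ :=
      key _ (Cand.has_onOutput.1 (Cand.has_onOutput.1 (Cand.has_onInput.1 ⟨k, hp⟩)))
    · simp at h
    · exact .inr ⟨0, i', o, by simp_all⟩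
    · exact .inr ⟨1, i', o, by simp_all⟩
  · refine WellFormed.mono (A := deciding ξ 0) (hXP n s) ?_
    rintro ⟨i, o⟩ hp
    obtain ⟨i', o', h | h | h⟩ := key _ (Cand.has_onOutput.1 (Cand.has_onOutput.1
      (Cand.has_onInput.1 (Cand.has_onInput.1 hp))))
    · simp at h
    · simp only [Cand.has_onInput, Cand.has_onOutput]
      simp_all
    · simp at h
  · refine WellFormed.mono (hXP m t) ?_
    rintro ⟨i, o⟩ hp
    obtain ⟨i', o', h | h | h⟩ := key _ (Cand.has_onOutput.1 (Cand.has_onOutput.1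
      (Cand.has_onInput.1 (Cand.has_onInput.1 hp))))
    · simp at h
    · simp at h
    · simp only [Cand.has_onInput, Cand.has_onOutput]
      simp_all

theorem correct_pathSentence_pathPair (hξ : ξ.FreeBelow 2) (hlen : len.ExpressesLength)
    (hinc : inc.ExpressesIncompatible) (htree : tree.ExpressesTree T) (hT : WellFoundedTree T)
    {D : Cand} (hD : (all (all (or inc (neg inc)))).IsWitness (fun _ => 0) D) :
    (pathSentence ξ len tree inc).Correct (fun _ => 0) (.ofSet {p | PathPair D p}) := by
  intro X hX hX'
  choose S hS hS' using hX'
  have hlenS : ∀ n, (Denumerable.ofNat (List ℕ) (S n)).length = n := fun n =>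
    (hlen.isTrue_iff _ _).1 (IsWitness.isTrue ⟨((hX.2 n).2.2 (S n)).2.1, (hS' n).1⟩)
  have htreeS : ∀ n, Denumerable.ofNat (List ℕ) (S n) ∈ T := fun n =>
    (htree.isTrue_iff _ _).1 (IsWitness.isTrue ⟨((hX.2 n).2.2 (S n)).2.2.2.1, (hS' n).2.1⟩)
  have hdec : ∀ n s, (X.onInput n).Gives s → ∀ i,
      (∃ i' o, X.Has (n :: 1 :: 1 :: i :: i', s :: 0 :: o)) ∧ i ∈ ξ.family s ∨
        (∃ i' o, X.Has (n :: 1 :: 1 :: i :: i', s :: 1 :: o)) ∧ i ∉ ξ.family s := by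
    intro n s hs i
    obtain rfl := (hX.2 n).2.1 _ _ hs (hS n)
    have := (correct_deciding hξ 0).1 (hS' n).2.2 i
    simp only [Cand.has_onInput, Cand.has_onOutput] at this
    exact this
  obtain ⟨n₀, m₀, hnm⟩ := hT.exists_incompatible hlenS htreeS
  obtain ⟨n, s, m, t, l, hs, ht, hst, hfirst⟩ := exists_firstHit (hS n₀) (hS m₀) hnm
  have hmem : ∀ {p : InOut}, X.Has p → ∃ l' ≥ l, some p ∈ (List.range l').map X := by
    rintro p ⟨k, hk⟩
    exact ⟨l + k + 1, by omega, List.mem_map.2 ⟨k, by simp, hk⟩⟩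
  have h₁ : ∀ {i o : List ℕ}, X.Has (n :: 1 :: 1 :: i, s :: o) →
      Cand.Has (Cand.app (.ofSet {p | PathPair D p}) X) (1 :: 0 :: i, s :: t :: o) := by
    intro i o h
    obtain ⟨l', hl', h⟩ := hmem h
    exact Cand.has_app.2 ⟨_, Cand.isSegment_map_range X l', Cand.has_ofSet.2
      ⟨_, n, s, m, t, hfirst l' hl', i, o, .inr (.inl ⟨rfl, h⟩)⟩⟩
  have h₂ : ∀ {i o : List ℕ}, X.Has (m :: 1 :: 1 :: i, t :: o) →
      Cand.Has (Cand.app (.ofSet {p | PathPair D p}) X) (1 :: 1 :: i, s :: t :: o) := by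
    intro i o h
    obtain ⟨l', hl', h⟩ := hmem h
    exact Cand.has_app.2 ⟨_, Cand.isSegment_map_range X l', Cand.has_ofSet.2
      ⟨_, n, s, m, t, hfirst l' hl', i, o, .inr (.inr ⟨rfl, h⟩)⟩⟩
  obtain ⟨i₀, o₀, h₀⟩ : ∃ i o, X.Has (n :: 1 :: 1 :: i, s :: o) := by
    rcases hdec n s hs 0 with ⟨⟨i, o, h⟩, -⟩ | ⟨⟨i, o, h⟩, -⟩
    · exact ⟨_, _, h⟩
    · exact ⟨_, _, h⟩
  refine ⟨s, Cand.gives_iff.2 ⟨_, _, h₁ h₀⟩, t,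
    Cand.gives_iff.2 ⟨_, _, Cand.has_onOutput.2 (h₁ h₀)⟩, ?_, ?_, ?_⟩
  · have hW := ((hD.onInput s).onInput t).onOutput_zero ((hinc.isTrue_iff t s).2 ⟨hst.2, hst.1⟩)
    refine hW.2.mono ?_
    rintro ⟨i, o⟩ hp
    simp only [Cand.has_onInput, Cand.has_onOutput] at hp ⊢
    exact Cand.has_app.2 ⟨_, Cand.isSegment_map_range X l, Cand.has_ofSet.2
      ⟨_, n, s, m, t, hfirst l le_rfl, i, o, .inl ⟨rfl, hp⟩⟩⟩
  · refine (correct_deciding hξ 1).2 fun i => ?_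
    simp only [Cand.has_onInput, Cand.has_onOutput]
    refine (hdec n s hs i).imp (And.imp_left ?_) (And.imp_left ?_) <;>
    · rintro ⟨i', o, h⟩
      exact ⟨i', o, h₁ h⟩
  · refine (correct_deciding hξ 0).2 fun i => ?_
    simp only [Cand.has_onInput, Cand.has_onOutput]
    refine (hdec m t ht i).imp (And.imp_left ?_) (And.imp_left ?_) <;>
    · rintro ⟨i', o, h⟩
      exact ⟨i', o, h₂ h⟩

theorem constructivelyTrue_pathSentence (hξ : ξ.FreeBelow 2) (hlen : len.ExpressesLength)
    (hinc : inc.ExpressesIncompatible) (htree : tree.ExpressesTree T) (hT : WellFoundedTree T) :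
    (pathSentence ξ len tree inc).ConstructivelyTrue := by
  obtain ⟨D, hDc, hD⟩ := hinc.2.1
  exact constructivelyTrue_of_re ⟨wellFormed_pathSentence_pathPair hD,
    correct_pathSentence_pathPair hξ hlen hinc htree hT hD⟩
    ((rePred_pathPair hDc).of_eq fun p => (Cand.has_ofSet (D := {p | PathPair D p})).symm)

end Form

/-! ### Trees with a path -/

theorem OracleRE.ne {O : Set ℕ} {α β : Type*} [Primcodable α] [Primcodable β] {f g : α → β}
    (hf : Computable f) (hg : Computable g) : OracleRE O fun a => f a ≠ g a := by
  classical
  obtain ⟨_, h⟩ := (PrimrecPred.computablePred (Primrec.eq (α := β))).not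
  exact of_computable ⟨fun _ => inferInstance, (h.comp (hf.pair hg)).of_eq fun _ => by simp⟩

/-- The pair `p` may occur on input `n` in a witness of the antecedent of the path sentence that
chooses the sequence `s`; `Dl` and `Dt` decide length and membership in the tree. -/
def GoodPair (Dl Dt : Cand) (x : ℕ → Set ℕ) (n s : ℕ) (p : InOut) : Prop :=
  (∃ i o, p = (n :: 0 :: i, s :: o) ∧ Dl.Has (n :: s :: i, 0 :: o)) ∨
  (∃ i o, p = (n :: 1 :: 0 :: i, s :: o) ∧ Dt.Has (s :: i, 0 :: o)) ∨
  ∃ r, (p = ([n, 1, 1, r], [s, 0]) ∧ r ∈ x s) ∨ (p = ([n, 1, 1, r], [s, 1]) ∧ r ∉ x s)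

theorem GoodPair.congr {Dl Dt : Cand} {x y : ℕ → Set ℕ} {n s : ℕ} {p : InOut} (h : x s = y s) :
    GoodPair Dl Dt x n s p ↔ GoodPair Dl Dt y n s p := by
  simp only [GoodPair, h]

theorem GoodPair.exists_tail {Dl Dt : Cand} {x : ℕ → Set ℕ} {n s : ℕ} {p : InOut}
    (h : GoodPair Dl Dt x n s p) : ∃ i o, p = (n :: i, s :: o) := by
  rcases h with ⟨i, o, rfl, -⟩ | ⟨i, o, rfl, -⟩ | ⟨r, ⟨rfl, -⟩ | ⟨rfl, -⟩⟩
  · exact ⟨_, _, rfl⟩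
  · exact ⟨_, _, rfl⟩
  · exact ⟨_, _, rfl⟩
  · exact ⟨_, _, rfl⟩

theorem OracleRE.goodPair {Dl Dt : Cand} (hl : Computable Dl) (ht : Computable Dt) (O : Set ℕ) :
    OracleRE O fun a : ℕ × ℕ × InOut =>
      GoodPair Dl Dt (fun s => {r | Nat.pair s r ∈ O}) a.1 a.2.1 a.2.2 := by
  classical
  refine .or (.ex (.ex (.and ?_ ?_))) (.or (.ex (.ex (.and ?_ ?_)))
    (.ex (.or (.and ?_ ?_) (.and ?_ ?_))))
  · refine .eq ?_ ?_ <;> fun_prop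
  · exact Form.oracleRE_has hl (by fun_prop)
  · refine .eq ?_ ?_ <;> fun_prop
  · exact Form.oracleRE_has ht (by fun_prop)
  · refine .eq ?_ ?_ <;> fun_prop
  · refine (OracleRE.mem_iff (f := fun a : (ℕ × ℕ × InOut) × ℕ => Nat.pair a.1.2.1 a.2)
      (g := fun _ => true) (by fun_prop) (by fun_prop)).of_iff fun a => by simp
  · refine .eq ?_ ?_ <;> fun_prop
  · refine (OracleRE.mem_iff (f := fun a : (ℕ × ℕ × InOut) × ℕ => Nat.pair a.1.2.1 a.2)
      (g := fun _ => false) (by fun_prop) (by fun_prop)).of_iff fun a => by simp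

namespace Form

variable {ξ len inc tree : ArithForm} {T : Set (List ℕ)} {Dl Dt : Cand}

theorem isWitness_pathAntecedent (hξ : ξ.FreeBelow 2) (hlen : len.ExpressesLength)
    (htree : tree.ExpressesTree T) (hDl : (all (all (or len (neg len)))).IsWitness (fun _ => 0) Dl)
    (hDt : (all (or tree (neg tree))).IsWitness (fun _ => 0) Dt) {q : ℕ → ℕ}
    (hq : ∀ n, (Denumerable.ofNat (List ℕ) (q n)).length = n)
    (hqT : ∀ n, Denumerable.ofNat (List ℕ) (q n) ∈ T) {X : Cand}
    (hX : ∀ p, X.Has p ↔ ∃ n, GoodPair Dl Dt ξ.family n (q n) p) :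
    (pathAntecedent ξ len tree).IsWitness (fun _ => 0) X := by
  have hX' : ∀ {n i o}, X.Has (n :: i, o) ↔ GoodPair Dl Dt ξ.family n (q n) (n :: i, o) := by
    intro n i o
    rw [hX]
    constructor
    · rintro ⟨n', h⟩
      obtain ⟨i', o', h'⟩ := h.exists_tail
      obtain ⟨⟨rfl, -⟩, -⟩ : (n = n' ∧ i = i') ∧ o = q n' :: o' := by simpa using h'
      exact h
    · exact fun h => ⟨n, h⟩
  have hW : ∀ n, (or tree (neg tree)).IsWitness (push n fun _ => 0) (Dt.onInput n) := hDt.onInput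
  have hlenq : ∀ n, len.IsWitness (push (q n) (push n fun _ => 0))
      (((Dl.onInput n).onInput (q n)).onOutput 0) := fun n =>
    ((hDl.onInput n).onInput (q n)).onOutput_zero ((hlen.isTrue_iff _ _).2 (hq n))
  have htreeq : ∀ n, tree.IsWitness (push (q n) (push n fun _ => 0))
      ((Dt.onInput (q n)).onOutput 0) := fun n =>
    (isWitness_congr htree.1 fun k hk => by obtain rfl : k = 0 := by omega
                                            rfl).1
      ((hDt.onInput (q n)).onOutput_zero ((htree.isTrue_iff _ _).2 (hqT n)))
  constructor
  · refine ⟨fun k p hp => ?_, fun n => wellFormed_ex_of_has (n := q n) ?_ ⟨?_, ?_, ?_, ?_, ?_⟩⟩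
    · obtain ⟨n, h⟩ := (hX p).1 ⟨k, hp⟩
      obtain ⟨i, o, rfl⟩ := h.exists_tail
      exact .inr ⟨n, i, _, rfl⟩
    · rintro ⟨i, o⟩ hp
      obtain ⟨i', o', h⟩ := (hX'.1 (Cand.has_onInput.1 hp)).exists_tail
      simp only [Prod.mk.injEq, List.cons.injEq] at h
      exact ⟨i, o', by rw [h.2]⟩
    · rintro k ⟨i, o⟩ hp
      rcases hX'.1 (Cand.has_onInput.1 (Cand.has_onOutput.1 ⟨k, hp⟩)) with
        ⟨i', o', h, -⟩ | ⟨i', o', h, -⟩ | ⟨r, ⟨h, -⟩ | ⟨h, -⟩⟩ <;>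
        simp only [Prod.mk.injEq, List.cons.injEq, true_and] at h
      · exact .inr ⟨0, i', o, by simp, by rw [h.1]⟩
      all_goals exact .inr ⟨1, _, o, by simp, by rw [h.1]⟩
    · refine (hlenq n).1.mono ?_
      rintro ⟨i, o⟩ hp
      simp only [Cand.has_onInput, Cand.has_onOutput] at hp ⊢
      rcases hX'.1 hp with ⟨i', o', h, h'⟩ | ⟨i', o', h, -⟩ | ⟨r, ⟨h, -⟩ | ⟨h, -⟩⟩ <;> simp_all
    · rintro k ⟨i, o⟩ hp
      rcases hX'.1 (Cand.has_onInput.1 (Cand.has_onOutput.1 (Cand.has_onInput.1 ⟨k, hp⟩))) with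
        ⟨i', o', h, -⟩ | ⟨i', o', h, -⟩ | ⟨r, ⟨h, -⟩ | ⟨h, -⟩⟩ <;>
        simp only [Prod.mk.injEq, List.cons.injEq, true_and] at h
      · simp at h
      · exact .inr ⟨0, i', o, by simp, by rw [h.1]⟩
      all_goals exact .inr ⟨1, _, o, by simp, by rw [h.1]⟩
    · refine (htreeq n).1.mono ?_
      rintro ⟨i, o⟩ hp
      simp only [Cand.has_onInput, Cand.has_onOutput] at hp ⊢
      rcases hX'.1 hp with ⟨i', o', h, -⟩ | ⟨i', o', h, h'⟩ | ⟨r, ⟨h, -⟩ | ⟨h, -⟩⟩ <;> simp_all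
    · refine wellFormed_deciding 0 ?_ ?_
      · rintro ⟨i, o⟩ hp
        simp only [Cand.has_onInput, Cand.has_onOutput] at hp
        rcases hX'.1 hp with ⟨i', o', h, -⟩ | ⟨i', o', h, -⟩ | ⟨r, ⟨h, -⟩ | ⟨h, -⟩⟩ <;>
          simp only [Prod.mk.injEq, List.cons.injEq, true_and] at h
        · simp at h
        · simp at h
        · exact ⟨r, 0, by simp, by rw [h.1, h.2]⟩
        · exact ⟨r, 1, by simp, by rw [h.1, h.2]⟩
      · intro r j j' hj hj'
        simp only [Cand.has_onInput, Cand.has_onOutput] at hj hj'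
        have key : ∀ {j}, X.Has ([n, 1, 1, r], [q n, j]) →
            j = 0 ∧ r ∈ ξ.family (q n) ∨ j = 1 ∧ r ∉ ξ.family (q n) := by
          intro j hj
          rcases hX'.1 hj with ⟨i', o', h, -⟩ | ⟨i', o', h, -⟩ | ⟨r', ⟨h, h'⟩ | ⟨h, h'⟩⟩ <;> simp_all
        rcases key hj with h | h <;> rcases key hj' with h' | h'
        · exact h.1.trans h'.1.symm
        · exact absurd h.2 h'.2
        · exact absurd h'.2 h.2
        · exact h.1.trans h'.1.symm
  · intro n
    have hbit : ∀ i, (∃ i' o, X.Has (n :: 1 :: 1 :: i :: i', q n :: 0 :: o)) ∧ i ∈ ξ.family (q n) ∨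
        (∃ i' o, X.Has (n :: 1 :: 1 :: i :: i', q n :: 1 :: o)) ∧ i ∉ ξ.family (q n) := by
      intro i
      by_cases h : i ∈ ξ.family (q n)
      · exact .inl ⟨⟨[], [], hX'.2 (.inr (.inr ⟨i, .inl ⟨rfl, h⟩⟩))⟩, h⟩
      · exact .inr ⟨⟨[], [], hX'.2 (.inr (.inr ⟨i, .inr ⟨rfl, h⟩⟩))⟩, h⟩
    refine ⟨q n, ?_, (hlenq n).2.mono ?_, (htreeq n).2.mono ?_, (correct_deciding hξ 0).2 ?_⟩
    · simp only [Cand.gives_iff, Cand.has_onInput]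
      rcases hbit 0 with ⟨⟨i, o, h⟩, -⟩ | ⟨⟨i, o, h⟩, -⟩
      · exact ⟨_, _, h⟩
      · exact ⟨_, _, h⟩
    · rintro ⟨i, o⟩ hp
      simp only [Cand.has_onInput, Cand.has_onOutput] at hp ⊢
      exact hX'.2 (.inl ⟨i, o, rfl, hp⟩)
    · rintro ⟨i, o⟩ hp
      simp only [Cand.has_onInput, Cand.has_onOutput] at hp ⊢
      exact hX'.2 (.inr (.inl ⟨i, o, rfl, hp⟩))
    · simp only [Cand.has_onInput, Cand.has_onOutput]
      exact hbit

/-- A witness of the consequent of the path sentence decides two incompatible members of the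
family. -/
theorem IsWitness.pathConsequent (hξ : ξ.FreeBelow 2) (hinc : inc.ExpressesIncompatible) {V : Cand}
    (hV : (pathConsequent ξ inc).IsWitness (fun _ => 0) V) : ∃ s t, Incompatible s t ∧
      (∀ i, ∃ i' j o, V.Has (1 :: 0 :: i :: i', s :: t :: j :: o)) ∧
      (∀ i, ∃ i' j o, V.Has (1 :: 1 :: i :: i', s :: t :: j :: o)) ∧
      (∀ {s' t' i i' j o}, V.Has (1 :: 0 :: i :: i', s' :: t' :: j :: o) →
        j = 0 ∧ i ∈ ξ.family s' ∨ j = 1 ∧ i ∉ ξ.family s') ∧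
      ∀ {s' t' i i' j o}, V.Has (1 :: 1 :: i :: i', s' :: t' :: j :: o) →
        j = 0 ∧ i ∈ ξ.family t' ∨ j = 1 ∧ i ∉ ξ.family t' := by
  obtain ⟨hw, s, hs, t, ht, hi, hP, hQ⟩ := hV
  have uniq : ∀ {i s' t' o}, V.Has (i, s' :: t' :: o) → s' = s ∧ t' = t := by
    intro i s' t' o h
    obtain rfl := hw.2.1 _ _ (Cand.gives_iff.2 ⟨_, _, h⟩) hs
    obtain rfl := (hw.2.2 s').2.1 _ _ (Cand.gives_iff.2 ⟨_, _, Cand.has_onOutput.2 h⟩) ht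
    exact ⟨rfl, rfl⟩
  have hww := (hw.2.2 s).2.2 t
  rw [correct_deciding hξ] at hP hQ
  simp only [Cand.has_onInput, Cand.has_onOutput] at hP hQ
  have uniqbit : ∀ {d i i₁ i₂ j₁ j₂ o₁ o₂}, d < 2 → V.Has (1 :: d :: i :: i₁, s :: t :: j₁ :: o₁) →
      V.Has (1 :: d :: i :: i₂, s :: t :: j₂ :: o₂) → j₁ = j₂ := by
    intro d i i₁ i₂ j₁ j₂ o₁ o₂ hd h₁ h₂
    obtain rfl | rfl : d = 0 ∨ d = 1 := by omega
    · refine (hww.2.2.2.1.2 i).2.1 _ _ (Cand.gives_iff.2 ⟨i₁, o₁, ?_⟩) (Cand.gives_iff.2 ⟨i₂, o₂, ?_⟩)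
      · simpa only [Cand.has_onInput, Cand.has_onOutput] using h₁
      · simpa only [Cand.has_onInput, Cand.has_onOutput] using h₂
    · refine (hww.2.2.2.2.2 i).2.1 _ _ (Cand.gives_iff.2 ⟨i₁, o₁, ?_⟩) (Cand.gives_iff.2 ⟨i₂, o₂, ?_⟩)
      · simpa only [Cand.has_onInput, Cand.has_onOutput] using h₁
      · simpa only [Cand.has_onInput, Cand.has_onOutput] using h₂
  refine ⟨s, t, ?_, fun i => ?_, fun i => ?_, fun {s' t' i i' j o} h => ?_,
    fun {s' t' i i' j o} h => ?_⟩
  · have := (hinc.isTrue_iff t s).1 (IsWitness.isTrue ⟨hww.2.1, hi⟩)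
    exact ⟨this.2, this.1⟩
  · rcases hP i with ⟨⟨i', o, h⟩, -⟩ | ⟨⟨i', o, h⟩, -⟩
    · exact ⟨i', 0, o, h⟩
    · exact ⟨i', 1, o, h⟩
  · rcases hQ i with ⟨⟨i', o, h⟩, -⟩ | ⟨⟨i', o, h⟩, -⟩
    · exact ⟨i', 0, o, h⟩
    · exact ⟨i', 1, o, h⟩
  · obtain ⟨rfl, rfl⟩ := uniq h
    rcases hP i with ⟨⟨i', o, h'⟩, hx⟩ | ⟨⟨i', o, h'⟩, hx⟩
    · exact .inl ⟨uniqbit zero_lt_two h h', hx⟩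
    · exact .inr ⟨uniqbit zero_lt_two h h', hx⟩
  · obtain ⟨rfl, rfl⟩ := uniq h
    rcases hQ i with ⟨⟨i', o, h'⟩, hx⟩ | ⟨⟨i', o, h'⟩, hx⟩
    · exact .inl ⟨uniqbit one_lt_two h h', hx⟩
    · exact .inr ⟨uniqbit one_lt_two h h', hx⟩

end Form

/-- The entries of `σ` are good pairs for the finite sequence `q` of nodes of the tree different
from `s₀`, and `W` has on `σ` a pair that decides the element `i` of the member `s₀` of the family
by `j`. -/
def Decision (Dl Dt W : Cand) (x : ℕ → Set ℕ) (d s₀ : ℕ) (a : ℕ × ℕ) : Prop :=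
  ∃ (σ : List (Option InOut)) (q : List ℕ),
    (∀ n < q.length, ∃ s, q[n]? = some s ∧ (Denumerable.ofNat (List ℕ) s).length = n ∧
      (∃ i o, Dt.Has (s :: i, 0 :: o)) ∧ s ≠ s₀) ∧
    (∀ k < σ.length, σ[k]? = some none ∨
      ∃ p n s, σ[k]? = some (some p) ∧ q[n]? = some s ∧ GoodPair Dl Dt x n s p) ∧
    ∃ s t i' o', (d = 0 ∧ s = s₀ ∨ d = 1 ∧ t = s₀) ∧
      W.Has (encode σ :: 1 :: d :: a.1 :: i', s :: t :: a.2 :: o')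

theorem OracleRE.decision {Dl Dt W : Cand} (hl : Computable Dl) (ht : Computable Dt)
    (hW : Computable W) (O : Set ℕ) (d s₀ : ℕ) :
    OracleRE O (Decision Dl Dt W (fun s => {r | Nat.pair s r ∈ O}) d s₀) := by
  refine .ex (.ex (.and (.forall_lt (p := fun (x : ((ℕ × ℕ) × List (Option InOut)) × List ℕ) n =>
      ∃ s, x.2[n]? = some s ∧ (Denumerable.ofNat (List ℕ) s).length = n ∧
        (∃ i o, Dt.Has (s :: i, 0 :: o)) ∧ s ≠ s₀)
      (.ex (.and ?_ (.and ?_ (.and (.ex (.ex ?_)) ?_)))) ?_) (.and (.forall_lt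
      (p := fun (x : ((ℕ × ℕ) × List (Option InOut)) × List ℕ) k => x.1.2[k]? = some none ∨
      ∃ p n s, x.1.2[k]? = some (some p) ∧ x.2[n]? = some s ∧
        GoodPair Dl Dt (fun s => {r | Nat.pair s r ∈ O}) n s p)
      (.or ?_ (.ex (.ex (.ex (.and ?_ (.and ?_ ?_)))))) ?_)
      (.ex (.ex (.ex (.ex (.and (.or (.and ?_ ?_) (.and ?_ ?_)) ?_))))))))
  · refine .eq ?_ ?_ <;> fun_prop
  · refine .eq ?_ ?_ <;> fun_prop
  · exact Form.oracleRE_has ht (by fun_prop)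
  · refine .ne ?_ ?_ <;> fun_prop
  · fun_prop
  · refine .eq ?_ ?_ <;> fun_prop
  · refine .eq ?_ ?_ <;> fun_prop
  · refine .eq ?_ ?_ <;> fun_prop
  · exact (OracleRE.goodPair hl ht O).comp (f := fun x : ((((((ℕ × ℕ) × List (Option InOut)) ×
      List ℕ) × ℕ) × InOut) × ℕ) × ℕ => (x.1.2, x.2, x.1.1.2)) (by fun_prop)
  · fun_prop
  · refine .eq ?_ ?_ <;> fun_prop
  · refine .eq ?_ ?_ <;> fun_prop
  · refine .eq ?_ ?_ <;> fun_prop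
  · refine .eq ?_ ?_ <;> fun_prop
  · exact Form.oracleRE_has hW (by fun_prop)

namespace Form

variable {ξ len inc tree : ArithForm} {T : Set (List ℕ)}

/-- If `T` has a path and the path sentence is constructively true, then the family is not
independent. -/
theorem not_independent_of_path (hξ : ξ.FreeBelow 2) (hlen : len.ExpressesLength)
    (hinc : inc.ExpressesIncompatible) (htree : tree.ExpressesTree T) (hT : ¬ WellFoundedTree T)
    (h : (pathSentence ξ len tree inc).ConstructivelyTrue) : ¬ Independent ξ.family := by
  classical
  obtain ⟨Dl, hDlc, hDl⟩ := hlen.2.1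
  obtain ⟨Dt, hDtc, hDt⟩ := htree.2.1
  obtain ⟨W, hWc, hW⟩ := h
  obtain ⟨π, hπ⟩ := not_not.1 hT
  set pre : ℕ → ℕ := fun n => encode ((List.range n).map π) with hpre
  have hpre_len : ∀ n, (Denumerable.ofNat (List ℕ) (pre n)).length = n := by
    intro n
    simp [hpre]
  have hpre_T : ∀ n, Denumerable.ofNat (List ℕ) (pre n) ∈ T := by
    intro n
    simpa [hpre] using hπ n
  have hDtT : ∀ s, (∃ i o, Dt.Has (s :: i, 0 :: o)) ↔ Denumerable.ofNat (List ℕ) s ∈ T := by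
    intro s
    rw [← htree.isTrue_iff s fun _ => 0, ← (hDt.onInput s).gives_zero_iff, Cand.gives_iff]
    simp only [Cand.has_onInput]
  have hconseq : ∀ X, (pathAntecedent ξ len tree).IsWitness (fun _ => 0) X →
      (pathConsequent ξ inc).IsWitness (fun _ => 0) (W.app X) :=
    fun X hX => ⟨hW.1.2 X hX.1, hW.2 X hX.1 hX.2⟩
  obtain ⟨X₀, hX₀⟩ : ∃ X : Cand, ∀ p, X.Has p ↔ ∃ n, GoodPair Dl Dt ξ.family n (pre n) p :=
    ⟨.ofSet {p | ∃ n, GoodPair Dl Dt ξ.family n (pre n) p}, fun p => Cand.has_ofSet⟩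
  obtain ⟨s, t, hst, hs, ht, -, -⟩ := (hconseq X₀ (isWitness_pathAntecedent hξ hlen htree hDl hDt
    hpre_len hpre_T hX₀)).pathConsequent hξ hinc
  obtain ⟨d, s₀, hd, hs₀, hall⟩ : ∃ d s₀, (d = 0 ∧ s = s₀ ∨ d = 1 ∧ t = s₀) ∧ (∀ n, pre n ≠ s₀) ∧
      ∀ i, ∃ i' j o, (W.app X₀).Has (1 :: d :: i :: i', s :: t :: j :: o) := by
    by_cases hsp : ∃ n, pre n = s
    · refine ⟨1, t, .inr ⟨rfl, rfl⟩, ?_, ht⟩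
      rintro m rfl
      obtain ⟨n, rfl⟩ := hsp
      simp only [Incompatible, hpre, Denumerable.ofNat_encode] at hst
      have hmono : ∀ {n m : ℕ}, n ≤ m → (List.range n).map π <+: (List.range m).map π := by
        intro n m h
        rw [List.prefix_iff_eq_take]
        simp [← List.map_take, List.take_range, h]
      rcases le_total n m with h | h
      · exact hst.1 (hmono h)
      · exact hst.2 (hmono h)
    · exact ⟨0, s, .inl ⟨rfl, rfl⟩, fun n hn => hsp ⟨n, hn⟩, hs⟩
  set O := joinWithout ξ.family s₀ with hO
  have hfam : ∀ s ≠ s₀, {r | Nat.pair s r ∈ O} = ξ.family s := by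
    intro s hs
    ext r
    simp [hO, joinWithout, hs]
  have sound : ∀ {i j}, Decision Dl Dt W (fun s => {r | Nat.pair s r ∈ O}) d s₀ (i, j) →
      j = 0 ∧ i ∈ ξ.family s₀ ∨ j = 1 ∧ i ∉ ξ.family s₀ := by
    rintro i j ⟨σ, q, hq, hσ, s', t', i', o', hd', hW'⟩
    have hq' : ∀ n, (Denumerable.ofNat (List ℕ) ((q[n]?).getD (pre n))).length = n ∧
        Denumerable.ofNat (List ℕ) ((q[n]?).getD (pre n)) ∈ T := by
      intro n
      by_cases hn : n < q.length
      · obtain ⟨s, h₁, h₂, h₃, -⟩ := hq n hn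
        rw [h₁]
        exact ⟨h₂, (hDtT s).1 h₃⟩
      · rw [List.getElem?_eq_none (not_lt.1 hn)]
        exact ⟨hpre_len n, hpre_T n⟩
    let D : Set InOut := {p | ∃ n, GoodPair Dl Dt ξ.family n ((q[n]?).getD (pre n)) p}
    let X : Cand := fun k => (σ[k]?).getD (Cand.ofSet D (k - σ.length))
    have hX : ∀ p, X.Has p ↔ p ∈ D := by
      intro p
      constructor
      · rintro ⟨k, hk⟩
        by_cases hkσ : k < σ.length
        · rcases hσ k hkσ with h | ⟨p', n, s, h₁, h₂, h₃⟩
          · simp [X, h] at hk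
          · simp only [X, h₁, Option.getD_some, Option.some.injEq] at hk
            subst hk
            obtain ⟨s'', h₄, -, -, h₅⟩ := hq n (List.getElem?_eq_some_iff.1 h₂).1
            obtain rfl := Option.some.inj (h₄.symm.trans h₂)
            exact ⟨n, by rw [h₂]; exact (GoodPair.congr (hfam s'' h₅)).1 h₃⟩
        · simp only [X, List.getElem?_eq_none (not_lt.1 hkσ), Option.getD_none] at hk
          exact Cand.has_ofSet.1 ⟨_, hk⟩
      · intro h
        obtain ⟨k, hk⟩ := Cand.has_ofSet.2 h
        exact ⟨σ.length + k, by simp [X, hk]⟩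
    have hseg : Cand.IsSegment σ X := by
      refine List.ext_getElem (by simp) fun k h₁ h₂ => ?_
      simp [X, h₁]
    have hV := Cand.has_app.2 ⟨σ, hseg, hW'⟩
    obtain ⟨-, -, -, -, -, h₁, h₂⟩ := (hconseq X (isWitness_pathAntecedent hξ hlen htree hDl hDt
      (fun n => (hq' n).1) (fun n => (hq' n).2) hX)).pathConsequent hξ hinc
    rcases hd' with ⟨rfl, rfl⟩ | ⟨rfl, rfl⟩
    · exact h₁ hV
    · exact h₂ hV
  have complete : ∀ i, ∃ j, Decision Dl Dt W (fun s => {r | Nat.pair s r ∈ O}) d s₀ (i, j) := by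
    intro i
    obtain ⟨i', j, o, hV⟩ := hall i
    obtain ⟨σ, hσ, hV⟩ := Cand.has_app.1 hV
    have hex : ∀ k, ∃ n, ∀ p, X₀ k = some p → GoodPair Dl Dt ξ.family n (pre n) p := by
      intro k
      rcases hk : X₀ k with _ | p
      · exact ⟨0, by simp⟩
      · obtain ⟨n, hn⟩ := (hX₀ p).1 ⟨k, hk⟩
        exact ⟨n, fun p' h => Option.some.inj h ▸ hn⟩
    choose N hN using hex
    let M := (Finset.range σ.length).sup N + 1
    refine ⟨j, σ, (List.range M).map pre, ?_, ?_, s, t, i', o, hd, hV⟩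
    · intro n hn
      simp only [List.length_map, List.length_range] at hn
      exact ⟨pre n, by simp [hn], hpre_len n, (hDtT _).2 (hpre_T n), hs₀ n⟩
    · intro k hk
      rw [Cand.getElem?_of_isSegment hσ hk]
      rcases hXk : X₀ k with _ | p
      · exact .inl rfl
      · have hNM : N k < M := Nat.lt_succ_of_le (Finset.le_sup (f := N) (Finset.mem_range.2 hk))
        exact .inr ⟨p, N k, pre (N k), rfl, by simp [hNM],
          (GoodPair.congr (hfam _ (hs₀ _))).2 (hN k p hXk)⟩
  intro hind
  refine hind s₀ ?_
  let f : ℕ → ℕ := fun i => if i ∈ ξ.family s₀ then 1 else 0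
  refine OracleRE.turingReducible (f := f) ?_
  refine OracleRE.of_iff (p := fun a : ℕ × ℕ => ∃ j : ℕ,
    Decision Dl Dt W (fun s => {r | Nat.pair s r ∈ O}) d s₀ (a.1, j) ∧ a.2 + j = 1)
    (.ex (.and ((OracleRE.decision hDlc hDtc hWc O d s₀).comp (by fun_prop))
      (.eq (by fun_prop) (by fun_prop)))) ?_
  rintro ⟨i, v⟩
  constructor
  · rintro ⟨j, hj, hv⟩
    rcases sound hj with ⟨rfl, h⟩ | ⟨rfl, h⟩
    · simp only [f, h, if_true]; omega
    · simp only [f, h, if_false]; omega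
  · intro hv
    obtain ⟨j, hj⟩ := complete i
    refine ⟨j, hj, ?_⟩
    simp only [f] at hv ⊢
    rcases sound hj with ⟨rfl, h⟩ | ⟨rfl, h⟩
    · simp [← hv, h]
    · simp [← hv, h]

end Form

/-! ### Decidable formulas for recursive relations -/

theorem ArithDef.exists_form₂ {P : Type} {R : (P → Set ℕ) → ℕ × ℕ → Prop} (h : ArithDef R) :
    ∃ φ : Form P, φ.ImpFree ∧ φ.FreeBelow 2 ∧ ∀ I e, φ.Holds I e ↔ R I (e 0, e 1) := by
  obtain ⟨Q, h₁, h₂⟩ := h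
  obtain ⟨φ, h₃, h₄⟩ := h₁.subst₁ ((EnvFun.var 0).natPair (EnvFun.var 1))
  refine ⟨φ.rename fun k => min k 1, h₃.rename _, Form.freeBelow_rename (fun k => by omega) φ, ?_⟩
  intro I e
  rw [Form.holds_rename, h₄, ← h₂]
  rfl

namespace Form

variable {A B : ArithForm} {e : ℕ → ℕ} {V : Cand}

theorem isWitness_or_neg_neg {b : Prop}
    (hV : ∀ p, V.Has p ↔ (p = ([], [0]) ∧ b) ∨ (p = ([], [1]) ∧ ¬ b))
    (hA : b → ¬ A.IsTrue e) (hB : ¬ b → ¬ B.IsTrue e) : (or (neg A) (neg B)).IsWitness e V := by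
  have hg : ∀ m, V.Gives m → m = 0 ∧ b ∨ m = 1 ∧ ¬ b := by
    intro m hm
    obtain ⟨i, o, hm⟩ := Cand.gives_iff.1 hm
    rcases (hV _).1 hm with ⟨h, hb⟩ | ⟨h, hb⟩ <;> simp_all
  have leaf : ∀ j k p, (V.onOutput j) k = some p → p = ([], []) := by
    rintro j k ⟨i, o⟩ hp
    rcases (hV _).1 (Cand.has_onOutput.1 ⟨k, hp⟩) with ⟨h, hb⟩ | ⟨h, hb⟩ <;> simp_all
  refine ⟨⟨?_, ?_, leaf 0, leaf 1⟩, ?_⟩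
  · intro k p hp
    rcases (hV p).1 ⟨k, hp⟩ with ⟨h, -⟩ | ⟨h, -⟩
    · exact .inr ⟨0, [], [], by simp, h⟩
    · exact .inr ⟨1, [], [], by simp, h⟩
  · intro m n hm hn
    rcases hg m hm with h | h <;> rcases hg n hn with h' | h' <;> simp_all
  · by_cases hb : b
    · exact .inl ⟨Cand.gives_iff.2 ⟨[], [], (hV _).2 (.inl ⟨rfl, hb⟩)⟩, hA hb⟩
    · exact .inr ⟨Cand.gives_iff.2 ⟨[], [], (hV _).2 (.inr ⟨rfl, hb⟩)⟩, hB hb⟩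

theorem isWitness_all {V : ℕ → Cand} {W : Cand}
    (hW : ∀ p, W.Has p ↔ ∃ n i o, p = (n :: i, o) ∧ (V n).Has (i, o))
    (hV : ∀ n, A.IsWitness (push n e) (V n)) : (all A).IsWitness e W := by
  have hW' : ∀ n p, (W.onInput n).Has p ↔ (V n).Has p := by
    rintro n ⟨i, o⟩
    rw [Cand.has_onInput, hW]
    constructor
    · rintro ⟨n', i', o', h, h'⟩
      simp_all
    · exact fun h => ⟨n, i, o, rfl, h⟩
  refine ⟨⟨fun k p hp => ?_, fun n => (hV n).1.mono fun p hp => .inr ((hW' n p).1 hp)⟩,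
    fun n => (hV n).2.mono fun p hp => (hW' n p).2 hp⟩
  obtain ⟨n, i, o, h, -⟩ := (hW p).1 ⟨k, hp⟩
  exact .inr ⟨n, i, o, h⟩

theorem constructivelyTrue_all_or_neg {φ : ArithForm} {R : ℕ → Prop} (h₁ : REPred R)
    (h₂ : REPred fun n => ¬ R n) (hφ : ∀ n, φ.IsTrue (push n fun _ => 0) ↔ R n) :
    (all (or (neg (neg φ)) (neg (neg (neg φ))))).ConstructivelyTrue := by
  refine constructivelyTrue_of_re (W := .ofSet {p | ∃ n, (p = ([n], [0]) ∧ R n) ∨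
    (p = ([n], [1]) ∧ ¬ R n)}) ?_ ?_
  · refine isWitness_all (V := fun n => .ofSet {p | (p = ([], [0]) ∧ R n) ∨
      (p = ([], [1]) ∧ ¬ R n)}) ?_ fun n => isWitness_or_neg_neg (b := R n)
        (fun p => Cand.has_ofSet) ?_ ?_
    · rintro ⟨i, o⟩
      simp only [Cand.has_ofSet, Set.mem_ofPred_eq, Prod.mk.injEq]
      constructor
      · rintro ⟨n, ⟨⟨rfl, rfl⟩, h⟩ | ⟨⟨rfl, rfl⟩, h⟩⟩
        · exact ⟨n, [], [0], ⟨rfl, rfl⟩, .inl ⟨⟨rfl, rfl⟩, h⟩⟩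
        · exact ⟨n, [], [1], ⟨rfl, rfl⟩, .inr ⟨⟨rfl, rfl⟩, h⟩⟩
      · rintro ⟨n, _, _, ⟨rfl, rfl⟩, ⟨⟨rfl, rfl⟩, h⟩ | ⟨⟨rfl, rfl⟩, h⟩⟩
        · exact ⟨n, .inl ⟨⟨rfl, rfl⟩, h⟩⟩
        · exact ⟨n, .inr ⟨⟨rfl, rfl⟩, h⟩⟩
    · exact fun h => not_not.2 ((hφ n).2 h)
    · exact fun h h' => h' (mt (hφ n).1 h)
  · refine OracleRE.re (OracleRE.of_iff (p := fun p : InOut => ∃ n, (p = ([n], [0]) ∧ R n) ∨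
      (p = ([n], [1]) ∧ ¬ R n)) (.ex (.or (.and (.eq ?_ ?_) ?_) (.and (.eq ?_ ?_) ?_)))
      fun p => by rw [Cand.has_ofSet]; rfl)
    · fun_prop
    · fun_prop
    · exact (OracleRE.of_re h₁).comp .snd
    · fun_prop
    · fun_prop
    · exact (OracleRE.of_re h₂).comp .snd

theorem constructivelyTrue_all_all_or_neg {φ : ArithForm} {R : ℕ → ℕ → Prop}
    (hR : ComputablePred fun x : ℕ × ℕ => R x.1 x.2)
    (hφ : ∀ s n, φ.IsTrue (push s (push n fun _ => 0)) ↔ R s n) :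
    (all (all (or (neg (neg φ)) (neg (neg (neg φ)))))).ConstructivelyTrue := by
  refine constructivelyTrue_of_re (W := .ofSet {p | ∃ n s, (p = ([n, s], [0]) ∧ R s n) ∨
    (p = ([n, s], [1]) ∧ ¬ R s n)}) ?_ ?_
  · refine isWitness_all (V := fun n => .ofSet {p | ∃ s, (p = ([s], [0]) ∧ R s n) ∨
      (p = ([s], [1]) ∧ ¬ R s n)}) ?_ fun n => isWitness_all (V := fun s => .ofSet
      {p | (p = ([], [0]) ∧ R s n) ∨ (p = ([], [1]) ∧ ¬ R s n)}) ?_ fun s =>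
        isWitness_or_neg_neg (b := R s n) (fun p => Cand.has_ofSet) ?_ ?_
    · rintro ⟨i, o⟩
      simp only [Cand.has_ofSet, Set.mem_ofPred_eq, Prod.mk.injEq]
      constructor
      · rintro ⟨n, s, ⟨⟨rfl, rfl⟩, h⟩ | ⟨⟨rfl, rfl⟩, h⟩⟩
        · exact ⟨n, [s], [0], ⟨rfl, rfl⟩, s, .inl ⟨⟨rfl, rfl⟩, h⟩⟩
        · exact ⟨n, [s], [1], ⟨rfl, rfl⟩, s, .inr ⟨⟨rfl, rfl⟩, h⟩⟩
      · rintro ⟨n, _, _, ⟨rfl, rfl⟩, s, ⟨⟨rfl, rfl⟩, h⟩ | ⟨⟨rfl, rfl⟩, h⟩⟩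
        · exact ⟨n, s, .inl ⟨⟨rfl, rfl⟩, h⟩⟩
        · exact ⟨n, s, .inr ⟨⟨rfl, rfl⟩, h⟩⟩
    · rintro ⟨i, o⟩
      simp only [Cand.has_ofSet, Set.mem_ofPred_eq, Prod.mk.injEq]
      constructor
      · rintro ⟨s, ⟨⟨rfl, rfl⟩, h⟩ | ⟨⟨rfl, rfl⟩, h⟩⟩
        · exact ⟨s, [], [0], ⟨rfl, rfl⟩, .inl ⟨⟨rfl, rfl⟩, h⟩⟩
        · exact ⟨s, [], [1], ⟨rfl, rfl⟩, .inr ⟨⟨rfl, rfl⟩, h⟩⟩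
      · rintro ⟨s, _, _, ⟨rfl, rfl⟩, ⟨⟨rfl, rfl⟩, h⟩ | ⟨⟨rfl, rfl⟩, h⟩⟩
        · exact ⟨s, .inl ⟨⟨rfl, rfl⟩, h⟩⟩
        · exact ⟨s, .inr ⟨⟨rfl, rfl⟩, h⟩⟩
    · exact fun h => not_not.2 ((hφ s n).2 h)
    · exact fun h h' => h' (mt (hφ s n).1 h)
  · refine OracleRE.re (OracleRE.of_iff (p := fun p : InOut => ∃ n s, (p = ([n, s], [0]) ∧ R s n) ∨
      (p = ([n, s], [1]) ∧ ¬ R s n)) (.ex (.ex (.or (.and (.eq ?_ ?_) ?_) (.and (.eq ?_ ?_) ?_))))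
      fun p => by rw [Cand.has_ofSet]; rfl)
    · fun_prop
    · fun_prop
    · exact (OracleRE.of_computable hR).comp (f := fun x : (InOut × ℕ) × ℕ => (x.2, x.1.2))
        (by fun_prop)
    · fun_prop
    · fun_prop
    · exact (OracleRE.of_computable hR.not).comp (f := fun x : (InOut × ℕ) × ℕ => (x.2, x.1.2))
        (by fun_prop)

theorem exists_expressesLength : ∃ len : ArithForm, len.ImpFree ∧ len.ExpressesLength := by
  have hR : ComputablePred fun x : ℕ × ℕ => (Denumerable.ofNat (List ℕ) x.1).length = x.2 :=
    (Primrec.eq.comp (Primrec.list_length.comp ((Primrec.ofNat (List ℕ)).comp Primrec.fst))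
      Primrec.snd).computablePred
  obtain ⟨φ, h₁, h₂, h₃⟩ := (ArithDef.of_computable (P := Empty) hR).exists_form₂
  refine ⟨φ.neg.neg, h₁, h₂, constructivelyTrue_all_all_or_neg hR fun s n => h₃ _ _, fun s n => ?_⟩
  refine not_not.trans ((h₃ _ _).trans ?_)
  show (Denumerable.ofNat (List ℕ) (encode s)).length = n ↔ _
  rw [Denumerable.ofNat_encode]

theorem exists_expressesIncompatible :
    ∃ inc : ArithForm, inc.ImpFree ∧ inc.ExpressesIncompatible := by
  have hR : ComputablePred fun x : ℕ × ℕ => Incompatible x.1 x.2 :=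
    PrimrecPred.computablePred primrecRel_incompatible
  obtain ⟨φ, h₁, h₂, h₃⟩ := (ArithDef.of_computable (P := Empty) hR).exists_form₂
  refine ⟨φ.neg.neg, h₁, h₂, constructivelyTrue_all_all_or_neg hR fun s n => h₃ _ _, fun s t => ?_⟩
  refine not_not.trans ((h₃ _ _).trans ?_)
  show Incompatible (encode s) (encode t) ↔ _
  rw [Incompatible, Denumerable.ofNat_encode, Denumerable.ofNat_encode]

end Form

/-! ### The formula for a recursive tree -/

/-- The numeral of `n`. -/
def Term.numeral : ℕ → Term
  | 0 => .zero
  | n + 1 => .add (numeral n) .one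

theorem Term.eval_numeral (e : ℕ → ℕ) (n : ℕ) : (numeral n).eval e = n := by
  induction n with
  | zero => rfl
  | succ n h => simp [numeral, eval, h]

theorem Term.freeBelow_numeral (b n : ℕ) : (numeral n).FreeBelow b := by
  induction n with
  | zero => trivial
  | succ n h => exact ⟨h, trivial⟩

theorem Term.computable_code_numeral : Computable fun n => (numeral n).code := by
  have h : Computable fun n : ℕ => (Nat.rec (Term.code .zero)
      (fun _ c => Nat.pair 3 (Nat.pair c (Term.code .one))) n : ℕ) := by
    refine Computable.nat_rec (f := fun n : ℕ => n) (g := fun _ => Term.code .zero)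
      (h := fun _ (x : ℕ × ℕ) => Nat.pair 3 (Nat.pair x.2 (Term.code .one))) .id (.const _) ?_
    show Computable fun x : ℕ × ℕ × ℕ => Nat.pair 3 (Nat.pair x.2.2 (Term.code .one))
    fun_prop
  refine h.of_eq fun n => ?_
  induction n with
  | zero => rfl
  | succ n ih => simp only [numeral, code, ← ih]

namespace Form

/-- The formula `¬¬ ∃ x (x = c ∧ φ(s, x))`, where `s` is the variable `0`. -/
def treeForm (φ : ArithForm) (c : ℕ) : ArithForm :=
  neg (neg (ex (and (eq (.var 0) (.numeral c)) (φ.rename fun k => if k = 0 then 1 else 0))))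

theorem isTrue_treeForm_iff {φ : ArithForm} {R : ℕ → ℕ → Prop}
    (hφ : ∀ e, φ.IsTrue e ↔ R (e 0) (e 1)) (c : ℕ) (e : ℕ → ℕ) :
    (treeForm φ c).IsTrue e ↔ R (e 0) c := by
  have h : ∀ n, (φ.rename fun k => if k = 0 then 1 else 0).IsTrue (push n e) ↔ R (e 0) n :=
    fun n => (holds_rename _ φ _ _).trans (hφ _)
  refine not_not.trans ⟨?_, fun hR => ?_⟩
  · rintro ⟨n, h₁, h₂⟩
    have h₁ : n = (Term.numeral c).eval (push n e) := h₁
    rw [Term.eval_numeral] at h₁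
    exact h₁ ▸ (h n).1 h₂
  · refine ⟨c, ?_, (h c).2 hR⟩
    show c = (Term.numeral c).eval (push c e)
    rw [Term.eval_numeral]

theorem pathSentence_isSentence {ξ len tree inc : ArithForm} (hlen : len.FreeBelow 2)
    (htree : tree.FreeBelow 1) (hinc : inc.FreeBelow 2) :
    (pathSentence ξ len tree inc).IsSentence := by
  have h : ∀ v < 2, (deciding ξ v).FreeBelow 2 := by
    intro v hv
    have : (ξ.rename fun k => if k = 0 then 0 else v + 1).FreeBelow 3 :=
      freeBelow_rename (fun k => by split_ifs <;> omega) ξ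
    exact ⟨this, this⟩
  exact ⟨⟨hlen, htree.mono one_le_two, h 0 (by simp)⟩, hinc, h 1 (by simp), h 0 (by simp)⟩

theorem impFree_deciding {ξ : ArithForm} (hξ : ξ.ImpFree) (v : ℕ) : (deciding ξ v).ImpFree :=
  ⟨hξ.rename _, hξ.rename _⟩

/-- Formulas for recursive trees are computed from programs. -/
theorem exists_treeForm : ∃ φ : ArithForm, φ.ImpFree ∧
    ∀ (c : Nat.Partrec.Code) (T : Set (List ℕ)), Decides c T →
      (treeForm φ (encode c)).ExpressesTree T := by
  have hev : ∀ v : ℕ, REPred fun x : ℕ × ℕ =>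
      v ∈ (Denumerable.ofNat Nat.Partrec.Code x.2).eval x.1 := by
    intro v
    have : Partrec fun x : ℕ × ℕ => (Denumerable.ofNat Nat.Partrec.Code x.2).eval x.1 :=
      Nat.Partrec.Code.eval_part.comp ((Computable.ofNat _).comp .snd) .fst
    refine OracleRE.re ((OracleRE.of_recursiveIn (O := ∅) (Nat.Partrec.recursiveIn this)).comp
      (f := fun x : ℕ × ℕ => (encode x, v)) (by fun_prop) |>.of_iff fun x => ?_)
    obtain ⟨a, b⟩ := x
    simp
  obtain ⟨φ, h₁, -, h₃⟩ := (ArithDef.of_re (P := Empty) (hev 1)).exists_form₂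
  refine ⟨φ, h₁, fun c T hT => ?_⟩
  have hval : ∀ n, (1 ∈ c.eval n ↔ Denumerable.ofNat (List ℕ) n ∈ T) ∧
      (0 ∈ c.eval n ↔ Denumerable.ofNat (List ℕ) n ∉ T) := by
    intro n
    have := hT (Denumerable.ofNat (List ℕ) n)
    rw [Denumerable.encode_ofNat] at this
    by_cases h : Denumerable.ofNat (List ℕ) n ∈ T
    · simp [this.1 h, h]
    · simp [this.2 h, h]
  have hre : ∀ v, REPred fun n => v ∈ c.eval n := fun v =>
    OracleRE.re ((OracleRE.of_re (hev v)).comp (f := fun n : ℕ => (n, encode c)) (by fun_prop)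
      |>.of_iff fun n => by simp)
  have htrue : ∀ e : ℕ → ℕ, (treeForm φ (encode c)).IsTrue e ↔
      Denumerable.ofNat (List ℕ) (e 0) ∈ T := by
    intro e
    rw [isTrue_treeForm_iff (R := fun s c => 1 ∈ (Denumerable.ofNat Nat.Partrec.Code c).eval s)
      (fun e => h₃ _ e)]
    simp only [Denumerable.ofNat_encode]
    exact (hval _).1
  refine ⟨?_, ?_, fun s => ?_⟩
  · refine ⟨⟨Nat.succ_pos _, Term.freeBelow_numeral _ _⟩, freeBelow_rename (fun k => ?_) φ⟩
    split_ifs <;> omega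
  · refine constructivelyTrue_all_or_neg (R := fun n => Denumerable.ofNat (List ℕ) n ∈ T)
      ((hre 1).of_eq fun n => (hval n).1) ((hre 0).of_eq fun n => (hval n).2) fun n => ?_
    exact not_not.symm.trans (htrue _)
  · refine (htrue _).trans ?_
    show Denumerable.ofNat (List ℕ) (encode s) ∈ T ↔ _
    rw [Denumerable.ofNat_encode]

theorem computable_code_pathSentence (ξ len inc φ : ArithForm) :
    Computable fun c : Nat.Partrec.Code => (pathSentence ξ len (treeForm φ (encode c)) inc).code := by
  have h : Computable fun c : Nat.Partrec.Code => (Term.numeral (encode c)).code :=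
    Term.computable_code_numeral.comp .encode
  have h' : Computable fun c : Nat.Partrec.Code => (treeForm φ (encode c)).code := by
    show Computable fun c : Nat.Partrec.Code => Nat.pair 2 (Nat.pair 2 (Nat.pair 6 (Nat.pair 3
      (Nat.pair (Nat.pair 0 (Nat.pair (Nat.pair 0 0) (Term.numeral (encode c)).code))
        (φ.rename fun k => if k = 0 then 1 else 0).code))))
    fun_prop
  show Computable fun c : Nat.Partrec.Code => Nat.pair 5 (Nat.pair (Nat.pair 7 (Nat.pair 6
    (Nat.pair 3 (Nat.pair len.code (Nat.pair 3 (Nat.pair (treeForm φ (encode c)).code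
      (deciding ξ 0).code)))))) (pathConsequent ξ inc).code)
  fun_prop

end Form

/-! ### Arithmetical generic sets -/

theorem ArithDef.isPrefix {P : Type} {α β : Type*} [Primcodable α] [Primcodable β] {f g : α → List β}
    (hf : Computable f) (hg : Computable g) : ArithDef (P := P) fun _ a => f a <+: g a :=
  ArithDef.ex (R := fun _ a t => f a ++ t = g a) (.eq (by fun_prop) (by fun_prop))

/-- `τ` is the least extension of `σ` that satisfies `D`, or `σ` itself if there is none. -/
def LeastExtension (D : List Bool → Prop) (σ τ : List Bool) : Prop :=
  (σ <+: τ ∧ D τ ∧ ∀ τ', σ <+: τ' → D τ' → ¬ encode τ' < encode τ) ∨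
    (τ = σ ∧ ∀ τ', σ <+: τ' → ¬ D τ')

theorem exists_leastExtension (D : List Bool → Prop) (σ : List Bool) :
    ∃ τ, LeastExtension D σ τ := by
  by_cases h : ∃ τ, σ <+: τ ∧ D τ
  · have := (measure (encode : List Bool → ℕ)).wf.has_min {τ | σ <+: τ ∧ D τ} h
    obtain ⟨τ, ⟨h₁, h₂⟩, h₃⟩ := this
    exact ⟨τ, .inl ⟨h₁, h₂, fun τ' h h' => h₃ τ' ⟨h, h'⟩⟩⟩
  · exact ⟨σ, .inr ⟨rfl, fun τ' h₁ h₂ => h ⟨τ', h₁, h₂⟩⟩⟩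

theorem LeastExtension.unique {D : List Bool → Prop} {σ τ τ' : List Bool}
    (h : LeastExtension D σ τ) (h' : LeastExtension D σ τ') : τ = τ' := by
  rcases h with ⟨h₁, h₂, h₃⟩ | ⟨h₁, h₂⟩ <;> rcases h' with ⟨h₁', h₂', h₃'⟩ | ⟨h₁', h₂'⟩
  · have := h₃ _ h₁' h₂'
    have := h₃' _ h₁ h₂
    exact encode_injective (by omega)
  · exact absurd h₂ (h₂' _ h₁)
  · exact absurd h₂' (h₂ _ h₁')
  · rw [h₁, h₁']

theorem LeastExtension.isPrefix {D : List Bool → Prop} {σ τ : List Bool}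
    (h : LeastExtension D σ τ) : σ <+: τ := by
  rcases h with h | ⟨rfl, -⟩
  exacts [h.1, List.prefix_rfl]

theorem seg_eq_of_getElem? {G : Set ℕ} {σ : List Bool}
    (h : ∀ (n : ℕ) (b : Bool), σ[n]? = some b → (n ∈ G ↔ b = true)) : seg G σ.length = σ := by
  classical
  refine List.ext_getElem? fun n => ?_
  rw [getElem?_seg]
  split_ifs with hn
  · rw [List.getElem?_eq_getElem hn, Option.some.injEq]
    have := h n _ (List.getElem?_eq_getElem hn)
    cases hb : σ[n] <;> simp_all
  · rw [List.getElem?_eq_none (by omega)]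

/-- Every arithmetical sequence of properties of finite strings has an arithmetical set that forces
each of them or its failure. -/
theorem exists_generic {D : ℕ → List Bool → Prop}
    (hD : ArithDef (P := Empty) fun _ (p : ℕ × List Bool) => D p.1 p.2) :
    ∃ G : Set ℕ, (ArithDef (P := Empty) fun _ n => n ∈ G) ∧
      ∀ k, ∃ u, D k (seg G u) ∨ ∀ τ, seg G u <+: τ → ¬ D k τ := by
  choose F hF using fun k σ => exists_leastExtension (D k) σ
  obtain ⟨s, hs₀, hs⟩ : ∃ s : ℕ → List Bool, s 0 = [] ∧
      ∀ k, LeastExtension (D k) (s k) (s (k + 1)) :=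
    ⟨fun k => Nat.rec [] F k, rfl, fun k => hF k _⟩
  have hmono : ∀ k l, k ≤ l → s k <+: s l := by
    intro k l hkl
    induction l, hkl using Nat.le_induction with
    | base => exact List.prefix_rfl
    | succ l _ ih => exact ih.trans (hs l).isPrefix
  let G : Set ℕ := {n | ∃ k, (s k)[n]? = some true}
  have hG : ∀ k, seg G (s k).length = s k := by
    refine fun k => seg_eq_of_getElem? fun n b hb => ⟨?_, ?_⟩
    · rintro ⟨l, hl⟩
      have : ∀ m, (s (max k l))[n]? = some m → m = true := by
        obtain ⟨t, ht⟩ := hmono l (max k l) (le_max_right _ _)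
        intro m hm
        rw [← ht, List.getElem?_append_left (List.getElem?_eq_some_iff.1 hl).1, hl] at hm
        simpa using hm.symm
      refine this b ?_
      obtain ⟨t, ht⟩ := hmono k (max k l) (le_max_left _ _)
      rwa [← ht, List.getElem?_append_left (List.getElem?_eq_some_iff.1 hb).1]
    · rintro rfl
      exact ⟨k, hb⟩
  refine ⟨G, ?_, fun k => ⟨(s (k + 1)).length, ?_⟩⟩
  · have hstep : ArithDef (P := Empty) fun _ (x : ℕ × List Bool × List Bool) =>
        LeastExtension (D x.1) x.2.1 x.2.2 := by
      refine .or (.and (.isPrefix ?_ ?_) (.and ?_ (.all (.imp (.isPrefix ?_ ?_) (.imp ?_ (.not (.lt ?_ ?_)))))))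
        (.and (.eq ?_ ?_) (.all (.imp (.isPrefix ?_ ?_) (.not ?_))))
      case refine_3 =>
        exact hD.comp (f := fun x : ℕ × List Bool × List Bool => (x.1, x.2.2)) (by fun_prop)
      case refine_6 =>
        exact hD.comp (f := fun x : (ℕ × List Bool × List Bool) × List Bool => (x.1.1, x.2))
          (by fun_prop)
      case refine_13 =>
        exact hD.comp (f := fun x : (ℕ × List Bool × List Bool) × List Bool => (x.1.1, x.2))
          (by fun_prop)
      all_goals fun_prop
    have hdef : ArithDef (P := Empty) fun _ (n : ℕ) => ∃ k : ℕ, ∃ L : List (List Bool),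
        L[0]? = some [] ∧ (∀ i : ℕ, i < k → ∃ a b, L[i]? = some a ∧ L[i + 1]? = some b ∧
          LeastExtension (D i) a b) ∧ ∃ a, L[k]? = some a ∧ a[n]? = some true := by
      refine .ex (.ex (.and (.eq ?_ ?_) (.and (.all (.imp (.lt ?_ ?_) (.ex (.ex (.and (.eq ?_ ?_)
        (.and (.eq ?_ ?_) (hstep.comp (f := fun x : ((((ℕ × ℕ) × List (List Bool)) × ℕ) × List Bool) ×
          List Bool => (x.1.1.2, x.1.2, x.2)) ?_)))))))
        (.ex (.and (.eq ?_ ?_) (.eq ?_ ?_))))))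
      all_goals fun_prop
    refine hdef.of_iff fun _ n => exists_congr fun k => ⟨?_, fun hn => ?_⟩
    · rintro ⟨L, h₀, h₁, a, h₂, h₃⟩
      have : ∀ i ≤ k, L[i]? = some (s i) := by
        intro i hi
        induction i with
        | zero => rw [h₀, hs₀]
        | succ i ih =>
          obtain ⟨a, b, ha, hb, h⟩ := h₁ i hi
          rw [ih (by omega), Option.some.injEq] at ha
          rw [hb, ((ha ▸ h : LeastExtension (D i) (s i) b)).unique (hs i)]
      rw [this k le_rfl, Option.some.injEq] at h₂
      exact h₂ ▸ h₃
    · have hL : ∀ i ≤ k, ((List.range (k + 1)).map s)[i]? = some (s i) := by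
        intro i hi
        simp [Nat.lt_succ_of_le hi]
      exact ⟨_, hs₀ ▸ hL 0 (Nat.zero_le _), fun i hi => ⟨_, _, hL i hi.le, hL (i + 1) hi, hs i⟩, _,
        hL k le_rfl, hn⟩
  · rw [hG]
    rcases hs k with h | ⟨h₁, h₂⟩
    · exact .inl h.2.1
    · exact .inr (h₁ ▸ h₂)

/-! ### Independent arithmetical sets -/

/-- The string `ρ` is an initial segment of `τ` with the bits of the set number `n` deleted. -/
def Masked (n : ℕ) (τ ρ : List Bool) : Prop := ∀ (k : ℕ) (b : Bool), ρ[k]? = some b →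
  (k.unpair.1 = n ∧ b = false) ∨ (¬ k.unpair.1 = n ∧ τ[k]? = some b)

/-- The machine with code `c`, using the bits of `τ` outside of the set number `n` as its oracle,
accepts the wrong bit for some element of this set. -/
def Mismatch (n : ℕ) (c : Nat.Partrec.Code) (τ : List Bool) : Prop :=
  ∃ (i : ℕ) (b : Bool) (ρ : List Bool), τ[Nat.pair n i]? = some b ∧ Masked n τ ρ ∧
    ∃ y, y ∈ c.eval (encode ((i, !b), ρ))

theorem arithDef_mismatch : ArithDef (P := Empty) fun _ (x : ℕ × List Bool) =>
    Mismatch x.1.unpair.1 (Denumerable.ofNat Nat.Partrec.Code x.1.unpair.2) x.2 := by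
  have hmask : ArithDef (P := Empty) fun _ (x : ℕ × List Bool × List Bool) =>
      Masked x.1 x.2.1 x.2.2 := by
    refine .all (.all (.imp (.eq ?_ ?_) (.or (.and (.eq ?_ ?_) (.eq ?_ ?_))
      (.and (.not (.eq ?_ ?_)) (.eq ?_ ?_))))) <;> fun_prop
  have hnot : Computable not := Primrec.not.to_comp
  have hev : ArithDef (P := Empty) fun _ (x : ℕ × (ℕ × Bool) × List Bool) =>
      ∃ y, y ∈ (Denumerable.ofNat Nat.Partrec.Code x.1).eval (encode x.2) :=
    .ex ((ArithDef.mem_partrec Nat.Partrec.Code.eval_part).comp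
      (f := fun x : (ℕ × (ℕ × Bool) × List Bool) × ℕ =>
        ((Denumerable.ofNat Nat.Partrec.Code x.1.1, encode x.1.2), x.2))
      ((((Computable.ofNat Nat.Partrec.Code).comp (by fun_prop)).pair (by fun_prop)).pair
        (by fun_prop)))
  refine .ex (.ex (.ex (.and (.eq ?_ ?_) (.and (hmask.comp (f := fun x : (((ℕ × List Bool) × ℕ) ×
    Bool) × List Bool => (x.1.1.1.1.unpair.1, x.1.1.1.2, x.2)) ?_) (hev.comp
      (f := fun x : (((ℕ × List Bool) × ℕ) × Bool) × List Bool =>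
        (x.1.1.1.1.unpair.2, (x.1.1.2, !x.1.2), x.2)) ?_))))) <;> fun_prop

theorem exists_independent_family :
    ∃ ξ : ArithForm, ξ.ImpFree ∧ ξ.FreeBelow 2 ∧ Independent ξ.family := by
  classical
  obtain ⟨G, hG, hgen⟩ := exists_generic (D := fun k => Mismatch k.unpair.1
    (Denumerable.ofNat Nat.Partrec.Code k.unpair.2)) arithDef_mismatch
  obtain ⟨ξ, h₁, h₂, h₃⟩ := ArithDef.exists_form₂ (R := fun _ (x : ℕ × ℕ) => Nat.pair x.2 x.1 ∈ G)
    (hG.comp (f := fun x : ℕ × ℕ => Nat.pair x.2 x.1) (by fun_prop))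
  refine ⟨ξ, h₁, h₂, fun n hn => ?_⟩
  have hx : ∀ m i, i ∈ ξ.family m ↔ Nat.pair m i ∈ G := fun m i => h₃ _ _
  set O := joinWithout ξ.family n
  have hO : ∀ k, k ∈ O ↔ k.unpair.1 ≠ n ∧ k ∈ G := by
    intro k
    refine and_congr_right fun _ => ?_
    rw [hx, Nat.pair_unpair]
  rw [TuringReducible, RecursiveIn.iff_nat] at hn
  obtain ⟨R, hR₁, hR₂, hR₃⟩ := (OracleRE.of_recursiveIn hn).comp
    (f := fun x : ℕ × Bool => (x.1, encode x.2)) (by fun_prop)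
  have hR₃ : ∀ i b, (b = decide (Nat.pair n i ∈ G)) ↔ ∃ u, R (i, b) (seg O u) := by
    intro i b
    rw [← hR₃ (i, b)]
    by_cases h : Nat.pair n i ∈ G <;> cases b <;> simp [charFun, hx, h]
  obtain ⟨c, hc⟩ := Nat.Partrec.Code.exists_code.1 (PrimrecPred.computablePred hR₁).to_re
  have hc : ∀ i b ρ, (∃ y, y ∈ c.eval (encode ((i, b), ρ))) ↔ R (i, b) ρ := by
    intro i b ρ
    rw [hc]
    simp
  have hlarge : ∀ u, u ≤ Nat.pair n u := Nat.right_le_pair n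
  obtain ⟨u, hu | hu⟩ := hgen (Nat.pair n (encode c))
  · simp only [Nat.unpair_pair, Denumerable.ofNat_encode] at hu
    obtain ⟨i, b, ρ, hi, hρ, hy⟩ := hu
    have hρ : seg O ρ.length = ρ := by
      refine seg_eq_of_getElem? fun k b hb => ?_
      rw [hO]
      rcases hρ k b hb with ⟨h, rfl⟩ | ⟨h, hτ⟩
      · simp [h]
      · rw [getElem?_seg] at hτ
        split_ifs at hτ
        have hτ : decide (k ∈ G) = b := by simpa using hτ
        simp [h, ← hτ]
    rw [hc, ← hρ] at hy
    have := (hR₃ i (!b)).2 ⟨_, hy⟩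
    rw [getElem?_seg] at hi
    split_ifs at hi
    simp_all
  · simp only [Nat.unpair_pair, Denumerable.ofNat_encode] at hu
    set b := decide (Nat.pair n u ∈ G)
    obtain ⟨v, hv⟩ := (hR₃ u b).1 rfl
    let w := max v (Nat.pair n u + 1)
    refine hu ((seg G w).set (Nat.pair n u) (!b)) ?_ ⟨u, !b, seg O v, ?_, ?_, ?_⟩
    · rw [List.prefix_iff_getElem?]
      intro k hk
      rw [length_seg] at hk
      have := hlarge u
      rw [List.getElem?_set_ne (by omega), getElem?_seg, if_pos (by omega)]
      simp [seg]
    · have : Nat.pair n u < w := by omega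
      simp [this]
    · intro k b' hk
      rw [getElem?_seg] at hk
      split_ifs at hk with hkv
      have hk : decide (k ∈ O) = b' := by simpa using hk
      by_cases hkn : k.unpair.1 = n
      · exact .inl ⟨hkn, by simp [← hk, hO, hkn]⟩
      · refine .inr ⟨hkn, ?_⟩
        have hne : Nat.pair n u ≠ k := by rintro rfl; simp at hkn
        rw [List.getElem?_set_ne hne, getElem?_seg, if_pos (by omega), ← hk]
        simp [hO, hkn]
    · rw [Bool.not_not, hc]
      exact hv

/-! ### Normal form of `Σ¹₁` relations -/

@[fun_prop] theorem Computable.fun_mul {α : Type*} [Primcodable α] {f g : α → ℕ}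
    (hf : Computable f) (hg : Computable g) : Computable fun a => f a * g a :=
  Primrec.nat_mul.to_comp.comp hf hg

@[fun_prop] theorem Computable.fun_getD {α β : Type*} [Primcodable α] [Primcodable β]
    {f : α → List β} {g : α → ℕ} (b : β) (hf : Computable f) (hg : Computable g) :
    Computable fun a => (f a).getD (g a) b :=
  (Primrec.list_getD b).to_comp.comp hf hg

@[fun_prop] theorem Computable.fun_map_unpair_fst {α : Type*} [Primcodable α]
    {f : α → List ℕ} (hf : Computable f) :
    Computable fun a => (f a).map fun v => v.unpair.1 :=
  (Primrec.list_map Primrec.id ((Primrec.fst.comp (Primrec.unpair.comp .snd)).to₂)).to_comp.comp hf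

@[fun_prop] theorem Computable.fun_map_unpair_snd {α : Type*} [Primcodable α]
    {f : α → List ℕ} (hf : Computable f) :
    Computable fun a => (f a).map fun v => v.unpair.2 :=
  (Primrec.list_map Primrec.id ((Primrec.snd.comp (Primrec.unpair.comp .snd)).to₂)).to_comp.comp hf

/-- The relation `Q` holds of `X` and `a` iff there is an infinite sequence `g` such that a fixed
recursively enumerable relation holds of no initial segments of `X` and `g`. -/
def SigmaForm {α : Type*} [Primcodable α] (Q : Set ℕ → α → Prop) : Prop :=
  ∃ N : α × List Bool × List ℕ → Prop, OracleRE ∅ N ∧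
    ∀ X a, Q X a ↔ ∃ g : ℕ → ℕ, ∀ k, ¬ N (a, seg X k, (List.range k).map g)

namespace SigmaForm

variable {α β : Type*} [Primcodable α] [Primcodable β] {Q Q' : Set ℕ → α → Prop}

theorem of_iff (h : SigmaForm Q) (H : ∀ X a, Q X a ↔ Q' X a) : SigmaForm Q' :=
  let ⟨N, h₁, h₂⟩ := h
  ⟨N, h₁, fun X a => (H X a).symm.trans (h₂ X a)⟩

theorem of_re_compl {q : α → Prop} (h : OracleRE ∅ fun a => ¬ q a) : SigmaForm fun _ a => q a :=
  ⟨fun x => ¬ q x.1, h.comp .fst, fun X a => by simp⟩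

open Classical in
theorem decide_mem {f : α → ℕ} (hf : Computable f) (b : Bool) :
    SigmaForm fun X a => decide (f a ∈ X) = b := by
  refine ⟨fun x => x.2.1[f x.1]? = some (!b), .eq (by fun_prop) (by fun_prop), fun X a => ?_⟩
  simp only [getElem?_seg]
  constructor
  · rintro rfl
    refine ⟨fun _ => 0, fun k => ?_⟩
    split_ifs <;> simp
  · rintro ⟨_, h⟩
    have := h (f a + 1)
    rw [if_pos (Nat.lt_succ_self _), Option.some.injEq] at this
    cases b <;> simp_all

theorem comp {Q : Set ℕ → β → Prop} (h : SigmaForm Q) {f : α → β} (hf : Computable f) :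
    SigmaForm fun X a => Q X (f a) := by
  obtain ⟨N, h₁, h₂⟩ := h
  exact ⟨fun x => N (f x.1, x.2), h₁.comp (f := fun x : α × List Bool × List ℕ => (f x.1, x.2))
    (by fun_prop), fun X a => h₂ X (f a)⟩

theorem and (h : SigmaForm Q) (h' : SigmaForm Q') : SigmaForm fun X a => Q X a ∧ Q' X a := by
  obtain ⟨N, h₁, h₂⟩ := h
  obtain ⟨N', h₁', h₂'⟩ := h'
  refine ⟨fun x => N (x.1, x.2.1, x.2.2.map fun v => v.unpair.1) ∨
    N' (x.1, x.2.1, x.2.2.map fun v => v.unpair.2), .or (h₁.comp (by fun_prop))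
      (h₁'.comp (by fun_prop)), fun X a => ?_⟩
  simp only [h₂, h₂', List.map_map, Function.comp_def, not_or, forall_and]
  constructor
  · rintro ⟨⟨g, hg⟩, g', hg'⟩
    exact ⟨fun k => Nat.pair (g k) (g' k), by simpa using hg, by simpa using hg'⟩
  · rintro ⟨g, hg, hg'⟩
    exact ⟨⟨_, hg⟩, _, hg'⟩

theorem ex {Q : Set ℕ → α → ℕ → Prop} (h : SigmaForm fun X (x : α × ℕ) => Q X x.1 x.2) :
    SigmaForm fun X a => ∃ m, Q X a m := by
  obtain ⟨N, h₁, h₂⟩ := h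
  refine ⟨fun x => ∃ (m : ℕ) (γ : List ℕ), x.2.2 = m :: γ ∧
    N ((x.1, m), x.2.1.take γ.length, γ), .ex (.ex (.and (.eq (by fun_prop) (by fun_prop))
      (h₁.comp (f := fun y : ((α × List Bool × List ℕ) × ℕ) × List ℕ =>
        ((y.1.1.1, y.1.2), y.1.1.2.1.take y.2.length, y.2)) (by fun_prop)))), fun X a => ?_⟩
  have hcons : ∀ (g : ℕ → ℕ) k, (List.range (k + 1)).map g =
      g 0 :: (List.range k).map fun i => g (i + 1) := fun g k => by
    simp [List.range_succ_eq_map, Function.comp_def]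
  simp only [fun m => h₂ X (a, m)]
  constructor
  · rintro ⟨m, g, hg⟩
    refine ⟨push m g, ?_⟩
    rintro (_ | k) ⟨m', γ, hγ, hN⟩
    · simp at hγ
    · rw [hcons, List.cons.injEq] at hγ
      obtain ⟨rfl, rfl⟩ := hγ
      refine hg k ?_
      simpa [take_seg, push] using hN
  · rintro ⟨g, hg⟩
    refine ⟨g 0, fun i => g (i + 1), fun k hN => hg (k + 1) ⟨g 0, _, hcons g k, ?_⟩⟩
    simpa [take_seg] using hN

theorem or (h : SigmaForm Q) (h' : SigmaForm Q') : SigmaForm fun X a => Q X a ∨ Q' X a := by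
  obtain ⟨N, h₁, h₂⟩ := h
  obtain ⟨N', h₁', h₂'⟩ := h'
  refine of_iff (Q := fun X a => ∃ m : ℕ, (m = 0 → Q X a) ∧ (¬ m = 0 → Q' X a))
    (.ex ⟨fun x => (x.1.2 = 0 ∧ N (x.1.1, x.2)) ∨ (0 < x.1.2 ∧ N' (x.1.1, x.2)),
      .or (.and (.eq (by fun_prop) (by fun_prop)) (h₁.comp (by fun_prop)))
        (.and (.lt (by fun_prop) (by fun_prop)) (h₁'.comp (by fun_prop))), ?_⟩) fun X a => ?_
  · rintro X ⟨a, m⟩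
    simp only [h₂, h₂']
    rcases Nat.eq_zero_or_pos m with rfl | hm
    · simp
    · simp [hm, hm.ne']
  · constructor
    · rintro ⟨m, hm, hm'⟩
      by_cases h : m = 0
      exacts [.inl (hm h), .inr (hm' h)]
    · rintro (h | h)
      exacts [⟨0, by simpa using h⟩, ⟨1, by simpa using h⟩]

theorem all {Q : Set ℕ → α → ℕ → Prop} (h : SigmaForm fun X (x : α × ℕ) => Q X x.1 x.2) :
    SigmaForm fun X a => ∀ m, Q X a m := by
  obtain ⟨N, h₁, h₂⟩ := h
  refine ⟨fun x => ∃ (m : ℕ) (γ : List ℕ), γ.length < x.2.1.length + 1 ∧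
    (∀ k < γ.length, γ[k]? = x.2.2[Nat.pair m k]?) ∧ N ((x.1, m), x.2.1.take γ.length, γ),
    .ex (.ex (.and (.lt (by fun_prop) (by fun_prop)) (.and (.forall_lt
      (p := fun (y : ((α × List Bool × List ℕ) × ℕ) × List ℕ) k =>
        y.2[k]? = y.1.1.2.2[Nat.pair y.1.2 k]?) (.eq (by fun_prop) (by fun_prop)) (by fun_prop))
      (h₁.comp (f := fun y : ((α × List Bool × List ℕ) × ℕ) × List ℕ =>
        ((y.1.1.1, y.1.2), y.1.1.2.1.take y.2.length, y.2)) (by fun_prop))))), fun X a => ?_⟩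
  simp only [fun m => h₂ X (a, m)]
  constructor
  · intro h
    choose g hg using h
    refine ⟨fun n => g n.unpair.1 n.unpair.2, ?_⟩
    rintro K ⟨m, γ, hlen, hγ, hN⟩
    have : γ = (List.range γ.length).map (g m) := by
      refine List.ext_getElem? fun k => ?_
      by_cases hk : k < γ.length
      · have := hγ k hk
        rw [List.getElem?_eq_getElem hk] at this ⊢
        have hK : Nat.pair m k < K := by
          have := (List.getElem?_eq_some_iff.1 this.symm).1
          simpa using this
        simp [hK] at this
        simp [hk, this]
      · simp [hk]
    refine hg m γ.length ?_
    simp only [length_seg] at hlen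
    rw [take_seg, min_eq_left (by omega)] at hN
    rwa [← this]
  · rintro ⟨g, hg⟩ m
    refine ⟨fun i => g (Nat.pair m i), fun k hN => hg (Nat.pair m k) ⟨m,
      (List.range k).map fun i => g (Nat.pair m i), ?_, ?_, ?_⟩⟩
    · simpa [Nat.lt_succ_iff] using Nat.right_le_pair m k
    · intro i hi
      have hi : i < k := by simpa using hi
      have := Nat.pair_lt_pair_right m hi
      simp [hi, this]
    · simpa [take_seg, Nat.right_le_pair m k] using hN

end SigmaForm

theorem Term.computable_eval (t : Term) : Computable fun e : List ℕ => t.eval fun k => e.getD k 0 := by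
  induction t with
  | var k => simp only [eval]; fun_prop
  | zero => exact .const _
  | one => exact .const _
  | add s t hs ht => simp only [eval]; fun_prop
  | mul s t hs ht => simp only [eval]; fun_prop

theorem push_getD (n : ℕ) (e : List ℕ) : push n (fun k => e.getD k 0) = fun k => (n :: e).getD k 0 := by
  funext k
  cases k <;> rfl

theorem Form.sigmaForm_holds (φ : Form Unit) :
    (SigmaForm fun X (e : List ℕ) => φ.Holds (fun _ => X) fun k => e.getD k 0) ∧
    SigmaForm fun X (e : List ℕ) => ¬ φ.Holds (fun _ => X) fun k => e.getD k 0 := by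
  classical
  induction φ with
  | eq s t =>
    exact ⟨.of_re_compl (.ne s.computable_eval t.computable_eval),
      .of_re_compl ((OracleRE.eq s.computable_eval t.computable_eval).of_iff fun _ => not_not.symm)⟩
  | lt s t =>
    have hs := s.computable_eval
    refine ⟨.of_re_compl ((OracleRE.lt t.computable_eval (g := fun e => s.eval (fun k => e.getD k 0) + 1)
      (by fun_prop)).of_iff fun _ => ?_),
      .of_re_compl ((OracleRE.lt s.computable_eval t.computable_eval).of_iff fun _ => not_not.symm)⟩
    exact Nat.lt_succ_iff.trans not_lt.symm
  | pred p t =>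
    exact ⟨(SigmaForm.decide_mem t.computable_eval true).of_iff fun _ _ => by simp [Holds],
      (SigmaForm.decide_mem t.computable_eval false).of_iff fun _ _ => by simp [Holds]⟩
  | neg A hA => exact ⟨hA.2, hA.1.of_iff fun _ _ => by simp [Holds]⟩
  | and A B hA hB =>
    exact ⟨hA.1.and hB.1, (hA.2.or hB.2).of_iff fun _ _ => by simp only [Holds]; tauto⟩
  | or A B hA hB =>
    exact ⟨hA.1.or hB.1, (hA.2.and hB.2).of_iff fun _ _ => by simp only [Holds]; tauto⟩
  | imp A B hA hB =>
    exact ⟨(hA.2.or hB.1).of_iff fun _ _ => by simp only [Holds]; tauto,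
      (hA.1.and hB.2).of_iff fun _ _ => by simp only [Holds]; tauto⟩
  | ex A hA =>
    simp only [Holds, not_exists, push_getD]
    exact ⟨.ex (hA.1.comp (f := fun x : List ℕ × ℕ => x.2 :: x.1) (by fun_prop)),
      .all (hA.2.comp (f := fun x : List ℕ × ℕ => x.2 :: x.1) (by fun_prop))⟩
  | all A hA =>
    simp only [Holds, not_forall, push_getD]
    exact ⟨.all (hA.1.comp (f := fun x : List ℕ × ℕ => x.2 :: x.1) (by fun_prop)),
      .ex (hA.2.comp (f := fun x : List ℕ × ℕ => x.2 :: x.1) (by fun_prop))⟩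

/-! ### Reduction of `Π¹₁` sets to well-foundedness of recursive trees -/

theorem OracleRE.exists_bound {α : Type*} [Primcodable α] {p : α → Prop} (h : OracleRE ∅ p) :
    ∃ S : α × ℕ → Prop, ComputablePred S ∧ ∀ a, p a ↔ ∃ u, S (a, u) := by
  obtain ⟨R, h₁, -, h₃⟩ := h
  have hseg : Primrec (seg ∅) :=
    (Primrec.list_map Primrec.list_range ((Primrec.const false).to₂)).of_eq fun u => by
      simp [seg]
  exact ⟨fun x => R x.1 (seg ∅ x.2), (PrimrecRel.comp h₁ Primrec.fst
    (hseg.comp Primrec.snd)).computablePred, h₃⟩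

theorem exists_code_decides {T : ℕ → Set (List ℕ)}
    (hT : ComputablePred fun x : ℕ × List ℕ => x.2 ∈ T x.1) :
    ∃ c : ℕ → Nat.Partrec.Code, Computable c ∧ ∀ n, Decides (c n) (T n) := by
  classical
  obtain ⟨_, hT⟩ := hT
  have hf : Computable fun x : ℕ × List ℕ => if x.2 ∈ T x.1 then 1 else 0 :=
    (Computable.cond hT (.const 1) (.const 0)).of_eq fun x => by
      by_cases h : x.2 ∈ T x.1 <;> simp [h]
  obtain ⟨c, hc⟩ := Nat.Partrec.Code.exists_code.1 hf
  refine ⟨c.curry, Nat.Partrec.Code.primrec₂_curry.to_comp.comp (.const c) .id, fun n s => ?_⟩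
  have : (c.curry n).eval (encode s) = Part.some (if s ∈ T n then 1 else 0) := by
    rw [Nat.Partrec.Code.eval_curry]
    refine (congrFun hc (encode (n, s))).trans ?_
    simp
  rw [this]
  constructor <;> intro h <;> simp [h]

/-- The first `j` entries of `s` taken as pairs of a bit and a number, with the parameter `n`. -/
def treeNode (n : ℕ) (s : List ℕ) (j : ℕ) : List ℕ × List Bool × List ℕ :=
  ([n], (s.take j).map (fun v => decide (v.unpair.1 = 1)), (s.take j).map fun v => v.unpair.2)

theorem computable_treeNode :
    Computable fun y : (ℕ × List ℕ) × ℕ => treeNode y.1.1 y.1.2 y.2 := by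
  have hbits : Computable fun s : List ℕ => s.map fun v => decide (v.unpair.1 = 1) :=
    (Primrec.list_map Primrec.id (((Primrec.eq (α := ℕ)).decide.comp (Primrec.fst.comp
      (Primrec.unpair.comp .snd)) (Primrec.const 1)).to₂)).to_comp
  have htake : Computable fun y : (ℕ × List ℕ) × ℕ => y.1.2.take y.2 := by fun_prop
  have hsnd : Computable fun y : (ℕ × List ℕ) × ℕ => (y.1.2.take y.2).map fun v => v.unpair.2 :=
    .fun_map_unpair_snd htake
  have hn : Computable fun y : (ℕ × List ℕ) × ℕ => [y.1.1] := by fun_prop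
  exact hn.pair ((hbits.comp htake).pair hsnd)

/-- The tree of the sequences in whose initial segments `B` finds no violation. -/
def boundTree (B : (List ℕ × List Bool × List ℕ) × ℕ → Prop) (n : ℕ) : Set (List ℕ) :=
  {s | ∀ j < s.length + 1, ∀ u < s.length + 1, ¬ B (treeNode n s j, u)}

theorem computablePred_boundTree {B : (List ℕ × List Bool × List ℕ) × ℕ → Prop}
    (hB : ComputablePred B) : ComputablePred fun x : ℕ × List ℕ => x.2 ∈ boundTree B x.1 := by
  have hlen : Computable fun x : ℕ × List ℕ => x.2.length + 1 := by fun_prop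
  have hnode : Computable fun z : ((ℕ × List ℕ) × ℕ) × ℕ => (treeNode z.1.1.1 z.1.1.2 z.1.2, z.2) :=
    (computable_treeNode.comp .fst).pair .snd
  refine ComputablePred.computable_iff_re_compl_re'.2 ⟨OracleRE.re ?_, OracleRE.re ?_⟩
  · exact .forall_lt (p := fun (x : ℕ × List ℕ) j =>
      ∀ u < x.2.length + 1, ¬ B (treeNode x.1 x.2 j, u))
      (.forall_lt (p := fun (y : (ℕ × List ℕ) × ℕ) u => ¬ B (treeNode y.1.1 y.1.2 y.2, u))
        ((OracleRE.of_computable hB.not).comp hnode) (hlen.comp .fst)) hlen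
  · refine OracleRE.of_iff (p := fun x : ℕ × List ℕ => ∃ j u : ℕ, j < x.2.length + 1 ∧
      u < x.2.length + 1 ∧ B (treeNode x.1 x.2 j, u)) (.ex (.ex (.and
        (.lt (.comp .snd .fst) (hlen.comp (.comp .fst .fst))) (.and
          (.lt .snd (hlen.comp (.comp .fst .fst)))
          ((OracleRE.of_computable hB).comp hnode))))) fun x => ?_
    simp only [boundTree, Set.mem_ofPred_eq]
    push Not
    constructor
    · rintro ⟨j, u, hj, hu, h⟩
      exact ⟨j, hj, u, hu, h⟩
    · rintro ⟨j, hj, u, hu, h⟩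
      exact ⟨j, u, hj, hu, h⟩

theorem IsPi11.exists_trees {S : Set ℕ} (hS : IsPi11 S) :
    ∃ (c : ℕ → Nat.Partrec.Code) (T : ℕ → Set (List ℕ)), Computable c ∧
      ∀ n, IsSeqTree (T n) ∧ Decides (c n) (T n) ∧ (n ∈ S ↔ WellFoundedTree (T n)) := by
  obtain ⟨φ, -, hφ⟩ := hS
  obtain ⟨N, h₁, h₂⟩ := φ.sigmaForm_holds.2
  obtain ⟨B, hB, hN⟩ := h₁.exists_bound
  obtain ⟨c, hc, hdec⟩ := exists_code_decides (computablePred_boundTree hB)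
  refine ⟨c, boundTree B, hc, fun n => ⟨?_, hdec n, ?_⟩⟩
  · rintro s t ⟨r, rfl⟩ ht j hj u hu
    have := ht j (by simp; omega) u (by simp; omega)
    simpa only [treeNode, List.take_append_of_le_length (show j ≤ s.length by omega)] using this
  · have hpath : ∀ p : ℕ → ℕ, (∀ k, (List.range k).map p ∈ boundTree B n) ↔ ∀ k, ¬ N ([n],
        seg {i | (p i).unpair.1 = 1} k, (List.range k).map fun i => (p i).unpair.2) := by
      intro p
      have hnode : ∀ j k, j ≤ k → treeNode n ((List.range k).map p) j = ([n],
          seg {i | (p i).unpair.1 = 1} j, (List.range j).map fun i => (p i).unpair.2) := by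
        intro j k hj
        simp [treeNode, ← List.map_take, List.take_range, hj, seg, Function.comp_def]
      simp only [hN, not_exists]
      constructor
      · intro h k u hB
        refine h (max k u) k (by simp) u (by simp) ?_
        rwa [hnode _ _ (le_max_left _ _)]
      · intro h k j hj u hu
        rw [hnode j k (by simp at hj; omega)]
        exact h j u
    rw [hφ, WellFoundedTree, not_exists]
    simp only [hpath]
    have hpush : ∀ X : Set ℕ, φ.Holds (fun _ => X) (push n fun _ => 0) ↔
        ¬ ∃ g : ℕ → ℕ, ∀ k, ¬ N ([n], seg X k, (List.range k).map g) := by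
      intro X
      rw [← h₂ X [n], not_not]
      have : (push n fun _ => 0) = fun k => [n].getD k 0 := push_getD n []
      rw [this]
    simp only [hpush]
    constructor
    · exact fun h p hp => h _ ⟨_, hp⟩
    · rintro h X ⟨g, hg⟩
      classical
      refine h (fun i => Nat.pair (if i ∈ X then 1 else 0) (g i)) ?_
      simpa using hg

theorem pi11Hard_constructiveTruth :
    Pi11Hard constructiveTruth ∧ Pi11Hard simpleConstructiveTruth := by
  obtain ⟨ξ, hξ₁, hξ₂, hξ₃⟩ := exists_independent_family
  obtain ⟨len, hlen₁, hlen⟩ := Form.exists_expressesLength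
  obtain ⟨inc, hinc₁, hinc⟩ := Form.exists_expressesIncompatible
  obtain ⟨φ, hφ, htree⟩ := Form.exists_treeForm
  have key : ∀ S, IsPi11 S → ∃ A : ℕ → ArithForm, ∃ B : ArithForm,
      (∀ n, (A n).ImpFree) ∧ B.ImpFree ∧ (∀ n, ((A n).imp B).IsSentence) ∧
      (Computable fun n => ((A n).imp B).code) ∧
      ∀ n, n ∈ S ↔ ((A n).imp B).ConstructivelyTrue := by
    intro S hS
    obtain ⟨c, T, hc, hT⟩ := hS.exists_trees
    refine ⟨fun n => Form.pathAntecedent ξ len (Form.treeForm φ (encode (c n))),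
      Form.pathConsequent ξ inc,
      fun n => ?_, ?_, fun n => ?_, ?_, fun n => ?_⟩
    · exact ⟨hlen₁, ⟨trivial, hφ.rename _⟩, Form.impFree_deciding hξ₁ 0⟩
    · exact ⟨hinc₁, Form.impFree_deciding hξ₁ 1, Form.impFree_deciding hξ₁ 0⟩
    · exact Form.pathSentence_isSentence hlen.1 (htree _ _ (hT n).2.1).1 hinc.1
    · exact (Form.computable_code_pathSentence ξ len inc φ).comp hc
    · rw [(hT n).2.2]
      refine ⟨fun h => Form.constructivelyTrue_pathSentence hξ₂ hlen hinc (htree _ _ (hT n).2.1) h,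
        fun h => ?_⟩
      by_contra hwf
      exact Form.not_independent_of_path hξ₂ hlen hinc (htree _ _ (hT n).2.1) hwf h hξ₃
  constructor <;> intro S hS <;> obtain ⟨A, B, hA, hB, hAB, hcomp, hiff⟩ := key S hS <;>
    refine ⟨_, hcomp, fun n => (hiff n).trans ⟨fun h => ?_, ?_⟩⟩
  · exact ⟨_, hAB n, h, rfl⟩
  · rintro ⟨A', -, h, h'⟩
    exact Form.code_injective h' ▸ h
  · exact ⟨A n, B, hA n, hB, hAB n, h, rfl⟩
  · rintro ⟨A', B', -, -, -, h, hcode⟩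
    exact Form.code_injective hcode ▸ h

/-! ### Substitution of definable sets -/

theorem push_tl (e : ℕ → ℕ) : push (e 0) (tl e) = e := by
  funext k
  cases k <;> rfl

theorem EnvDef.holds_subst {P P' : Type} {D : P' → (P → Set ℕ) → ℕ → Prop}
    (hD : ∀ p, EnvDef fun I e => D p I (e 0)) (φ : Form P') (v : ℕ) :
    EnvDef fun I e => φ.Holds (fun p => {m | D p I (Nat.pair (e v) m)}) e := by
  induction φ generalizing v with
  | eq s t => exact .eq_term s t
  | lt s t => exact .lt_term s t
  | pred p t => exact (hD p).subst₁ (.natPair (.var v) (.term t))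
  | neg A hA => exact (hA v).not
  | and A B hA hB => exact (hA v).and (hB v)
  | or A B hA hB => exact (hA v).or (hB v)
  | imp A B hA hB => exact (hA v).imp (hB v)
  | ex A hA =>
    refine .ex (R := fun I e n => A.Holds (fun p => {m | D p I (Nat.pair (e v) m)}) (push n e))
      ((hA (v + 1)).of_iff fun I e => ?_)
    rw [push_tl]
    rfl
  | all A hA =>
    refine .all (R := fun I e n => A.Holds (fun p => {m | D p I (Nat.pair (e v) m)}) (push n e))
      ((hA (v + 1)).of_iff fun I e => ?_)
    rw [push_tl]
    rfl

theorem ArithDef.subst {P P' : Type} {α : Type*} [Primcodable α] {R : (P' → Set ℕ) → α → Prop}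
    (hR : ArithDef R) {D : P' → (P → Set ℕ) → α × ℕ → Prop} (hD : ∀ p, ArithDef (D p)) :
    ArithDef fun I a => R (fun p => {m | D p I (a, m)}) a := by
  obtain ⟨Q, ⟨φ, -, h₁⟩, h₂⟩ := hR
  choose E hE₁ hE₂ using hD
  refine ⟨fun I n => Q (fun p => {m | E p I (Nat.pair n m)}) n,
    (EnvDef.holds_subst hE₁ φ 0).of_iff fun I e => h₁ _ e, fun I a => ?_⟩
  refine (h₂ _ a).trans ?_
  have : ∀ p, {m | E p I (Nat.pair (encode a) m)} = {m | D p I (a, m)} :=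
    fun p => Set.ext fun m => hE₂ p I (a, m)
  simp only [this]

/-- A number quantifier in front of universal set quantifiers does not lead out of `Π¹₁`. -/
theorem isPi11_of_exists_forall {β : Type*} [Primcodable β] {S : Set ℕ}
    {R : (ℕ → Set ℕ) → ℕ × β → Prop} (hR : ArithDef R)
    (hS : ∀ n, n ∈ S ↔ ∃ b, ∀ I, R I (n, b)) : IsPi11 S := by
  have h : ArithDef (P := Unit) fun I (n : ℕ) => ∃ b : β,
      R (fun p => {m | Nat.pair (encode b) (Nat.pair p m) ∈ I ()}) (n, b) := by
    refine .ex ((hR.subst (P := Unit) (D := fun p I x =>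
      Nat.pair (encode x.1.2) (Nat.pair p x.2) ∈ I ()) fun p => .mem () ?_).of_iff fun I x => Iff.rfl)
    fun_prop
  obtain ⟨φ, -, h₁, h₂⟩ := h.exists_form
  refine ⟨φ, h₁, fun n => ?_⟩
  have h₃ : ∀ X : Set ℕ, φ.Holds (fun _ => X) (push n fun _ => 0) ↔ _ := fun X => h₂ _ n _ rfl
  simp only [hS, h₃]
  constructor
  · rintro ⟨b, hb⟩ X
    exact ⟨b, hb _⟩
  · intro h
    by_contra! hb
    choose I hI using hb
    obtain ⟨b, hb⟩ := h {k | ∃ b : β, encode b = k.unpair.1 ∧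
      k.unpair.2.unpair.2 ∈ I b k.unpair.2.unpair.1}
    refine hI b ?_
    convert hb using 1
    funext p
    ext m
    simp

/-! ### Decoding of formulas -/

theorem unpair_fst_lt_of_pos {c : ℕ} (h : 0 < c.unpair.1) :
    c.unpair.2.unpair.1 < c ∧ c.unpair.2.unpair.2 < c ∧ c.unpair.2 < c := by
  have h₁ : c.unpair.2 < c := by
    conv_rhs => rw [← Nat.pair_unpair c]
    calc c.unpair.2 < Nat.pair 0 c.unpair.2 + c.unpair.1 := by
          have := Nat.right_le_pair 0 c.unpair.2
          omega
      _ ≤ _ := by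
          have : ∀ a b, Nat.pair 0 b + a ≤ Nat.pair a b := by
            intro a b
            unfold Nat.pair
            split_ifs <;> nlinarith
          exact this _ _
  exact ⟨(Nat.unpair_left_le _).trans_lt h₁, (Nat.unpair_right_le _).trans_lt h₁, h₁⟩

/-- The term with the given number; the value is arbitrary if there is none. -/
def Term.ofCode (c : ℕ) : Term :=
  if c.unpair.1 = 0 then .var c.unpair.2
  else if c.unpair.1 = 1 then .zero
  else if c.unpair.1 = 2 then .one
  else if _h : c.unpair.1 = 3 then .add (ofCode c.unpair.2.unpair.1) (ofCode c.unpair.2.unpair.2)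
  else if _h : c.unpair.1 = 4 then .mul (ofCode c.unpair.2.unpair.1) (ofCode c.unpair.2.unpair.2)
  else .zero
termination_by c
decreasing_by all_goals have := unpair_fst_lt_of_pos (c := c) (by omega); omega

/-- The formula with the given number; the value is arbitrary if there is none. -/
def Form.ofCode (c : ℕ) : ArithForm :=
  let x := c.unpair.2
  if c.unpair.1 = 0 then .eq (Term.ofCode x.unpair.1) (Term.ofCode x.unpair.2)
  else if c.unpair.1 = 1 then .lt (Term.ofCode x.unpair.1) (Term.ofCode x.unpair.2)
  else if _h : c.unpair.1 = 2 then .neg (ofCode c.unpair.2)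
  else if _h : c.unpair.1 = 3 then .and (ofCode c.unpair.2.unpair.1) (ofCode c.unpair.2.unpair.2)
  else if _h : c.unpair.1 = 4 then .or (ofCode c.unpair.2.unpair.1) (ofCode c.unpair.2.unpair.2)
  else if _h : c.unpair.1 = 5 then .imp (ofCode c.unpair.2.unpair.1) (ofCode c.unpair.2.unpair.2)
  else if _h : c.unpair.1 = 6 then .ex (ofCode c.unpair.2)
  else if _h : c.unpair.1 = 7 then .all (ofCode c.unpair.2)
  else .eq .zero .zero
termination_by c
decreasing_by all_goals have := unpair_fst_lt_of_pos (c := c) (by omega); omega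

namespace Term

variable (s t : ℕ)

theorem ofCode_var : ofCode (Nat.pair 0 s) = .var s := by rw [ofCode]; simp
theorem ofCode_zero : ofCode (Nat.pair 1 0) = .zero := by rw [ofCode]; simp
theorem ofCode_one : ofCode (Nat.pair 2 0) = .one := by rw [ofCode]; simp
theorem ofCode_add : ofCode (Nat.pair 3 (Nat.pair s t)) = .add (ofCode s) (ofCode t) := by
  rw [ofCode]; simp
theorem ofCode_mul : ofCode (Nat.pair 4 (Nat.pair s t)) = .mul (ofCode s) (ofCode t) := by
  rw [ofCode]; simp

end Term

namespace Form

variable (a b : ℕ)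

theorem ofCode_eq : ofCode (Nat.pair 0 (Nat.pair a b)) = .eq (.ofCode a) (.ofCode b) := by
  rw [ofCode]; simp
theorem ofCode_lt : ofCode (Nat.pair 1 (Nat.pair a b)) = .lt (.ofCode a) (.ofCode b) := by
  rw [ofCode]; simp
theorem ofCode_neg : ofCode (Nat.pair 2 a) = .neg (ofCode a) := by rw [ofCode]; simp
theorem ofCode_and : ofCode (Nat.pair 3 (Nat.pair a b)) = .and (ofCode a) (ofCode b) := by
  rw [ofCode]; simp
theorem ofCode_or : ofCode (Nat.pair 4 (Nat.pair a b)) = .or (ofCode a) (ofCode b) := by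
  rw [ofCode]; simp
theorem ofCode_ex : ofCode (Nat.pair 6 a) = .ex (ofCode a) := by rw [ofCode]; simp
theorem ofCode_all : ofCode (Nat.pair 7 a) = .all (ofCode a) := by rw [ofCode]; simp

end Form

/-! ### Arithmetical clauses for syntax and satisfaction -/

/-- `Z` consists of the `(b, c)` such that `c` is the number of a term with variables below `b`. -/
def TermNumbers (Z : Set ℕ) : Prop := ∀ b c : ℕ, encode (b, c) ∈ Z ↔
  (∃ k : ℕ, k < b ∧ c = Nat.pair 0 k) ∨ c = Nat.pair 1 0 ∨ c = Nat.pair 2 0 ∨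
  ∃ s t : ℕ, encode (b, s) ∈ Z ∧ encode (b, t) ∈ Z ∧
    (c = Nat.pair 3 (Nat.pair s t) ∨ c = Nat.pair 4 (Nat.pair s t))

/-- `Z` consists of the `(b, c)` such that `c` is the number of a formula without `→` with free
variables below `b`. -/
def FormNumbers (Y Z : Set ℕ) : Prop := ∀ b c : ℕ, encode (b, c) ∈ Z ↔
  (∃ s t : ℕ, encode (b, s) ∈ Y ∧ encode (b, t) ∈ Y ∧
    (c = Nat.pair 0 (Nat.pair s t) ∨ c = Nat.pair 1 (Nat.pair s t))) ∨
  (∃ a : ℕ, encode (b, a) ∈ Z ∧ c = Nat.pair 2 a) ∨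
  (∃ s t : ℕ, encode (b, s) ∈ Z ∧ encode (b, t) ∈ Z ∧
    (c = Nat.pair 3 (Nat.pair s t) ∨ c = Nat.pair 4 (Nat.pair s t))) ∨
  ∃ a : ℕ, encode (b + 1, a) ∈ Z ∧ (c = Nat.pair 6 a ∨ c = Nat.pair 7 a)

/-- `Z` is the graph of the evaluation of terms. -/
def TermEval (Z : Set ℕ) : Prop := ∀ (e : List ℕ) (v : ℕ),
  (∀ k : ℕ, encode (Nat.pair 0 k, e, v) ∈ Z ↔ e.getD k 0 = v) ∧
  (encode (Nat.pair 1 0, e, v) ∈ Z ↔ 0 = v) ∧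
  (encode (Nat.pair 2 0, e, v) ∈ Z ↔ 1 = v) ∧
  (∀ s t : ℕ, encode (Nat.pair 3 (Nat.pair s t), e, v) ∈ Z ↔
    ∃ x y : ℕ, encode (s, e, x) ∈ Z ∧ encode (t, e, y) ∈ Z ∧ x + y = v) ∧
  (∀ s t : ℕ, encode (Nat.pair 4 (Nat.pair s t), e, v) ∈ Z ↔
    ∃ x y : ℕ, encode (s, e, x) ∈ Z ∧ encode (t, e, y) ∈ Z ∧ x * y = v)

/-- `Z` is the satisfaction relation of formulas without `→`. -/
def FormSat (T Z : Set ℕ) : Prop := ∀ e : List ℕ,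
  (∀ s t : ℕ, encode (Nat.pair 0 (Nat.pair s t), e) ∈ Z ↔
    ∃ x y : ℕ, encode (s, e, x) ∈ T ∧ encode (t, e, y) ∈ T ∧ x = y) ∧
  (∀ s t : ℕ, encode (Nat.pair 1 (Nat.pair s t), e) ∈ Z ↔
    ∃ x y : ℕ, encode (s, e, x) ∈ T ∧ encode (t, e, y) ∈ T ∧ x < y) ∧
  (∀ a : ℕ, encode (Nat.pair 2 a, e) ∈ Z ↔ ¬ encode (a, e) ∈ Z) ∧
  (∀ a b : ℕ, encode (Nat.pair 3 (Nat.pair a b), e) ∈ Z ↔ encode (a, e) ∈ Z ∧ encode (b, e) ∈ Z) ∧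
  (∀ a b : ℕ, encode (Nat.pair 4 (Nat.pair a b), e) ∈ Z ↔ encode (a, e) ∈ Z ∨ encode (b, e) ∈ Z) ∧
  (∀ a : ℕ, encode (Nat.pair 6 a, e) ∈ Z ↔ ∃ n : ℕ, encode (a, n :: e) ∈ Z) ∧
  (∀ a : ℕ, encode (Nat.pair 7 a, e) ∈ Z ↔ ∀ n : ℕ, encode (a, n :: e) ∈ Z)

theorem exists_termNumbers : ∃ Z, TermNumbers Z := by
  refine ⟨{k | ∃ t : Term, t.FreeBelow k.unpair.1 ∧ t.code = k.unpair.2}, fun b c => ?_⟩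
  simp only [Set.mem_ofPred_eq, encode_prod_val, encode_nat, Nat.unpair_pair]
  constructor
  · rintro ⟨t, h, rfl⟩
    cases t with
    | var k => exact .inl ⟨k, h, rfl⟩
    | zero => exact .inr (.inl rfl)
    | one => exact .inr (.inr (.inl rfl))
    | add s t => exact .inr (.inr (.inr ⟨_, _, ⟨s, h.1, rfl⟩, ⟨t, h.2, rfl⟩, .inl rfl⟩))
    | mul s t => exact .inr (.inr (.inr ⟨_, _, ⟨s, h.1, rfl⟩, ⟨t, h.2, rfl⟩, .inr rfl⟩))
  · rintro (⟨k, h, rfl⟩ | rfl | rfl | ⟨_, _, ⟨s, hs, rfl⟩, ⟨t, ht, rfl⟩, rfl | rfl⟩)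
    exacts [⟨.var k, h, rfl⟩, ⟨.zero, trivial, rfl⟩, ⟨.one, trivial, rfl⟩,
      ⟨.add s t, ⟨hs, ht⟩, rfl⟩, ⟨.mul s t, ⟨hs, ht⟩, rfl⟩]

theorem lt_pair_pair {j : ℕ} (hj : 0 < j) (s t : ℕ) :
    s < Nat.pair j (Nat.pair s t) ∧ t < Nat.pair j (Nat.pair s t) := by
  have := unpair_fst_lt_of_pos (c := Nat.pair j (Nat.pair s t)) (by simpa using hj)
  simp only [Nat.unpair_pair] at this
  exact ⟨this.1, this.2.1⟩

theorem lt_pair_right {j : ℕ} (hj : 0 < j) (s : ℕ) : s < Nat.pair j s := by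
  have := unpair_fst_lt_of_pos (c := Nat.pair j s) (by simpa using hj)
  simpa using this.2.2

theorem TermNumbers.mem_iff {Z : Set ℕ} (hZ : TermNumbers Z) (b c : ℕ) :
    encode (b, c) ∈ Z ↔ ∃ t : Term, t.FreeBelow b ∧ t.code = c := by
  constructor
  · induction c using Nat.strong_induction_on with
    | _ c ih =>
      intro h
      rcases (hZ b c).1 h with ⟨k, hk, rfl⟩ | rfl | rfl | ⟨s, t, hs, ht, rfl | rfl⟩
      · exact ⟨.var k, hk, rfl⟩
      · exact ⟨.zero, trivial, rfl⟩
      · exact ⟨.one, trivial, rfl⟩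
      · have hlt := lt_pair_pair (show 0 < 3 by simp) s t
        obtain ⟨s', hs', rfl⟩ := ih s hlt.1 hs
        obtain ⟨t', ht', rfl⟩ := ih t hlt.2 ht
        exact ⟨.add s' t', ⟨hs', ht'⟩, rfl⟩
      · have hlt := lt_pair_pair (show 0 < 4 by simp) s t
        obtain ⟨s', hs', rfl⟩ := ih s hlt.1 hs
        obtain ⟨t', ht', rfl⟩ := ih t hlt.2 ht
        exact ⟨.mul s' t', ⟨hs', ht'⟩, rfl⟩
  · rintro ⟨t, ht, rfl⟩
    induction t with
    | var k => exact (hZ _ _).2 (.inl ⟨k, ht, rfl⟩)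
    | zero => exact (hZ _ _).2 (.inr (.inl rfl))
    | one => exact (hZ _ _).2 (.inr (.inr (.inl rfl)))
    | add s t hs ht' => exact (hZ _ _).2 (.inr (.inr (.inr ⟨_, _, hs ht.1, ht' ht.2, .inl rfl⟩)))
    | mul s t hs ht' => exact (hZ _ _).2 (.inr (.inr (.inr ⟨_, _, hs ht.1, ht' ht.2, .inr rfl⟩)))

theorem exists_formNumbers {Y : Set ℕ} (hY : TermNumbers Y) : ∃ Z, FormNumbers Y Z := by
  refine ⟨{k | ∃ A : ArithForm, A.ImpFree ∧ A.FreeBelow k.unpair.1 ∧ A.code = k.unpair.2},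
    fun b c => ?_⟩
  simp only [hY.mem_iff]
  simp only [Set.mem_ofPred_eq, encode_prod_val, encode_nat, Nat.unpair_pair]
  constructor
  · rintro ⟨A, hi, h, rfl⟩
    cases A with
    | eq s t => exact .inl ⟨_, _, ⟨s, h.1, rfl⟩, ⟨t, h.2, rfl⟩, .inl rfl⟩
    | lt s t => exact .inl ⟨_, _, ⟨s, h.1, rfl⟩, ⟨t, h.2, rfl⟩, .inr rfl⟩
    | pred p => exact p.elim
    | neg A => exact .inr (.inl ⟨_, ⟨A, hi, h, rfl⟩, rfl⟩)
    | and A B =>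
      exact .inr (.inr (.inl ⟨_, _, ⟨A, hi.1, h.1, rfl⟩, ⟨B, hi.2, h.2, rfl⟩, .inl rfl⟩))
    | or A B =>
      exact .inr (.inr (.inl ⟨_, _, ⟨A, hi.1, h.1, rfl⟩, ⟨B, hi.2, h.2, rfl⟩, .inr rfl⟩))
    | imp A B => exact hi.elim
    | ex A => exact .inr (.inr (.inr ⟨_, ⟨A, hi, h, rfl⟩, .inl rfl⟩))
    | all A => exact .inr (.inr (.inr ⟨_, ⟨A, hi, h, rfl⟩, .inr rfl⟩))
  · rintro (⟨_, _, ⟨s, hs, rfl⟩, ⟨t, ht, rfl⟩, rfl | rfl⟩ | ⟨_, ⟨A, hi, h, rfl⟩, rfl⟩ |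
      ⟨_, _, ⟨A, hi, h, rfl⟩, ⟨B, hi', h', rfl⟩, rfl | rfl⟩ | ⟨_, ⟨A, hi, h, rfl⟩, rfl | rfl⟩)
    exacts [⟨.eq s t, trivial, ⟨hs, ht⟩, rfl⟩, ⟨.lt s t, trivial, ⟨hs, ht⟩, rfl⟩,
      ⟨.neg A, hi, h, rfl⟩, ⟨.and A B, ⟨hi, hi'⟩, ⟨h, h'⟩, rfl⟩, ⟨.or A B, ⟨hi, hi'⟩, ⟨h, h'⟩, rfl⟩,
      ⟨.ex A, hi, h, rfl⟩, ⟨.all A, hi, h, rfl⟩]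

theorem FormNumbers.mem_iff {Y Z : Set ℕ} (hZ : FormNumbers Y Z) (hY : TermNumbers Y) (b c : ℕ) :
    encode (b, c) ∈ Z ↔ ∃ A : ArithForm, A.ImpFree ∧ A.FreeBelow b ∧ A.code = c := by
  unfold FormNumbers at hZ
  simp only [hY.mem_iff] at hZ
  constructor
  · intro h
    induction c using Nat.strong_induction_on generalizing b with
    | _ c ih =>
      rcases (hZ b c).1 h with ⟨_, _, ⟨s, hs, rfl⟩, ⟨t, ht, rfl⟩, rfl | rfl⟩ | ⟨a, ha, rfl⟩ |
        ⟨s, t, hs, ht, rfl | rfl⟩ | ⟨a, ha, rfl | rfl⟩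
      · exact ⟨.eq s t, trivial, ⟨hs, ht⟩, rfl⟩
      · exact ⟨.lt s t, trivial, ⟨hs, ht⟩, rfl⟩
      · obtain ⟨A, hi, hA, rfl⟩ := ih a (lt_pair_right (by simp) a) b ha
        exact ⟨.neg A, hi, hA, rfl⟩
      · have hlt := lt_pair_pair (show 0 < 3 by simp) s t
        obtain ⟨A, hi, hA, rfl⟩ := ih s hlt.1 b hs
        obtain ⟨B, hi', hB, rfl⟩ := ih t hlt.2 b ht
        exact ⟨.and A B, ⟨hi, hi'⟩, ⟨hA, hB⟩, rfl⟩
      · have hlt := lt_pair_pair (show 0 < 4 by simp) s t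
        obtain ⟨A, hi, hA, rfl⟩ := ih s hlt.1 b hs
        obtain ⟨B, hi', hB, rfl⟩ := ih t hlt.2 b ht
        exact ⟨.or A B, ⟨hi, hi'⟩, ⟨hA, hB⟩, rfl⟩
      · obtain ⟨A, hi, hA, rfl⟩ := ih a (lt_pair_right (by simp) a) (b + 1) ha
        exact ⟨.ex A, hi, hA, rfl⟩
      · obtain ⟨A, hi, hA, rfl⟩ := ih a (lt_pair_right (by simp) a) (b + 1) ha
        exact ⟨.all A, hi, hA, rfl⟩
  · rintro ⟨A, hi, hA, rfl⟩
    induction A generalizing b with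
    | eq s t => exact (hZ _ _).2 (.inl ⟨_, _, ⟨s, hA.1, rfl⟩, ⟨t, hA.2, rfl⟩, .inl rfl⟩)
    | lt s t => exact (hZ _ _).2 (.inl ⟨_, _, ⟨s, hA.1, rfl⟩, ⟨t, hA.2, rfl⟩, .inr rfl⟩)
    | pred p => exact p.elim
    | neg A ih => exact (hZ _ _).2 (.inr (.inl ⟨_, ih b hi hA, rfl⟩))
    | and A B ihA ihB =>
      exact (hZ _ _).2 (.inr (.inr (.inl ⟨_, _, ihA b hi.1 hA.1, ihB b hi.2 hA.2, .inl rfl⟩)))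
    | or A B ihA ihB =>
      exact (hZ _ _).2 (.inr (.inr (.inl ⟨_, _, ihA b hi.1 hA.1, ihB b hi.2 hA.2, .inr rfl⟩)))
    | imp A B => exact hi.elim
    | ex A ih => exact (hZ _ _).2 (.inr (.inr (.inr ⟨_, ih (b + 1) hi hA, .inl rfl⟩)))
    | all A ih => exact (hZ _ _).2 (.inr (.inr (.inr ⟨_, ih (b + 1) hi hA, .inr rfl⟩)))

theorem mem_setOf_encode {α : Type*} [Encodable α] {p : α → Prop} {a : α} :
    encode a ∈ {k | ∃ a, encode a = k ∧ p a} ↔ p a :=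
  ⟨fun ⟨_, h, hp⟩ => encode_injective h ▸ hp, fun h => ⟨a, rfl, h⟩⟩

/-- The value of the term with number `c`. -/
def evalCode (e : List ℕ) (c : ℕ) : ℕ := (Term.ofCode c).eval fun k => e.getD k 0

theorem exists_termEval : ∃ T, TermEval T ∧
    ∀ c e v, encode (c, e, v) ∈ T ↔ evalCode e c = v := by
  refine ⟨{k | ∃ x : ℕ × List ℕ × ℕ, encode x = k ∧ evalCode x.2.1 x.1 = x.2.2}, fun e v => ?_,
    fun c e v => mem_setOf_encode⟩
  simp only [mem_setOf_encode, evalCode, Term.ofCode_var, Term.ofCode_zero, Term.ofCode_one,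
    Term.ofCode_add, Term.ofCode_mul, Term.eval]
  simp

theorem TermEval.mem_iff {T : Set ℕ} (hT : TermEval T) (t : Term) (e : List ℕ) (v : ℕ) :
    encode (t.code, e, v) ∈ T ↔ t.eval (fun k => e.getD k 0) = v := by
  induction t generalizing v with
  | var k => exact (hT e v).1 k
  | zero => exact (hT e v).2.1
  | one => exact (hT e v).2.2.1
  | add s t hs ht =>
    refine ((hT e v).2.2.2.1 _ _).trans ?_
    simp only [hs, ht]
    simp [Term.eval]
  | mul s t hs ht =>
    refine ((hT e v).2.2.2.2 _ _).trans ?_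
    simp only [hs, ht]
    simp [Term.eval]

theorem exists_formSat {T : Set ℕ} (hT : ∀ c e v, encode (c, e, v) ∈ T ↔ evalCode e c = v) :
    ∃ Z, FormSat T Z ∧ ∀ (c : ℕ) (e : List ℕ), encode (c, e) ∈ Z ↔ (Form.ofCode c).IsTrue fun k => e.getD k 0 := by
  refine ⟨{k | ∃ x : ℕ × List ℕ, encode x = k ∧ (Form.ofCode x.1).IsTrue fun k => x.2.getD k 0},
    fun e => ?_, fun c e => mem_setOf_encode⟩
  simp only [mem_setOf_encode, Form.ofCode_eq, Form.ofCode_lt, Form.ofCode_neg, Form.ofCode_and,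
    Form.ofCode_or, Form.ofCode_ex, Form.ofCode_all, Form.IsTrue, Form.Holds, push_getD, hT]
  simp [evalCode]

theorem FormSat.mem_iff {T Z : Set ℕ} (hZ : FormSat T Z) (hT : TermEval T) {A : ArithForm}
    (hA : A.ImpFree) (e : List ℕ) :
    encode (A.code, e) ∈ Z ↔ A.IsTrue fun k => e.getD k 0 := by
  induction A generalizing e with
  | eq s t =>
    refine ((hZ e).1 _ _).trans ?_
    simp only [hT.mem_iff]
    simp [Form.IsTrue, Form.Holds]
  | lt s t =>
    refine ((hZ e).2.1 _ _).trans ?_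
    simp only [hT.mem_iff]
    simp [Form.IsTrue, Form.Holds]
  | pred p => exact p.elim
  | neg A ih => exact ((hZ e).2.2.1 _).trans (not_congr (ih hA e))
  | and A B ihA ihB => exact ((hZ e).2.2.2.1 _ _).trans (and_congr (ihA hA.1 e) (ihB hA.2 e))
  | or A B ihA ihB => exact ((hZ e).2.2.2.2.1 _ _).trans (or_congr (ihA hA.1 e) (ihB hA.2 e))
  | imp A B => exact hA.elim
  | ex A ih =>
    refine ((hZ e).2.2.2.2.2.1 _).trans (exists_congr fun n => (ih hA _).trans ?_)
    rw [← push_getD]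
    rfl
  | all A ih =>
    refine ((hZ e).2.2.2.2.2.2 _).trans (forall_congr' fun n => (ih hA _).trans ?_)
    rw [← push_getD]
    rfl

/-! ### Arithmetical clauses for witnesses -/

/-- The pairs of `D` with first inputs `i` and first outputs `o`, these being removed. -/
noncomputable def Cand.restrict (D : InOut → Prop) (i o : List ℕ) : Cand :=
  .ofSet {p | D (i ++ p.1, o ++ p.2)}

namespace Cand

variable {D : InOut → Prop} {i o i' o' : List ℕ} {W : Cand} {n : ℕ}

theorem has_restrict : (restrict D i o).Has (i', o') ↔ D (i ++ i', o ++ o') := has_ofSet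

theorem has_restrict_onInput (p : InOut) :
    ((restrict D i o).onInput n).Has p ↔ (restrict D (i ++ [n]) o).Has p := by
  rw [has_onInput, has_restrict, has_restrict, List.append_assoc]
  rfl

theorem has_restrict_onOutput (p : InOut) :
    ((restrict D i o).onOutput n).Has p ↔ (restrict D i (o ++ [n])).Has p := by
  rw [has_onOutput, has_restrict, has_restrict, List.append_assoc]
  rfl

theorem gives_restrict : (restrict D i o).Gives n ↔ ∃ i' o', D (i ++ i', o ++ n :: o') := by
  simp only [gives_iff, has_restrict]

theorem forall_restrict {S : InOut → Prop} :
    (∀ k p, restrict D i o k = some p → S p) ↔ ∀ i' o', D (i ++ i', o ++ o') → S (i', o') := by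
  simp only [← has_restrict]
  constructor
  · rintro h i' o' ⟨k, hk⟩
    exact h k _ hk
  · exact fun h k p hk => h p.1 p.2 ⟨k, hk⟩

end Cand

namespace Form

variable {A B : ArithForm} {V W : Cand} {e : ℕ → ℕ} {D : InOut → Prop} {i o : List ℕ}

theorem wellFormed_congr (h : ∀ p, V.Has p ↔ W.Has p) : A.WellFormed V ↔ A.WellFormed W :=
  ⟨fun hV => hV.mono fun p hp => .inr ((h p).2 hp), fun hW => hW.mono fun p hp => .inr ((h p).1 hp)⟩

theorem correct_congr_has (h : ∀ p, V.Has p ↔ W.Has p) : A.Correct e V ↔ A.Correct e W :=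
  ⟨fun hV => hV.mono fun p hp => (h p).1 hp, fun hW => hW.mono fun p hp => (h p).2 hp⟩

theorem wellFormed_onInput_restrict (n : ℕ) : A.WellFormed ((Cand.restrict D i o).onInput n) ↔
    A.WellFormed (Cand.restrict D (i ++ [n]) o) :=
  wellFormed_congr Cand.has_restrict_onInput

theorem wellFormed_onOutput_restrict (n : ℕ) : A.WellFormed ((Cand.restrict D i o).onOutput n) ↔
    A.WellFormed (Cand.restrict D i (o ++ [n])) :=
  wellFormed_congr Cand.has_restrict_onOutput

theorem correct_onInput_restrict (n : ℕ) : A.Correct e ((Cand.restrict D i o).onInput n) ↔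
    A.Correct e (Cand.restrict D (i ++ [n]) o) :=
  correct_congr_has Cand.has_restrict_onInput

theorem correct_onOutput_restrict (n : ℕ) : A.Correct e ((Cand.restrict D i o).onOutput n) ↔
    A.Correct e (Cand.restrict D i (o ++ [n])) :=
  correct_congr_has Cand.has_restrict_onOutput

end Form

/-- At most one first output occurs. -/
def UniqueOutput (D : InOut → Prop) (i o : List ℕ) : Prop :=
  ∀ (m n : ℕ) (i' o' i'' o'' : List ℕ), D (i ++ i', o ++ m :: o') → D (i ++ i'', o ++ n :: o'') →
    m = n

theorem Cand.uniqueOutput_iff {D : InOut → Prop} {i o : List ℕ} :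
    (∀ m n, (restrict D i o).Gives m → (restrict D i o).Gives n → m = n) ↔ UniqueOutput D i o := by
  simp only [gives_restrict]
  exact ⟨fun h m n i' o' i'' o'' hm hn => h m n ⟨i', o', hm⟩ ⟨i'', o'', hn⟩,
    fun h m n ⟨_, _, hm⟩ ⟨_, _, hn⟩ => h m n _ _ _ _ hm hn⟩

/-- `Z` is the relation of well-formedness of the parts of `D` for formulas without `→`. -/
def WellFormedClauses (D : InOut → Prop) (Z : Set ℕ) : Prop := ∀ i o : List ℕ,
  (∀ j x : ℕ, j < 3 → (encode (Nat.pair j x, i, o) ∈ Z ↔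
    ∀ i' o' : List ℕ, D (i ++ i', o ++ o') → i' = [] ∧ o' = [])) ∧
  (∀ a b : ℕ, encode (Nat.pair 3 (Nat.pair a b), i, o) ∈ Z ↔
    (∀ i' o' : List ℕ, D (i ++ i', o ++ o') → (i' = [] ∧ o' = []) ∨
      ∃ (j : ℕ) (k : List ℕ), j < 2 ∧ i' = j :: k) ∧
    encode (a, i ++ [0], o) ∈ Z ∧ encode (b, i ++ [1], o) ∈ Z) ∧
  (∀ a b : ℕ, encode (Nat.pair 4 (Nat.pair a b), i, o) ∈ Z ↔
    (∀ i' o' : List ℕ, D (i ++ i', o ++ o') → (i' = [] ∧ o' = []) ∨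
      ∃ (j : ℕ) (k : List ℕ), j < 2 ∧ o' = j :: k) ∧
    UniqueOutput D i o ∧ encode (a, i, o ++ [0]) ∈ Z ∧ encode (b, i, o ++ [1]) ∈ Z) ∧
  (∀ a : ℕ, encode (Nat.pair 6 a, i, o) ∈ Z ↔
    (∀ i' o' : List ℕ, D (i ++ i', o ++ o') → (i' = [] ∧ o' = []) ∨
      ∃ (j : ℕ) (k : List ℕ), o' = j :: k) ∧
    UniqueOutput D i o ∧ ∀ n : ℕ, encode (a, i, o ++ [n]) ∈ Z) ∧
  (∀ a : ℕ, encode (Nat.pair 7 a, i, o) ∈ Z ↔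
    (∀ i' o' : List ℕ, D (i ++ i', o ++ o') → (i' = [] ∧ o' = []) ∨
      ∃ (j : ℕ) (k : List ℕ), i' = j :: k) ∧
    ∀ n : ℕ, encode (a, i ++ [n], o) ∈ Z)

/-- `Z` is the relation of correctness of the parts of `D` for formulas without `→`. -/
def CorrectClauses (D : InOut → Prop) (S Z : Set ℕ) : Prop := ∀ e i o : List ℕ,
  (∀ j x : ℕ, j < 3 → (encode (Nat.pair j x, e, i, o) ∈ Z ↔ encode (Nat.pair j x, e) ∈ S)) ∧
  (∀ a b : ℕ, encode (Nat.pair 3 (Nat.pair a b), e, i, o) ∈ Z ↔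
    encode (a, e, i ++ [0], o) ∈ Z ∧ encode (b, e, i ++ [1], o) ∈ Z) ∧
  (∀ a b : ℕ, encode (Nat.pair 4 (Nat.pair a b), e, i, o) ∈ Z ↔
    ((∃ i' o' : List ℕ, D (i ++ i', o ++ 0 :: o')) ∧ encode (a, e, i, o ++ [0]) ∈ Z) ∨
    ((∃ i' o' : List ℕ, D (i ++ i', o ++ 1 :: o')) ∧ encode (b, e, i, o ++ [1]) ∈ Z)) ∧
  (∀ a : ℕ, encode (Nat.pair 6 a, e, i, o) ∈ Z ↔
    ∃ n : ℕ, (∃ i' o' : List ℕ, D (i ++ i', o ++ n :: o')) ∧ encode (a, n :: e, i, o ++ [n]) ∈ Z) ∧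
  (∀ a : ℕ, encode (Nat.pair 7 a, e, i, o) ∈ Z ↔ ∀ n : ℕ, encode (a, n :: e, i ++ [n], o) ∈ Z)

namespace Form

variable {A B : ArithForm} {e : ℕ → ℕ} {D : InOut → Prop} {i o : List ℕ}

theorem wellFormed_restrict_leaf : (∀ k p, Cand.restrict D i o k = some p → p = ([], [])) ↔
    ∀ i' o' : List ℕ, D (i ++ i', o ++ o') → i' = [] ∧ o' = [] := by
  rw [Cand.forall_restrict]
  simp only [Prod.mk.injEq]

theorem wellFormed_restrict_and : (and A B).WellFormed (Cand.restrict D i o) ↔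
    (∀ i' o' : List ℕ, D (i ++ i', o ++ o') → (i' = [] ∧ o' = []) ∨
      ∃ (j : ℕ) (k : List ℕ), j < 2 ∧ i' = j :: k) ∧
    A.WellFormed (Cand.restrict D (i ++ [0]) o) ∧ B.WellFormed (Cand.restrict D (i ++ [1]) o) := by
  rw [WellFormed, Cand.forall_restrict]
  simp [wellFormed_onInput_restrict]

theorem wellFormed_restrict_or : (or A B).WellFormed (Cand.restrict D i o) ↔
    (∀ i' o' : List ℕ, D (i ++ i', o ++ o') → (i' = [] ∧ o' = []) ∨
      ∃ (j : ℕ) (k : List ℕ), j < 2 ∧ o' = j :: k) ∧ UniqueOutput D i o ∧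
    A.WellFormed (Cand.restrict D i (o ++ [0])) ∧ B.WellFormed (Cand.restrict D i (o ++ [1])) := by
  rw [WellFormed, Cand.forall_restrict, Cand.uniqueOutput_iff]
  simp [wellFormed_onOutput_restrict]

theorem wellFormed_restrict_ex : (ex A).WellFormed (Cand.restrict D i o) ↔
    (∀ i' o' : List ℕ, D (i ++ i', o ++ o') → (i' = [] ∧ o' = []) ∨
      ∃ (j : ℕ) (k : List ℕ), o' = j :: k) ∧ UniqueOutput D i o ∧
    ∀ n, A.WellFormed (Cand.restrict D i (o ++ [n])) := by
  rw [WellFormed, Cand.forall_restrict, Cand.uniqueOutput_iff]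
  simp [wellFormed_onOutput_restrict]

theorem wellFormed_restrict_all : (all A).WellFormed (Cand.restrict D i o) ↔
    (∀ i' o' : List ℕ, D (i ++ i', o ++ o') → (i' = [] ∧ o' = []) ∨
      ∃ (j : ℕ) (k : List ℕ), i' = j :: k) ∧
    ∀ n, A.WellFormed (Cand.restrict D (i ++ [n]) o) := by
  rw [WellFormed, Cand.forall_restrict]
  simp [wellFormed_onInput_restrict]

theorem correct_restrict_and : (and A B).Correct e (Cand.restrict D i o) ↔
    A.Correct e (Cand.restrict D (i ++ [0]) o) ∧ B.Correct e (Cand.restrict D (i ++ [1]) o) := by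
  simp only [Correct, correct_onInput_restrict]

theorem correct_restrict_or : (or A B).Correct e (Cand.restrict D i o) ↔
    ((∃ i' o' : List ℕ, D (i ++ i', o ++ 0 :: o')) ∧ A.Correct e (Cand.restrict D i (o ++ [0]))) ∨
    ((∃ i' o' : List ℕ, D (i ++ i', o ++ 1 :: o')) ∧ B.Correct e (Cand.restrict D i (o ++ [1]))) := by
  simp only [Correct, correct_onOutput_restrict, Cand.gives_restrict]

theorem correct_restrict_ex : (ex A).Correct e (Cand.restrict D i o) ↔
    ∃ n : ℕ, (∃ i' o' : List ℕ, D (i ++ i', o ++ n :: o')) ∧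
      A.Correct (push n e) (Cand.restrict D i (o ++ [n])) := by
  simp only [Correct, correct_onOutput_restrict, Cand.gives_restrict]

theorem correct_restrict_all : (all A).Correct e (Cand.restrict D i o) ↔
    ∀ n : ℕ, A.Correct (push n e) (Cand.restrict D (i ++ [n]) o) := by
  simp only [Correct, correct_onInput_restrict]

/-- The formulas that are not decomposed by witnesses. -/
theorem exists_leaf_ofCode {j : ℕ} (hj : j < 3) (x : ℕ) :
    (∀ W, (ofCode (Nat.pair j x)).WellFormed W ↔ ∀ k p, W k = some p → p = ([], [])) ∧
    ∀ e W, (ofCode (Nat.pair j x)).Correct e W ↔ (ofCode (Nat.pair j x)).IsTrue e := by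
  obtain ⟨s, t, rfl⟩ : ∃ s t, x = Nat.pair s t := ⟨_, _, (Nat.pair_unpair x).symm⟩
  interval_cases j
  · rw [ofCode_eq]
    exact ⟨fun _ => Iff.rfl, fun _ _ => Iff.rfl⟩
  · rw [ofCode_lt]
    exact ⟨fun _ => Iff.rfl, fun _ _ => Iff.rfl⟩
  · rw [ofCode_neg]
    exact ⟨fun _ => Iff.rfl, fun _ _ => Iff.rfl⟩

end Form

theorem exists_wellFormedClauses (D : InOut → Prop) : ∃ Z, WellFormedClauses D Z := by
  refine ⟨{k | ∃ x : ℕ × List ℕ × List ℕ, encode x = k ∧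
    (Form.ofCode x.1).WellFormed (Cand.restrict D x.2.1 x.2.2)}, fun i o => ?_⟩
  simp only [mem_setOf_encode, Form.ofCode_and, Form.ofCode_or, Form.ofCode_ex, Form.ofCode_all]
  refine ⟨fun j x hj => ?_, fun a b => Form.wellFormed_restrict_and,
    fun a b => Form.wellFormed_restrict_or, fun a => Form.wellFormed_restrict_ex,
    fun a => Form.wellFormed_restrict_all⟩
  rw [(Form.exists_leaf_ofCode hj x).1, Form.wellFormed_restrict_leaf]

theorem exists_correctClauses (D : InOut → Prop) {S : Set ℕ} (hS : ∀ (c : ℕ) (e : List ℕ),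
    encode (c, e) ∈ S ↔ (Form.ofCode c).IsTrue fun k => e.getD k 0) : ∃ Z, CorrectClauses D S Z := by
  refine ⟨{k | ∃ x : ℕ × List ℕ × List ℕ × List ℕ, encode x = k ∧
    (Form.ofCode x.1).Correct (fun k => x.2.1.getD k 0) (Cand.restrict D x.2.2.1 x.2.2.2)},
    fun e i o => ?_⟩
  simp only [mem_setOf_encode, Form.ofCode_and, Form.ofCode_or, Form.ofCode_ex, Form.ofCode_all,
    ← push_getD]
  refine ⟨fun j x hj => ?_, fun a b => Form.correct_restrict_and,
    fun a b => Form.correct_restrict_or, fun a => Form.correct_restrict_ex,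
    fun a => Form.correct_restrict_all⟩
  rw [(Form.exists_leaf_ofCode hj x).2, hS]

theorem WellFormedClauses.mem_iff {D : InOut → Prop} {Z : Set ℕ} (hZ : WellFormedClauses D Z)
    {A : ArithForm} (hA : A.ImpFree) (i o : List ℕ) :
    encode (A.code, i, o) ∈ Z ↔ A.WellFormed (Cand.restrict D i o) := by
  induction A generalizing i o with
  | eq s t => exact ((hZ i o).1 0 _ (by simp)).trans Form.wellFormed_restrict_leaf.symm
  | lt s t => exact ((hZ i o).1 1 _ (by simp)).trans Form.wellFormed_restrict_leaf.symm
  | pred p => exact p.elim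
  | neg A => exact ((hZ i o).1 2 _ (by simp)).trans Form.wellFormed_restrict_leaf.symm
  | and A B ihA ihB =>
    exact ((hZ i o).2.1 _ _).trans ((and_congr_right fun _ => and_congr (ihA hA.1 _ _)
      (ihB hA.2 _ _)).trans Form.wellFormed_restrict_and.symm)
  | or A B ihA ihB =>
    exact ((hZ i o).2.2.1 _ _).trans ((and_congr_right fun _ => and_congr_right fun _ =>
      and_congr (ihA hA.1 _ _) (ihB hA.2 _ _)).trans Form.wellFormed_restrict_or.symm)
  | imp A B => exact hA.elim
  | ex A ih =>
    exact ((hZ i o).2.2.2.1 _).trans ((and_congr_right fun _ => and_congr_right fun _ =>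
      forall_congr' fun n => ih hA _ _).trans Form.wellFormed_restrict_ex.symm)
  | all A ih =>
    exact ((hZ i o).2.2.2.2 _).trans ((and_congr_right fun _ =>
      forall_congr' fun n => ih hA _ _).trans Form.wellFormed_restrict_all.symm)

theorem CorrectClauses.mem_iff {D : InOut → Prop} {T S Z : Set ℕ} (hZ : CorrectClauses D S Z)
    (hT : TermEval T) (hS : FormSat T S) {A : ArithForm} (hA : A.ImpFree) (e i o : List ℕ) :
    encode (A.code, e, i, o) ∈ Z ↔ A.Correct (fun k => e.getD k 0) (Cand.restrict D i o) := by
  induction A generalizing e i o with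
  | eq s t => exact ((hZ e i o).1 0 _ (by simp)).trans (hS.mem_iff hT hA e)
  | lt s t => exact ((hZ e i o).1 1 _ (by simp)).trans (hS.mem_iff hT hA e)
  | pred p => exact p.elim
  | neg A => exact ((hZ e i o).1 2 _ (by simp)).trans (hS.mem_iff (A := .neg A) hT hA e)
  | and A B ihA ihB =>
    exact ((hZ e i o).2.1 _ _).trans ((and_congr (ihA hA.1 _ _ _)
      (ihB hA.2 _ _ _)).trans Form.correct_restrict_and.symm)
  | or A B ihA ihB =>
    exact ((hZ e i o).2.2.1 _ _).trans ((or_congr (and_congr_right fun _ => ihA hA.1 _ _ _)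
      (and_congr_right fun _ => ihB hA.2 _ _ _)).trans Form.correct_restrict_or.symm)
  | imp A B => exact hA.elim
  | ex A ih =>
    refine ((hZ e i o).2.2.2.1 _).trans ((exists_congr fun n => and_congr_right fun _ =>
      ?_).trans Form.correct_restrict_ex.symm)
    rw [push_getD]
    exact ih hA _ _ _
  | all A ih =>
    refine ((hZ e i o).2.2.2.2 _).trans ((forall_congr' fun n => ?_).trans
      Form.correct_restrict_all.symm)
    rw [push_getD]
    exact ih hA _ _ _

/-! ### Definability of the clauses -/

section

variable {α : Type} [Primcodable α]

theorem arithDef_termNumbers (p : ℕ) : ArithDef fun I (_ : α) => TermNumbers (I p) := by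
  refine .all (.all (.iff (.mem p ?_) (.or (.ex (.and (.lt ?_ ?_) (.eq ?_ ?_))) (.or (.eq ?_ ?_)
    (.or (.eq ?_ ?_) (.ex (.ex (.and (.mem p ?_) (.and (.mem p ?_) (.or (.eq ?_ ?_)
      (.eq ?_ ?_))))))))))) <;> fun_prop

theorem arithDef_formNumbers (p q : ℕ) : ArithDef fun I (_ : α) => FormNumbers (I p) (I q) := by
  refine .all (.all (.iff (.mem q ?_) (.or
    (.ex (.ex (.and (.mem p ?_) (.and (.mem p ?_) (.or (.eq ?_ ?_) (.eq ?_ ?_))))))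
    (.or (.ex (.and (.mem q ?_) (.eq ?_ ?_)))
    (.or (.ex (.ex (.and (.mem q ?_) (.and (.mem q ?_) (.or (.eq ?_ ?_) (.eq ?_ ?_))))))
    (.ex (.and (.mem q ?_) (.or (.eq ?_ ?_) (.eq ?_ ?_))))))))) <;> fun_prop

theorem arithDef_termEval (p : ℕ) : ArithDef fun I (_ : α) => TermEval (I p) := by
  refine .all (.all (.and (.all (.iff (.mem p ?_) (.eq ?_ ?_))) (.and (.iff (.mem p ?_) (.eq ?_ ?_))
    (.and (.iff (.mem p ?_) (.eq ?_ ?_)) (.and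
      (.all (.all (.iff (.mem p ?_) (.ex (.ex (.and (.mem p ?_) (.and (.mem p ?_) (.eq ?_ ?_))))))))
      (.all (.all (.iff (.mem p ?_)
        (.ex (.ex (.and (.mem p ?_) (.and (.mem p ?_) (.eq ?_ ?_)))))))))))))
    <;> fun_prop

theorem arithDef_formSat (p q : ℕ) : ArithDef fun I (_ : α) => FormSat (I p) (I q) := by
  refine .all (.and
    (.all (.all (.iff (.mem q ?_) (.ex (.ex (.and (.mem p ?_) (.and (.mem p ?_) (.eq ?_ ?_))))))))
    (.and
    (.all (.all (.iff (.mem q ?_) (.ex (.ex (.and (.mem p ?_) (.and (.mem p ?_) (.lt ?_ ?_))))))))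
    (.and (.all (.iff (.mem q ?_) (.not (.mem q ?_))))
    (.and (.all (.all (.iff (.mem q ?_) (.and (.mem q ?_) (.mem q ?_)))))
    (.and (.all (.all (.iff (.mem q ?_) (.or (.mem q ?_) (.mem q ?_)))))
    (.and (.all (.iff (.mem q ?_) (.ex (.mem q ?_))))
    (.all (.iff (.mem q ?_) (.all (.mem q ?_)))))))))) <;> fun_prop

variable {D : (ℕ → Set ℕ) → α → InOut → Prop}

theorem arithDef_wellFormedClauses (hD : ArithDef fun I (x : α × InOut) => D I x.1 x.2) (p : ℕ) :
    ArithDef fun I a => WellFormedClauses (D I a) (I p) := by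
  have hD' : ∀ {β : Type} [Primcodable β] {f : β → α} {g h : β → List ℕ}, Computable f →
      Computable g → Computable h → ArithDef fun I b => D I (f b) (g b, h b) :=
    fun hf hg hh => hD.comp (hf.pair (hg.pair hh))
  have hU : ArithDef fun I (x : α × List ℕ × List ℕ) => UniqueOutput (D I x.1) x.2.1 x.2.2 := by
    refine .all (.all (.all (.all (.all (.all (.imp (hD' ?_ ?_ ?_) (.imp (hD' ?_ ?_ ?_)
      (.eq ?_ ?_)))))))) <;> fun_prop
  have hU' : ∀ {β : Type} [Primcodable β] {f : β → α} {g h : β → List ℕ}, Computable f →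
      Computable g → Computable h → ArithDef fun I b => UniqueOutput (D I (f b)) (g b) (h b) :=
    fun hf hg hh => hU.comp (hf.pair (hg.pair hh))
  refine .all (.all (.and ?_ (.and ?_ (.and ?_ (.and ?_ ?_)))))
  · refine .all (.all (.imp (.lt ?_ ?_) (.iff (.mem p ?_) (.all (.all (.imp (hD' ?_ ?_ ?_)
      (.and (.eq ?_ ?_) (.eq ?_ ?_)))))))) <;> fun_prop
  · refine .all (.all (.iff (.mem p ?_) (.and (.all (.all (.imp (hD' ?_ ?_ ?_)
      (.or (.and (.eq ?_ ?_) (.eq ?_ ?_)) (.ex (.ex (.and (.lt ?_ ?_) (.eq ?_ ?_))))))))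
      (.and (.mem p ?_) (.mem p ?_))))) <;> fun_prop
  · refine .all (.all (.iff (.mem p ?_) (.and (.all (.all (.imp (hD' ?_ ?_ ?_)
      (.or (.and (.eq ?_ ?_) (.eq ?_ ?_)) (.ex (.ex (.and (.lt ?_ ?_) (.eq ?_ ?_))))))))
      (.and (hU' ?_ ?_ ?_) (.and (.mem p ?_) (.mem p ?_)))))) <;> fun_prop
  · refine .all (.iff (.mem p ?_) (.and (.all (.all (.imp (hD' ?_ ?_ ?_)
      (.or (.and (.eq ?_ ?_) (.eq ?_ ?_)) (.ex (.ex (.eq ?_ ?_)))))))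
      (.and (hU' ?_ ?_ ?_) (.all (.mem p ?_))))) <;> fun_prop
  · refine .all (.iff (.mem p ?_) (.and (.all (.all (.imp (hD' ?_ ?_ ?_)
      (.or (.and (.eq ?_ ?_) (.eq ?_ ?_)) (.ex (.ex (.eq ?_ ?_)))))))
      (.all (.mem p ?_)))) <;> fun_prop

theorem arithDef_correctClauses (hD : ArithDef fun I (x : α × InOut) => D I x.1 x.2) (p q : ℕ) :
    ArithDef fun I a => CorrectClauses (D I a) (I p) (I q) := by
  have hD' : ∀ {β : Type} [Primcodable β] {f : β → α} {g h : β → List ℕ}, Computable f →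
      Computable g → Computable h → ArithDef fun I b => D I (f b) (g b, h b) :=
    fun hf hg hh => hD.comp (hf.pair (hg.pair hh))
  refine .all (.all (.all (.and ?_ (.and ?_ (.and ?_ (.and ?_ ?_))))))
  · refine .all (.all (.imp (.lt ?_ ?_) (.iff (.mem q ?_) (.mem p ?_)))) <;> fun_prop
  · refine .all (.all (.iff (.mem q ?_) (.and (.mem q ?_) (.mem q ?_)))) <;> fun_prop
  · refine .all (.all (.iff (.mem q ?_) (.or (.and (.ex (.ex (hD' ?_ ?_ ?_))) (.mem q ?_))
      (.and (.ex (.ex (hD' ?_ ?_ ?_))) (.mem q ?_))))) <;> fun_prop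
  · refine .all (.iff (.mem q ?_) (.ex (.and (.ex (.ex (hD' ?_ ?_ ?_))) (.mem q ?_)))) <;> fun_prop
  · refine .all (.iff (.mem q ?_) (.all (.mem q ?_))) <;> fun_prop

end

/-! ### The upper bound -/

/-- `G` is the graph of a candidate. -/
def FunctionalGraph (G : Set ℕ) : Prop :=
  ∀ (k : ℕ) (p q : InOut), encode (k, p) ∈ G → encode (k, q) ∈ G → p = q

/-- The pair `p` occurs in the candidate with the graph `G`. -/
def GraphHas (G : Set ℕ) (p : InOut) : Prop := ∃ k : ℕ, encode (k, p) ∈ G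

/-- `σ` is an initial segment of the candidate with the graph `G`. -/
def GraphSegment (G : Set ℕ) (σ : List (Option InOut)) : Prop :=
  ∀ (k : ℕ) (x : Option InOut), σ[k]? = some x → ∀ p : InOut, x = some p ↔ encode (k, p) ∈ G

/-- The pair `p` occurs in the application of the candidate computed by `e` to the candidate with the
graph `G`. -/
def GraphApp (e : Nat.Partrec.Code) (G : Set ℕ) (p : InOut) : Prop :=
  ∃ (σ : List (Option InOut)) (k : ℕ), GraphSegment G σ ∧
    encode (some ((encode σ :: p.1, p.2) : InOut)) ∈ e.eval k

/-- The sets in the sequence `I` are a candidate, and the syntactic and semantic relations that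
determine whether this candidate and the application of `e` to it are witnesses. -/
def SemanticClauses (I : ℕ → Set ℕ) (e : Nat.Partrec.Code) : Prop :=
  FunctionalGraph (I 0) ∧ TermNumbers (I 1) ∧ FormNumbers (I 1) (I 2) ∧ TermEval (I 3) ∧
  FormSat (I 3) (I 4) ∧
  WellFormedClauses (GraphHas (I 0)) (I 5) ∧ CorrectClauses (GraphHas (I 0)) (I 4) (I 6) ∧
  WellFormedClauses (GraphApp e (I 0)) (I 7) ∧ CorrectClauses (GraphApp e (I 0)) (I 4) (I 8)

/-- According to `I`, the candidate computed by `e` satisfies the conditions on a witness of the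
implication with number `n` from `a` to `b`. -/
def WitnessConditions (I : ℕ → Set ℕ) (n a b : ℕ) (e : Nat.Partrec.Code) : Prop :=
  n = Nat.pair 5 (Nat.pair a b) ∧ encode ((0 : ℕ), a) ∈ I 2 ∧ encode ((0 : ℕ), b) ∈ I 2 ∧
  (∀ k : ℕ, ∃ x : Option InOut, encode x ∈ e.eval k) ∧
  (∀ (k : ℕ) (i o : List ℕ), encode (some ((i, o) : InOut)) ∈ e.eval k → (i = [] ∧ o = []) ∨
    ∃ (σ : List (Option InOut)) (i' : List ℕ), i = encode σ :: i') ∧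
  (encode (a, ([] : List ℕ), ([] : List ℕ)) ∈ I 5 →
    encode (b, ([] : List ℕ), ([] : List ℕ)) ∈ I 7 ∧
    (encode (a, ([] : List ℕ), ([] : List ℕ), ([] : List ℕ)) ∈ I 6 →
      encode (b, ([] : List ℕ), ([] : List ℕ), ([] : List ℕ)) ∈ I 8))

theorem ArithDef.mem_eval {P α : Type} [Primcodable α] {f : α → Nat.Partrec.Code} {g h : α → ℕ}
    (hf : Computable f) (hg : Computable g) (hh : Computable h) :
    ArithDef (P := P) fun _ a => h a ∈ (f a).eval (g a) :=
  (ArithDef.mem_partrec Nat.Partrec.Code.eval_part).comp (f := fun a => ((f a, g a), h a))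
    ((hf.pair hg).pair hh)

theorem arithDef_semanticClauses :
    ArithDef fun I (e : Nat.Partrec.Code) => SemanticClauses I e := by
  have hG : ArithDef fun I (x : Nat.Partrec.Code × InOut) => GraphHas (I 0) x.2 :=
    .ex (.mem 0 (by fun_prop))
  have hS : ArithDef fun I (x : List (Option InOut)) => GraphSegment (I 0) x := by
    refine .all (.all (.imp (.eq ?_ ?_) (.all (.iff (.eq ?_ ?_) (.mem 0 ?_))))) <;> fun_prop
  have hA : ArithDef fun I (x : Nat.Partrec.Code × InOut) => GraphApp x.1 (I 0) x.2 := by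
    refine .ex (.ex (.and (hS.comp (f := fun x : ((Nat.Partrec.Code × InOut) ×
      List (Option InOut)) × ℕ => x.1.2) ?_) (.mem_eval ?_ ?_ ?_))) <;> fun_prop
  refine .and (.all (.all (.all (.imp (.mem 0 ?_) (.imp (.mem 0 ?_) (.eq ?_ ?_)))))) (.and
    (arithDef_termNumbers 1) (.and (arithDef_formNumbers 1 2) (.and (arithDef_termEval 3) (.and
      (arithDef_formSat 3 4) (.and (arithDef_wellFormedClauses hG 5) (.and
        (arithDef_correctClauses hG 4 6) (.and (arithDef_wellFormedClauses hA 7)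
          (arithDef_correctClauses hA 4 8)))))))) <;> fun_prop

theorem arithDef_witnessConditions : ArithDef fun I (x : ℕ × ℕ × ℕ × Nat.Partrec.Code) =>
    WitnessConditions I x.1 x.2.1 x.2.2.1 x.2.2.2 := by
  refine .and (.eq ?_ ?_) (.and (.mem 2 ?_) (.and (.mem 2 ?_) (.and (.all (.ex (.mem_eval ?_ ?_ ?_)))
    (.and (.all (.all (.all (.imp (.mem_eval ?_ ?_ ?_) (.or (.and (.eq ?_ ?_) (.eq ?_ ?_))
      (.ex (.ex (.eq ?_ ?_))))))))
    (.imp (.mem 5 ?_) (.and (.mem 7 ?_) (.imp (.mem 6 ?_) (.mem 8 ?_)))))))) <;> fun_prop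

theorem exists_semanticClauses (X : Cand) (e : Nat.Partrec.Code) : ∃ I : ℕ → Set ℕ,
    SemanticClauses I e ∧ ∀ (k : ℕ) (p : InOut), encode (k, p) ∈ I 0 ↔ X k = some p := by
  obtain ⟨TT, hTT⟩ := exists_termNumbers
  obtain ⟨FF, hFF⟩ := exists_formNumbers hTT
  obtain ⟨T, hT, hT'⟩ := exists_termEval
  obtain ⟨S, hS, hS'⟩ := exists_formSat hT'
  let G : Set ℕ := {m | ∃ x : ℕ × InOut, encode x = m ∧ X x.1 = some x.2}
  have hG : ∀ (k : ℕ) (p : InOut), encode (k, p) ∈ G ↔ X k = some p := fun k p =>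
    mem_setOf_encode (p := fun x : ℕ × InOut => X x.1 = some x.2)
  obtain ⟨F, hF⟩ := exists_wellFormedClauses (GraphHas G)
  obtain ⟨C, hC⟩ := exists_correctClauses (GraphHas G) hS'
  obtain ⟨F', hF'⟩ := exists_wellFormedClauses (GraphApp e G)
  obtain ⟨C', hC'⟩ := exists_correctClauses (GraphApp e G) hS'
  refine ⟨fun p => [G, TT, FF, T, S, F, C, F', C'].getD p ∅, ⟨?_, hTT, hFF, hT, hS, hF, hC, hF', hC'⟩,
    hG⟩
  intro k p q hp hq
  exact Option.some.inj (((hG k p).1 hp).symm.trans ((hG k q).1 hq))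

theorem graphHas_iff {X : Cand} {G : Set ℕ}
    (hG : ∀ (k : ℕ) (p : InOut), encode (k, p) ∈ G ↔ X k = some p) (p : InOut) :
    GraphHas G p ↔ X.Has p := exists_congr fun k => hG k p

theorem graphSegment_iff {X : Cand} {G : Set ℕ}
    (hG : ∀ (k : ℕ) (p : InOut), encode (k, p) ∈ G ↔ X k = some p) (σ : List (Option InOut)) :
    GraphSegment G σ ↔ Cand.IsSegment σ X := by
  constructor
  · intro h
    refine List.ext_getElem? fun k => ?_
    by_cases hk : k < σ.length
    · have := h k _ (List.getElem?_eq_getElem hk)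
      simp only [hG] at this
      rw [List.getElem?_eq_getElem hk]
      simp only [List.getElem?_map, List.getElem?_range hk, Option.map_some, Option.some.injEq]
      exact Option.ext this
    · simp [hk]
  · intro h k x hx p
    rw [Cand.getElem?_of_isSegment h (List.getElem?_eq_some_iff.1 hx).1, Option.some.injEq] at hx
    rw [hG, hx]

theorem graphApp_iff {X W : Cand} {G : Set ℕ} {e : Nat.Partrec.Code}
    (hG : ∀ (k : ℕ) (p : InOut), encode (k, p) ∈ G ↔ X k = some p)
    (he : ∀ (k : ℕ) (x : Option InOut), encode x ∈ e.eval k ↔ W k = x) (p : InOut) :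
    GraphApp e G p ↔ (W.app X).Has p := by
  obtain ⟨i, o⟩ := p
  rw [Cand.has_app]
  simp only [GraphApp, graphSegment_iff hG, he, Cand.Has, exists_and_left]

theorem FunctionalGraph.exists_cand {G : Set ℕ} (hG : FunctionalGraph G) :
    ∃ X : Cand, ∀ (k : ℕ) (p : InOut), encode (k, p) ∈ G ↔ X k = some p := by
  classical
  refine ⟨fun k => if h : ∃ p : InOut, encode (k, p) ∈ G then some h.choose else none,
    fun k p => ?_⟩
  dsimp only
  by_cases h : ∃ p : InOut, encode (k, p) ∈ G
  · rw [dif_pos h, Option.some.injEq]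
    exact ⟨fun hp => hG k _ _ h.choose_spec hp, fun hp => hp ▸ h.choose_spec⟩
  · rw [dif_neg h]
    exact ⟨fun hp => (h ⟨p, hp⟩).elim, fun hp => by cases hp⟩

theorem SemanticClauses.iff {I : ℕ → Set ℕ} {e : Nat.Partrec.Code} (h : SemanticClauses I e)
    {X W : Cand} (hX : ∀ (k : ℕ) (p : InOut), encode (k, p) ∈ I 0 ↔ X k = some p)
    (he : ∀ (k : ℕ) (x : Option InOut), encode x ∈ e.eval k ↔ W k = x) {A : ArithForm}
    (hA : A.ImpFree) :
    (encode (A.code, ([] : List ℕ), ([] : List ℕ)) ∈ I 5 ↔ A.WellFormed X) ∧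
    (encode (A.code, ([] : List ℕ), ([] : List ℕ), ([] : List ℕ)) ∈ I 6 ↔
      A.Correct (fun _ => 0) X) ∧
    (encode (A.code, ([] : List ℕ), ([] : List ℕ)) ∈ I 7 ↔ A.WellFormed (W.app X)) ∧
    (encode (A.code, ([] : List ℕ), ([] : List ℕ), ([] : List ℕ)) ∈ I 8 ↔
      A.Correct (fun _ => 0) (W.app X)) := by
  obtain ⟨-, -, -, hT, hS, hF, hC, hF', hC'⟩ := h
  refine ⟨(hF.mem_iff hA _ _).trans (Form.wellFormed_congr fun p => ?_),
    (hC.mem_iff hT hS hA _ _ _).trans (Form.correct_congr_has fun p => ?_),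
    (hF'.mem_iff hA _ _).trans (Form.wellFormed_congr fun p => ?_),
    (hC'.mem_iff hT hS hA _ _ _).trans (Form.correct_congr_has fun p => ?_)⟩
  · exact Cand.has_restrict.trans (graphHas_iff hX p)
  · exact Cand.has_restrict.trans (graphHas_iff hX p)
  · exact Cand.has_restrict.trans (graphApp_iff hX he p)
  · exact Cand.has_restrict.trans (graphApp_iff hX he p)

theorem isPi11_simpleConstructiveTruth : IsPi11 simpleConstructiveTruth := by
  refine isPi11_of_exists_forall (β := ℕ × ℕ × Nat.Partrec.Code)
    (R := fun I x => SemanticClauses I x.2.2.2 → WitnessConditions I x.1 x.2.1 x.2.2.1 x.2.2.2)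
    ((arithDef_semanticClauses.comp (f := fun x : ℕ × ℕ × ℕ × Nat.Partrec.Code => x.2.2.2)
      (by fun_prop)).imp arithDef_witnessConditions) fun n => ?_
  constructor
  · rintro ⟨A, B, hA, hB, hAB, ⟨W, hW, hwf, hcorr⟩, rfl⟩
    obtain ⟨e, he⟩ := Nat.Partrec.Code.exists_code.1 hW
    have he' : ∀ k, e.eval k = Part.some (encode (W k)) := fun k => by rw [he]; simp
    have he : ∀ (k : ℕ) (x : Option InOut), encode x ∈ e.eval k ↔ W k = x := fun k x => by
      rw [he', Part.mem_some_iff]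
      exact encode_injective.eq_iff.trans eq_comm
    refine ⟨(A.code, B.code, e), fun I hI => ?_⟩
    obtain ⟨X, hX⟩ := hI.1.exists_cand
    obtain ⟨h₁, h₂, -, -⟩ := hI.iff hX he hA
    obtain ⟨-, -, h₃, h₄⟩ := hI.iff hX he hB
    refine ⟨rfl, (hI.2.2.1.mem_iff hI.2.1 _ _).2 ⟨A, hA, hAB.1, rfl⟩,
      (hI.2.2.1.mem_iff hI.2.1 _ _).2 ⟨B, hB, hAB.2, rfl⟩, fun k => ⟨W k, (he k _).2 rfl⟩, ?_, ?_⟩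
    · intro k i o hk
      rcases hwf.1 k (i, o) ((he k _).1 hk) with h | ⟨σ, i', o', h⟩
      · exact .inl (by simpa using h)
      · exact .inr ⟨σ, i', (Prod.mk.inj h).1⟩
    · simp only [h₁, h₂, h₃, h₄]
      exact fun h => ⟨hwf.2 X h, hcorr X h⟩
  · rintro ⟨⟨a, b, e⟩, h⟩
    dsimp only at h
    obtain ⟨I, hI, -⟩ := exists_semanticClauses (fun _ => none) e
    obtain ⟨rfl, ha, hb, htot, hshape, -⟩ := h I hI
    obtain ⟨A, hA, hA', rfl⟩ := (hI.2.2.1.mem_iff hI.2.1 _ _).1 ha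
    obtain ⟨B, hB, hB', rfl⟩ := (hI.2.2.1.mem_iff hI.2.1 _ _).1 hb
    obtain ⟨W, hW⟩ : ∃ W : Cand, ∀ k, encode (W k) ∈ e.eval k :=
      ⟨fun k => (htot k).choose, fun k => (htot k).choose_spec⟩
    have he' : ∀ k, e.eval k = Part.some (encode (W k)) := fun k => Part.eq_some_iff.2 (hW k)
    have he : ∀ (k : ℕ) (x : Option InOut), encode x ∈ e.eval k ↔ W k = x := fun k x => by
      rw [he', Part.mem_some_iff]
      exact encode_injective.eq_iff.trans eq_comm
    have key : ∀ X : Cand, A.WellFormed X → B.WellFormed (W.app X) ∧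
        (A.Correct (fun _ => 0) X → B.Correct (fun _ => 0) (W.app X)) := by
      intro X
      obtain ⟨I, hI, hX⟩ := exists_semanticClauses X e
      obtain ⟨h₁, h₂, -, -⟩ := hI.iff hX he hA
      obtain ⟨-, -, h₃, h₄⟩ := hI.iff hX he hB
      have := (h I hI).2.2.2.2.2
      simpa only [h₁, h₂, h₃, h₄] using this
    refine ⟨A, B, hA, hB, ⟨hA', hB'⟩, ⟨W, ?_, ⟨?_, fun X hX => (key X hX).1⟩,
      fun X hX => (key X hX).2⟩, rfl⟩
    · have h₁ : Computable fun k => encode (W k) :=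
        Partrec.nat_iff.2 (Nat.Partrec.Code.exists_code.2 ⟨e, funext he'⟩)
      exact Computable.encode_iff.1 h₁
    · rintro k ⟨i, o⟩ hk
      rcases hshape k i o ((he k _).2 hk) with h | ⟨σ, i', h⟩
      · exact .inl (by simpa using h)
      · exact .inr ⟨σ, i', o, by rw [h]⟩

theorem theorem1 :
    -- constructive arithmetical truth is `Π¹₁`-hard
    Pi11Hard constructiveTruth ∧
    -- for statements `A → B` with `A` and `B` free of `→`, it is `Π¹₁`-complete
    Pi11Complete simpleConstructiveTruth ∧
    -- there are arithmetical sets `xₙ`, none of which is recursive in the other ones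
    (∃ ξ : ArithForm, ξ.ImpFree ∧ ξ.FreeBelow 2 ∧ Independent ξ.family) ∧
    -- for all such `xₙ`, well-foundedness of `T` is constructive truth of the implication
    (∀ ξ : ArithForm, ξ.FreeBelow 2 → Independent ξ.family →
      ∀ len inc tree : ArithForm, len.ExpressesLength → inc.ExpressesIncompatible →
        ∀ T : Set (List ℕ), IsSeqTree T → tree.ExpressesTree T →
          (WellFoundedTree T ↔ (Form.pathSentence ξ len tree inc).ConstructivelyTrue)) ∧
    -- this applies to all recursive trees, and the implication is computed from a program for `T`
    (∃ len inc : ArithForm, len.ImpFree ∧ inc.ImpFree ∧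
      len.ExpressesLength ∧ inc.ExpressesIncompatible ∧
      ∀ ξ : ArithForm, ξ.FreeBelow 2 →
        ∃ f : Nat.Partrec.Code → ℕ, Computable f ∧
          ∀ (c : Nat.Partrec.Code) (T : Set (List ℕ)), IsSeqTree T → Decides c T →
            ∃ tree : ArithForm, tree.ImpFree ∧ tree.ExpressesTree T ∧
              (Form.pathSentence ξ len tree inc).IsSentence ∧
              (Form.pathSentence ξ len tree inc).code = f c) := by
  refine ⟨pi11Hard_constructiveTruth.1, ⟨isPi11_simpleConstructiveTruth,
    pi11Hard_constructiveTruth.2⟩, exists_independent_family, ?_, ?_⟩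
  · intro ξ hξ hind len inc tree hlen hinc T _ htree
    refine ⟨Form.constructivelyTrue_pathSentence hξ hlen hinc htree, fun h => ?_⟩
    by_contra hT
    exact Form.not_independent_of_path hξ hlen hinc htree hT h hind
  · obtain ⟨len, hlen₁, hlen⟩ := Form.exists_expressesLength
    obtain ⟨inc, hinc₁, hinc⟩ := Form.exists_expressesIncompatible
    obtain ⟨φ, hφ, htree⟩ := Form.exists_treeForm
    refine ⟨len, inc, hlen₁, hinc₁, hlen, hinc, fun ξ _ => ⟨_,
      Form.computable_code_pathSentence ξ len inc φ, fun c T _ hc => ⟨Form.treeForm φ (encode c), ⟨trivial, hφ.rename _⟩,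
        htree c T hc, Form.pathSentence_isSentence hlen.1 (htree c T hc).1 hinc.1, rfl⟩⟩⟩
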